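/- **Setting.** Let $\{p_{i,j}\}_{-1\le i,j\le 1}$ be non-negative transition probabilities with sum $1$ such that: $p_{i,j}=p_{j,i}$ and $p_{0,0}=p_{-1,1}=p_{1,-1}=0$; in the list $p_{1,1},p_{1,0},p_{0,-1},p_{-1,-1},p_{-1,0},p_{0,1}$ there are no two consecutive zeros; and $\sum ip_{i,j}=\sum jp_{i,j}=0$. Let $f$ be a real function on $\mathcal C=\{(i,j)\in\mathbb Z^2: i\ge 0\text{ or }j\ge 0\}$ such that $f(i,j)=\sum_{i_0,j_0}p_{i_0,j_0}f(i+i_0,j+j_0)$ if $i\ge1$ or $j\ge1$; $f(i,0)=0$ for $i\le0$ and $f(0,j)=0$ for $j\le 0$; $f(i,j)>0$ if $i>0$ or $j>0$; and $f(i,j)=f(j,i)$ on $\mathcal C$. Put $D_\varphi(y)=\sum_{i\ge1}f(i,i)y^{i-1}$. The change of variables $\varphi(x,y)=(xy,x^{-1})$ turns the step $(i,j)$ into $(i-j,i)$ and gives the kernel $$K_\varphi(x,y)=xy\Big[\sum p_{i,j}x^{j-i}y^{-i}-1\Big]=\alpha_\varphi(x)y^2+\beta_\varphi(x)y+\gamma_\varphi(x)=\widetilde\alpha_\varphi(y)x^2+\widetilde\beta_\varphi(y)x+\widetilde\gamma_\varphi(y),$$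 with discriminants $\delta_\varphi=\beta_\varphi^2-4\alpha_\varphi\gamma_\varphi$ and $\widetilde\delta_\varphi=\widetilde\beta_\varphi^2-4\widetilde\alpha_\varphi\widetilde\gamma_\varphi$. Let $x_{\varphi,1}$, $y_{\varphi,1}$ be the zeros of $\delta_\varphi$, $\widetilde\delta_\varphi$ in $[-1,1)$, and let $y_{\varphi,4}$ be the zero of $\widetilde\delta_\varphi$ in $(1,\infty)$ if $\deg\widetilde\delta_\varphi=4$, and $y_{\varphi,4}=\infty$ if $\deg\widetilde\delta_\varphi=3$. Let $\mathcal L_\varphi=\{y\in\mathbb C:K_\varphi(x,y)=0\text{ for some }x\in[x_{\varphi,1},1]\}$, and let $\mathcal G_{\mathcal L_\varphi}$ be the connected component of $\mathbb C\setminus\mathcal L_\varphi$ that contains $y_{\varphi,1}$. Let $\theta_\varphi=\arccos\big(-\sum klq_{k,l}\big/\sqrt{\sum k^2q_{k,l}\cdot\sum l^2q_{k,l}}\big)$, where $q_{k,l}=p_{l,l-k}$ are the weights of the changed walk. With principal branches of the square root and of $\arcsin$, set $$\widetilde W_\varphi(y)=\sin^2\Big(\frac{\pi}{\theta_\varphi}\Big[\arcsin\widetilde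 T_\varphi(y)-\frac\pi2\Big]\Big),\qquad \widetilde T_\varphi(y)=\Big(\frac13-\frac{2r(y)}{\widetilde\delta_\varphi''(1)}\Big)^{-1/2},$$ where $r(y)=\frac{\widetilde\delta_\varphi''(y_{\varphi,4})}{6}+\frac{\widetilde\delta_\varphi'(y_{\varphi,4})}{y-y_{\varphi,4}}$ if $y_{\varphi,4}\neq\infty$ and $r(y)=\frac{\widetilde\delta_\varphi''(0)}6+\frac{\widetilde\delta_\varphi'''(0)y}6$ otherwise. Put $\widetilde w_\varphi=\widetilde W_\varphi-\widetilde W_\varphi(0)$ and $$g_\varphi(y)=h\Big(\frac{2\widetilde w_\varphi(Y_\varphi(x_{\varphi,1}))}{\widetilde w_\varphi(y)}-1\Big),\qquad h(u)=-u+\sqrt{u^2-1},$$ with the branch of $\sqrt{u^2-1}$ that is analytic on $\mathbb C\setminus[-1,1]$ and equivalent to $u$ at infinity, and with $g_\varphi=0$ where $\widetilde w_\varphi=0$. Here $Y_\varphi(x_{\varphi,1})=-\beta_\varphi(x_{\varphi,1})/(2\alpha_\varphi(x_{\varphi,1}))$; if $\alpha_\varphi(x_{\varphi,1})=0$ this point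 is $\infty$, and $\widetilde w_\varphi(\infty)$ is the limit of $\widetilde w_\varphi$ at infinity in $\overline{\mathcal G_{\mathcal L_\varphi}}$. **Lemma.** The boundary of $\mathcal G_{\mathcal L_\varphi}$ is $\mathcal L_\varphi$. The function $\widetilde w_\varphi$ is a conformal gluing function for $\mathcal G_{\mathcal L_\varphi}$: it is injective and analytic on $\mathcal G_{\mathcal L_\varphi}$, continuous on $\overline{\mathcal G_{\mathcal L_\varphi}}\setminus\{1\}$ (with a finite limit at infinity if $\mathcal G_{\mathcal L_\varphi}$ is unbounded), tends to $\infty$ at $1$, and satisfies $\widetilde w_\varphi(y)=\widetilde w_\varphi(\bar y)$ on $\mathcal L_\varphi\setminus\{1\}$. The function $g_\varphi$ is analytic on $\mathcal G_{\mathcal L_\varphi}$, $g_\varphi'$ has no zero there, and $g_\varphi/g_\varphi'$ extends continuously, with finite values, to $\overline{\mathcal G_{\mathcal L_\varphi}}\setminus\{1\}$. The series $D_\varphi(y)$ converges in the open unit disc $\mathcal D$. It can be analytically continued from $\mathcal D$ to $\mathcal G_{\mathcal L_\varphi}\cup\mathcal D$, and is continuous on $\overline{\mathcal G_{\mathcal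 L_\varphi}}\setminus\{1\}$. Moreover, for all $y\in\mathcal L_\varphi\setminus\{1\}$, $$\frac{g_\varphi(y)}{g_\varphi'(y)}D_\varphi(y)-\frac{g_\varphi(\bar y)}{g_\varphi'(\bar y)}D_\varphi(\bar y)=0,$$ where the values of $g_\varphi/g_\varphi'$ and $D_\varphi$ on the curve are those of the continuous extensions. -/

import Mathlib

open scoped Polynomial Topology

noncomputable section

namespace ThreeQuadrants

/-! ### The random walk and its harmonic function -/

/-- Transition probabilities `p i j` of a symmetric small-step walk of zero drift. -/
structure IsAdmissibleStep (p : ℤ → ℤ → ℝ) : Prop where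
  nonneg : ∀ i j, 0 ≤ p i j
  small : ∀ i j, p i j ≠ 0 → i ∈ Finset.Icc (-1) 1 ∧ j ∈ Finset.Icc (-1) 1
  sum_eq_one : ∑ i ∈ Finset.Icc (-1 : ℤ) 1, ∑ j ∈ Finset.Icc (-1 : ℤ) 1, p i j = 1
  symm : ∀ i j, p i j = p j i
  zero_zero : p 0 0 = 0
  neg_one_one : p (-1) 1 = 0
  one_neg_one : p 1 (-1) = 0
  /-- No two consecutive zeros in the list
  `p 1 1, p 1 0, p 0 (-1), p (-1) (-1), p (-1) 0, p 0 1`. -/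
  no_two_zeros : ¬ (p 1 1 = 0 ∧ p 1 0 = 0) ∧ ¬ (p 1 0 = 0 ∧ p 0 (-1) = 0) ∧
    ¬ (p 0 (-1) = 0 ∧ p (-1) (-1) = 0) ∧ ¬ (p (-1) (-1) = 0 ∧ p (-1) 0 = 0) ∧
    ¬ (p (-1) 0 = 0 ∧ p 0 1 = 0)
  drift_fst : ∑ i ∈ Finset.Icc (-1 : ℤ) 1, ∑ j ∈ Finset.Icc (-1 : ℤ) 1, (i : ℝ) * p i j = 0
  drift_snd : ∑ i ∈ Finset.Icc (-1 : ℤ) 1, ∑ j ∈ Finset.Icc (-1 : ℤ) 1, (j : ℝ) * p i j = 0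

/-- Symmetric positive discrete harmonic functions on the three-quarter plane
`{(i, j) : 0 ≤ i ∨ 0 ≤ j}`, vanishing on the two negative half-axes.
The values of `f` outside this cone play no role. -/
structure IsSymmPosHarmonic (p f : ℤ → ℤ → ℝ) : Prop where
  harmonic : ∀ i j, 1 ≤ i ∨ 1 ≤ j →
    f i j = ∑ k ∈ Finset.Icc (-1 : ℤ) 1, ∑ l ∈ Finset.Icc (-1 : ℤ) 1, p k l * f (i + k) (j + l)
  zero_fst : ∀ i, i ≤ 0 → f i 0 = 0
  zero_snd : ∀ j, j ≤ 0 → f 0 j = 0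
  pos : ∀ i j, 0 < i ∨ 0 < j → 0 < f i j
  symm : ∀ i j, 0 ≤ i ∨ 0 ≤ j → f i j = f j i

/-- The weights of the walk after the change of variable `φ(x, y) = (x y, x⁻¹)`:
the step `(i, j)` becomes the step `(i - j, i)`. -/
def phi (p : ℤ → ℤ → ℝ) (k l : ℤ) : ℝ := p l (l - k)

/-! ### Kernel, branch points, curve and domain of a small-step walk with weights `q` -/

/-- The kernel `K(x, y) = x y (∑ q i j x⁻ⁱ y⁻ʲ - 1)`, a polynomial in `x` and `y`. -/
def kernel (q : ℤ → ℤ → ℝ) (x y : ℂ) : ℂ :=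
  (∑ i ∈ Finset.Icc (-1 : ℤ) 1, ∑ j ∈ Finset.Icc (-1 : ℤ) 1,
    (q i j : ℂ) * x ^ (1 - i).toNat * y ^ (1 - j).toNat) - x * y

/-! `K(x, y) = α(x) y² + β(x) y + γ(x) = α̃(y) x² + β̃(y) x + γ̃(y)`. -/

def alpha (q : ℤ → ℤ → ℝ) : ℝ[X] :=
  Polynomial.C (q (-1) (-1)) * Polynomial.X ^ 2 + Polynomial.C (q 0 (-1)) * Polynomial.X
    + Polynomial.C (q 1 (-1))

def beta (q : ℤ → ℤ → ℝ) : ℝ[X] :=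
  Polynomial.C (q (-1) 0) * Polynomial.X ^ 2 + Polynomial.C (q 0 0 - 1) * Polynomial.X
    + Polynomial.C (q 1 0)

def gamma (q : ℤ → ℤ → ℝ) : ℝ[X] :=
  Polynomial.C (q (-1) 1) * Polynomial.X ^ 2 + Polynomial.C (q 0 1) * Polynomial.X
    + Polynomial.C (q 1 1)

/-- The weights with the two coordinates exchanged. -/
def swap (q : ℤ → ℤ → ℝ) (i j : ℤ) : ℝ := q j i

/-- The discriminant `δ = β² - 4 α γ`. -/
def delta (q : ℤ → ℤ → ℝ) : ℝ[X] := beta q ^ 2 - 4 * alpha q * gamma q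

/-- The discriminant `δ̃ = β̃² - 4 α̃ γ̃`. -/
def deltaTilde (q : ℤ → ℤ → ℝ) : ℝ[X] := delta (swap q)

theorem kernel_eq (q : ℤ → ℤ → ℝ) (x y : ℂ) :
    kernel q x y = (alpha q).aeval x * y ^ 2 + (beta q).aeval x * y + (gamma q).aeval x := by
  have h : Finset.Icc (-1 : ℤ) 1 = {-1, 0, 1} := by decide
  simp [kernel, alpha, beta, gamma, h]
  ring

theorem kernel_eq_swap (q : ℤ → ℤ → ℝ) (x y : ℂ) :
    kernel q x y = (alpha (swap q)).aeval y * x ^ 2 + (beta (swap q)).aeval y * x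
      + (gamma (swap q)).aeval y := by
  have h : Finset.Icc (-1 : ℤ) 1 = {-1, 0, 1} := by decide
  simp [kernel, swap, alpha, beta, gamma, h]
  ring

/-- The branch point `x₁` (resp. `y₁`): the zero in `[-1, 1)` of `δ` (resp. `δ̃`). -/
def branchOne (d : ℝ[X]) : ℝ := sInf {t : ℝ | t ∈ Set.Ico (-1) 1 ∧ d.eval t = 0}

/-- The branch point `y₄` of a discriminant of degree four with positive leading coefficient:
its zero in `(1, ∞)`. -/
def branchFour (d : ℝ[X]) : ℝ := sSup {t : ℝ | 1 < t ∧ d.eval t = 0}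

/-- The curve `𝓛 = {y : K(x, y) = 0 for some x ∈ [x₁, 1]}`. -/
def curveL (q : ℤ → ℤ → ℝ) : Set ℂ :=
  {y | ∃ x : ℝ, x ∈ Set.Icc (branchOne (delta q)) 1 ∧ kernel q x y = 0}

/-- The domain `𝓖_𝓛` bounded by `𝓛` that contains `y₁`. -/
def domainL (q : ℤ → ℤ → ℝ) : Set ℂ :=
  connectedComponentIn (curveL q)ᶜ (branchOne (deltaTilde q) : ℂ)

/-! ### Conformal gluing functions -/

/-- `W` is a conformal gluing function for the domain `G` bounded by the curve `M`, infinite at `1`.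
If `G` is unbounded, the continuity is that on the closure in the Riemann sphere; the last field
is vacuous when `G` is bounded. -/
structure IsConformalGluing (G M : Set ℂ) (W : ℂ → ℂ) : Prop where
  injOn : Set.InjOn W G
  analytic : AnalyticOnNhd ℂ W G
  glue : ∀ x ∈ M \ {1}, W x = W (starRingEnd ℂ x)
  continuousOn : ContinuousOn W (closure G \ {1})
  infinite_at_one : Filter.Tendsto W (𝓝[closure G \ {1}] 1) (Bornology.cobounded ℂ)
  limit_at_infinity : ∃ l : ℂ,
    Filter.Tendsto W (Bornology.cobounded ℂ ⊓ Filter.principal (closure G)) (𝓝 l)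

/-- The angle `θ` of the walk with weights `q`. -/
def angle (q : ℤ → ℤ → ℝ) : ℝ :=
  Real.arccos (-((∑ i ∈ Finset.Icc (-1 : ℤ) 1, ∑ j ∈ Finset.Icc (-1 : ℤ) 1, (i * j : ℝ) * q i j) /
    √((∑ i ∈ Finset.Icc (-1 : ℤ) 1, ∑ j ∈ Finset.Icc (-1 : ℤ) 1, (i : ℝ) ^ 2 * q i j) *
      (∑ i ∈ Finset.Icc (-1 : ℤ) 1, ∑ j ∈ Finset.Icc (-1 : ℤ) 1, (j : ℝ) ^ 2 * q i j))))

/-- The principal complex arcsine. -/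
def arcsinC (z : ℂ) : ℂ :=
  -Complex.I * Complex.log (Complex.I * z + Complex.sqrt (1 - z ^ 2))

/-- The rational function `𝔣` entering `T`, for a discriminant `d` of degree four (with the fourth
branch point in `(1, ∞)`) or three (with the fourth branch point at infinity). -/
def ratPart (d : ℝ[X]) (y : ℂ) : ℂ :=
  if d.natDegree = 4 then
    ((d.derivative.derivative.eval (branchFour d) / 6 : ℝ) : ℂ)
      + ((d.derivative.eval (branchFour d) : ℝ) : ℂ) / (y - (branchFour d : ℂ))
  else
    ((d.derivative.derivative.eval 0 / 6 : ℝ) : ℂ)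
      + ((d.derivative.derivative.derivative.eval 0 / 6 : ℝ) : ℂ) * y

/-- `T(y) = 1 / √(1/3 - 2 𝔣(y) / d''(1))`. -/
def funT (d : ℝ[X]) (y : ℂ) : ℂ :=
  1 / Complex.sqrt (1 / 3 - 2 * ratPart d y / ((d.derivative.derivative.eval 1 : ℝ) : ℂ))

/-- `W̃(y) = sin² ((π / θ) (arcsin T̃(y) - π / 2))`. -/
def gluingW (q : ℤ → ℤ → ℝ) (y : ℂ) : ℂ :=
  Complex.sin ((Real.pi / angle q : ℂ) * (arcsinC (funT (deltaTilde q) y) - Real.pi / 2)) ^ 2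

/-- `w̃ = W̃ - W̃(0)`, the gluing function that vanishes at `0`. -/
def gluingw (q : ℤ → ℤ → ℝ) (y : ℂ) : ℂ := gluingW q y - gluingW q 0

/-- The value `w̃(Y(x₁))`, where `Y(x₁) = -β(x₁) / (2 α(x₁))` is the double root of `K(x₁, ·)`.
If `α(x₁) = 0` then `Y(x₁) = ∞`, and the value is the limit of `w̃` at infinity in the (unbounded)
domain. -/
def gluingwAtY (q : ℤ → ℤ → ℝ) : ℂ :=
  if (alpha q).eval (branchOne (delta q)) = 0 then
    Filter.limUnder (Bornology.cobounded ℂ ⊓ Filter.principal (closure (domainL q))) (gluingw q)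
  else
    gluingw q ((-(beta q).eval (branchOne (delta q)) /
      (2 * (alpha q).eval (branchOne (delta q))) : ℝ) : ℂ)

/-- `h(u) = -u + √(u² - 1)`, with the branch of the root that is analytic on `ℂ ∖ [-1, 1]` and
equivalent to `u` at infinity; thus `h(u) → 0` as `u → ∞`. -/
def funh (u : ℂ) : ℂ := -u + Complex.sqrt (u - 1) * Complex.sqrt (u + 1)

/-- `g(y) = h(2 w̃(Y(x₁)) / w̃(y) - 1)`, extended by its limit `0` where `w̃(y) = 0`. -/
def gFun (q : ℤ → ℤ → ℝ) (y : ℂ) : ℂ :=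
  if gluingw q y = 0 then 0 else funh (2 * gluingwAtY q / gluingw q y - 1)

end ThreeQuadrants

end

/-! Zero drift makes the kernel curve rational, and everything follows from making its
uniformisation explicit. With the Möbius coordinates Z = (yA y + yB)/(1 - y) and U = (xA x + xB)/(1
- x), the equation K(x, y) = 0 becomes Z² + U² + 2 co Z U = 1 - co², where co = -cos θ
(`kernel_identity`). Its solutions are Z = cosh w, U = cosh(w ± iθ) (`quadratic_factor`). The
segment [x₁, 1] corresponds to U ≥ 1, so the curve is the image of the edges |Im w| = θ and the
domain is the image of the strip |Im w| < θ. The point y = 1 corresponds to Z = ∞. The function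
`level` describes both sets by a sign, because |1 + cosh w| - |cosh w - 1| = 2 cos(Im w)
(`curveL_eq`, `domainL_eq`).

With χ = π/θ, the formula for W̃ reduces to (1 - cosh χw)/2 (`gluingW_eq`). Put G = cosh(χw/2). It
has positive real part in the domain and is purely imaginary on the curve away from 1, where
conjugating y changes its sign. Writing cz for G(0), one gets w̃ = cz² - G². The value at Y(x₁) is
cz², since w = iθ there and G vanishes, and g = (G - cz)/(G + cz) (`gluingw_eq`, `gluingwAtY_eq`,
`gFun_eq`). All assertions about w̃, g and g/g' = (G² - cz²)/(2 cz G') are then read off from G,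
whose derivative has no zero (`deriv_coshPow_ne_zero`).

Convergence of the generating functions in the unit disc requires subexponential growth of f. A
compactness argument gives it: recentred copies of f at points where the growth ratio is nearly
extremal converge to a positive harmonic function on the whole lattice that is an exact exponential
in one direction. Zero drift forces the exponent to be trivial (`ratio_eq_one`, `exists_ratio_le`,
`exists_growth_bound`).

Summing the harmonicity relations on and below the diagonal gives, on K = 0 inside the unit bidisc,
D(y) ∂ₓK(x, y) = F(x), where F depends on x only (`functional_equation`). On the branch U = cosh(w -
iθ), the derivative ∂ₓK is a constant times (1 - y)² √(1 - Z²) (`kernel_deriv_branch`). The quotient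
therefore continues D to all y for which this x lies in the unit disc. The unit discs are
half-planes in Z and U, and together they account for the whole closed domain except 1 (`cover`). On
the edge w = τ + iθ, the variable x is a function of cosh τ, and the product (g/g') D depends on τ
only through cosh τ, cosh(χτ/2) and G². Conjugation replaces τ by -τ and G by -G, so the product is
unchanged (`ratio_mul_diagFun`). -/

namespace ThreeQuadrants

open Complex Filter

/-! ### The principal square root -/

theorem sqrt_sq (z : ℂ) : Complex.sqrt z ^ 2 = z := by
  simp [Complex.sqrt, Complex.cpow_ofNat_inv_pow]

theorem sqrt_re_nonneg (z : ℂ) : 0 ≤ (Complex.sqrt z).re := by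
  rw [Complex.sqrt, Complex.cpow_inv_two_re]
  exact Real.sqrt_nonneg _

theorem sqrt_re_pos {z : ℂ} (hz : z ∈ slitPlane) : 0 < (Complex.sqrt z).re := by
  rw [Complex.sqrt, Complex.cpow_inv_two_re]
  apply Real.sqrt_pos.2
  rcases hz with h | h
  · have := norm_nonneg z
    linarith
  · have := abs_re_lt_norm.2 h
    have := neg_abs_le z.re
    linarith

theorem sqrt_im_nonneg {z : ℂ} (hz : 0 ≤ z.im) : 0 ≤ (Complex.sqrt z).im := by
  rw [Complex.sqrt, Complex.cpow_inv_two_im_eq_sqrt hz]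
  exact Real.sqrt_nonneg _

theorem sqrt_im_nonpos {z : ℂ} (hz : z.im < 0) : (Complex.sqrt z).im ≤ 0 := by
  rw [Complex.sqrt, Complex.cpow_inv_two_im_eq_neg_sqrt hz]
  exact neg_nonpos.2 (Real.sqrt_nonneg _)

theorem sqrt_eq_of_sq_eq {z w : ℂ} (h : w ^ 2 = z) (hw : 0 < w.re) : Complex.sqrt z = w := by
  have h1 : Complex.sqrt z ^ 2 = w ^ 2 := by rw [sqrt_sq, h]
  rcases sq_eq_sq_iff_eq_or_eq_neg.1 h1 with h2 | h2
  · exact h2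
  · have := sqrt_re_nonneg z
    rw [h2, neg_re] at this
    linarith

theorem sq_mem_slitPlane {z : ℂ} (hz : 0 < z.re) : z ^ 2 ∈ slitPlane := by
  by_cases h : z.im = 0
  · left
    rw [sq, mul_re, h]
    nlinarith
  · right
    rw [sq, mul_im]
    have : z.re * z.im ≠ 0 := mul_ne_zero hz.ne' h
    intro h'
    apply this
    linarith

/-! ### Inverting the hyperbolic cosine in the strip -/

/-- Inversion preserves the closed left half-plane. If one of the two mutually inverse factors lay
there, so would the other, and hence their sum 2P. This keeps logarithms of P + v on the principal
branch. -/
theorem re_add_pos {P v : ℂ} (h : (P + v) * (P - v) = 1) (hP : 0 < P.re) : 0 < (P + v).re := by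
  by_contra hn
  have h1 : P - v = (P + v)⁻¹ := eq_inv_of_mul_eq_one_right h
  have h2 : (P - v).re ≤ 0 := by
    rw [h1, inv_re]
    exact div_nonpos_of_nonpos_of_nonneg (not_lt.1 hn) (normSq_nonneg _)
  rw [sub_re] at h2
  rw [add_re] at hn
  linarith

theorem cosh_two_log {P v : ℂ} (h : (P + v) * (P - v) = 1) :
    cosh (2 * log (P + v)) = 2 * P ^ 2 - 1 := by
  have h0 : P + v ≠ 0 := left_ne_zero_of_mul_eq_one h
  have h1 : P - v = (P + v)⁻¹ := eq_inv_of_mul_eq_one_right h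
  have h2 : cosh (log (P + v)) = P := by
    rw [Complex.cosh, exp_neg, exp_log h0, ← h1]
    ring
  have h3 : cosh (2 * log (P + v)) = cosh (log (P + v)) ^ 2 + sinh (log (P + v)) ^ 2 :=
    Complex.cosh_two_mul _
  have h4 := Complex.cosh_sq (log (P + v))
  rw [h3]
  rw [h2] at h4 ⊢
  linear_combination -h4

theorem abs_im_two_log_lt {E : ℂ} (hE : 0 < E.re) : |(2 * log E).im| < Real.pi := by
  have h := abs_arg_lt_pi_div_two_iff.2 (Or.inl hE)
  have h2 : (2 * log E).im = 2 * arg E := by simp [log_im]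
  rw [h2, abs_mul, abs_two]
  linarith

/-- The ambiguities of cosh are its sign symmetry and its period 2πi. The strip is too narrow for a
nonzero period. -/
theorem cosh_injOn_strip {w w' : ℂ} (hw : |w.im| < Real.pi) (hw' : |w'.im| < Real.pi)
    (h : cosh w = cosh w') : w' = w ∨ w' = -w := by
  rw [← cos_mul_I, ← cos_mul_I, Complex.cos_eq_cos_iff] at h
  obtain ⟨k, hk⟩ := h
  rw [abs_lt] at hw hw'
  have hpi := Real.pi_pos
  have key : k = 0 := by
    rcases hk with hk | hk
    · have := congrArg re hk
      simp at this
      have h1 : (k : ℝ) < 1 := by nlinarith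
      have h2 : (-1 : ℝ) < k := by nlinarith
      have h1' : k < 1 := by exact_mod_cast h1
      have h2' : -1 < k := by exact_mod_cast h2
      omega
    · have := congrArg re hk
      simp at this
      have h1 : (k : ℝ) < 1 := by nlinarith
      have h2 : (-1 : ℝ) < k := by nlinarith
      have h1' : k < 1 := by exact_mod_cast h1
      have h2' : -1 < k := by exact_mod_cast h2
      omega
  subst key
  rcases hk with hk | hk
  · left
    apply mul_right_cancel₀ I_ne_zero
    simpa using hk
  · right
    apply mul_right_cancel₀ I_ne_zero
    simpa using hk

theorem cosh_re_pos {w : ℂ} (hw : |w.im| < Real.pi / 2) : 0 < (cosh w).re := by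
  rw [← re_add_im w, cosh_add, cosh_mul_I, sinh_mul_I, ← ofReal_cosh, ← ofReal_sinh, ← ofReal_cos,
    ← ofReal_sin]
  simp only [add_re, mul_re, ofReal_re, ofReal_im, I_re, I_im, mul_im]
  rw [abs_lt] at hw
  have := mul_pos (Real.cosh_pos w.re) (Real.cos_pos_of_mem_Ioo ⟨by linarith, hw.2⟩)
  simpa using this

theorem cosh_eq_two_mul_sq (w : ℂ) : cosh w = 2 * cosh (w / 2) ^ 2 - 1 := by
  have h := Complex.cosh_two_mul (w / 2)
  rw [mul_div_cancel₀ w two_ne_zero] at h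
  have h2 := Complex.cosh_sq (w / 2)
  linear_combination h - h2

theorem cosh_eq_two_mul_sinh_sq (w : ℂ) : cosh w = 2 * sinh (w / 2) ^ 2 + 1 := by
  have h := Complex.cosh_two_mul (w / 2)
  rw [mul_div_cancel₀ w two_ne_zero] at h
  have h2 := Complex.cosh_sq (w / 2)
  linear_combination h + h2

theorem abs_im_half_lt {w : ℂ} (hw : |w.im| < Real.pi) : |(w / 2).im| < Real.pi / 2 := by
  have : (w / 2).im = w.im / 2 := by simp
  rw [this, abs_div, abs_two]
  linarith

/-- It is the square of √2 cosh(w/2), whose real part is positive in this strip. -/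
theorem one_add_cosh_mem_slitPlane {w : ℂ} (hw : |w.im| < Real.pi) : 1 + cosh w ∈ slitPlane := by
  have h1 : 1 + cosh w = ((Real.sqrt 2 : ℝ) * cosh (w / 2)) ^ 2 := by
    rw [cosh_eq_two_mul_sq, mul_pow, ← ofReal_pow, Real.sq_sqrt zero_le_two]
    push_cast
    ring
  rw [h1]
  apply sq_mem_slitPlane
  rw [re_ofReal_mul]
  exact mul_pos (by positivity) (cosh_re_pos (abs_im_half_lt hw))

theorem sinh_ne_zero_of_strip {w : ℂ} (hw : |w.im| < Real.pi) (h0 : w ≠ 0) : sinh w ≠ 0 := by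
  intro h
  have h1 := Complex.cosh_sq w
  rw [h] at h1
  have h2 : (cosh w - 1) * (1 + cosh w) = 0 := by linear_combination h1
  rcases mul_eq_zero.1 h2 with h3 | h3
  · have h4 : cosh (0 : ℂ) = cosh w := by rw [cosh_zero]; linear_combination -h3
    rcases cosh_injOn_strip (by simpa using Real.pi_pos) hw h4 with h5 | h5
    · exact h0 h5
    · exact h0 (by simpa using h5)
  · exact slitPlane_ne_zero (one_add_cosh_mem_slitPlane hw) h3

/-- A complex inverse of `cosh`, with values in the strip `|Im w| < π` off `(-∞, -1]`. -/
noncomputable def arcoshC (z : ℂ) : ℂ :=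
  2 * log (Complex.sqrt ((1 + z) / 2) + Complex.sqrt ((z - 1) / 2))

theorem half_mem_slitPlane {z : ℂ} (hz : z ∈ slitPlane) : z / 2 ∈ slitPlane := by
  have : z / 2 = ((1 / 2 : ℝ) : ℂ) * z := by push_cast; ring
  rw [this, mem_slitPlane_iff, re_ofReal_mul, im_ofReal_mul]
  rcases mem_slitPlane_iff.1 hz with h | h
  · left; positivity
  · right; simpa using h

theorem arcoshC_spec (z : ℂ) :
    (Complex.sqrt ((1 + z) / 2) + Complex.sqrt ((z - 1) / 2)) *
      (Complex.sqrt ((1 + z) / 2) - Complex.sqrt ((z - 1) / 2)) = 1 := by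
  linear_combination sqrt_sq ((1 + z) / 2) - sqrt_sq ((z - 1) / 2)

theorem cosh_arcoshC (z : ℂ) : cosh (arcoshC z) = z := by
  rw [arcoshC, cosh_two_log (arcoshC_spec z), sqrt_sq]
  ring

theorem abs_im_arcoshC_lt {z : ℂ} (hz : 1 + z ∈ slitPlane) : |(arcoshC z).im| < Real.pi :=
  abs_im_two_log_lt (re_add_pos (arcoshC_spec z) (sqrt_re_pos (half_mem_slitPlane hz)))

theorem arcoshC_one : arcoshC 1 = 0 := by
  have : ((1 : ℂ) + 1) / 2 = 1 := by norm_num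
  simp [arcoshC, this]

/-- Across (-1, 1) the function `arcoshC` jumps from w to -w. At the branch point 1 the two values
coincide. -/
theorem continuousAt_arcoshC_one : ContinuousAt arcoshC 1 := by
  have h1 : ContinuousAt (fun z : ℂ => Complex.sqrt ((1 + z) / 2)) 1 := by
    apply ContinuousAt.comp (g := Complex.sqrt)
    · apply continuousAt_sqrt
      left
      norm_num
    · fun_prop
  have h2 : ContinuousAt (fun z : ℂ => Complex.sqrt ((z - 1) / 2)) 1 := by
    apply ContinuousAt.comp (g := Complex.sqrt)
    · apply continuousAt_sqrt
      left
      simp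
    · fun_prop
  have h3 : ContinuousAt log (Complex.sqrt ((1 + 1) / 2) + Complex.sqrt ((1 - 1) / 2)) := by
    apply continuousAt_clog
    have : ((1 : ℂ) + 1) / 2 = 1 := by norm_num
    simp [this]
  exact continuousAt_const.mul (ContinuousAt.comp (f := fun z : ℂ =>
    Complex.sqrt ((1 + z) / 2) + Complex.sqrt ((z - 1) / 2)) h3 (h1.add h2))

/-! ### Generalised Chebyshev functions -/

/-- The function `cosh w ↦ cosh (lam * w)`. -/
noncomputable def coshPow (lam : ℝ) (z : ℂ) : ℂ := cosh (lam * arcoshC z)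

/-- The unknown sign of the inverse is invisible because cosh is even. -/
theorem coshPow_cosh (lam : ℝ) {w : ℂ} (hw : |w.im| < Real.pi) :
    coshPow lam (cosh w) = cosh (lam * w) := by
  have h := cosh_injOn_strip hw (abs_im_arcoshC_lt (one_add_cosh_mem_slitPlane hw))
    (cosh_arcoshC (cosh w)).symm
  rw [coshPow]
  rcases h with h | h
  · rw [h]
  · rw [h, mul_neg, cosh_neg]

theorem coshPow_eq_half (lam : ℝ) (z : ℂ) : coshPow lam z = 2 * coshPow (lam / 2) z ^ 2 - 1 := by
  rw [coshPow, cosh_eq_two_mul_sq, coshPow]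
  congr 4
  push_cast
  ring

theorem coshPow_one (lam : ℝ) : coshPow lam 1 = 1 := by
  rw [coshPow, arcoshC_one]
  simp

/-- Since `arcoshC` has jumps, it is replaced near cosh w by the local inverse of cosh through w.
Both give the same value of `coshPow`. -/
theorem hasDerivAt_coshPow (lam : ℝ) {w : ℂ} (hw : |w.im| < Real.pi) (h0 : w ≠ 0) :
    HasDerivAt (coshPow lam) (lam * sinh (lam * w) / sinh w) (cosh w) := by
  have hf := Complex.hasStrictDerivAt_cosh w
  have hf' := sinh_ne_zero_of_strip hw h0
  have hψ := hf.to_localInverse hf'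
  set ψ := hf.localInverse _ _ _ hf'
  have hψw : ψ (cosh w) = w := (hf.eventually_left_inverse hf').self_of_nhds
  have hright : ∀ᶠ z in 𝓝 (cosh w), cosh (ψ z) = z := hf.eventually_right_inverse hf'
  have him : ∀ᶠ z in 𝓝 (cosh w), |(ψ z).im| < Real.pi := by
    have hc : ContinuousAt (fun z => |(ψ z).im|) (cosh w) :=
      (continuous_abs.comp continuous_im).continuousAt.comp hψ.hasDerivAt.continuousAt
    apply hc.eventually_lt continuousAt_const
    rw [hψw]
    exact hw
  have heq : coshPow lam =ᶠ[𝓝 (cosh w)] fun z => cosh (lam * ψ z) := by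
    filter_upwards [hright, him] with z h1 h2
    rw [← coshPow_cosh lam h2, h1]
  refine HasDerivAt.congr_of_eventuallyEq ?_ heq
  have := (hψ.hasDerivAt.const_mul (lam : ℂ)).ccosh
  rw [hψw] at this
  exact this.congr_deriv (by rw [div_eq_mul_inv]; ring)

theorem tendsto_sinh_div_sinh (lam : ℝ) :
    Tendsto (fun t : ℂ => sinh (lam * t) / sinh t) (𝓝[≠] 0) (𝓝 (lam : ℂ)) := by
  have h1 : ∀ l : ℂ, Tendsto (fun t : ℂ => t⁻¹ * sinh (l * t)) (𝓝[≠] 0) (𝓝 l) := by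
    intro l
    have h : HasDerivAt (fun t : ℂ => sinh (l * t)) l 0 := by
      have := ((hasDerivAt_id (0 : ℂ)).const_mul l).csinh
      simpa using this
    simpa using h.tendsto_slope_zero
  have h2 := (h1 lam).div (h1 1) one_ne_zero
  rw [div_one] at h2
  refine h2.congr' ?_
  filter_upwards [self_mem_nhdsWithin] with t ht
  rw [Pi.div_apply, one_mul, mul_div_mul_left _ _ (inv_ne_zero ht)]

/-- At the branch point cosh has no local inverse. The identity cosh w - 1 = 2 sinh²(w/2) turns the
difference quotient into (sinh(λw/2)/sinh(w/2))², with limit λ². -/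
theorem hasDerivAt_coshPow_one (lam : ℝ) : HasDerivAt (coshPow lam) (lam ^ 2) 1 := by
  rw [hasDerivAt_iff_tendsto_slope]
  have h1 : Tendsto (fun z => arcoshC z / 2) (𝓝[≠] 1) (𝓝[≠] 0) := by
    apply tendsto_nhdsWithin_of_tendsto_nhds_of_eventually_within
    · have := continuousAt_arcoshC_one.div_const 2
      rw [ContinuousAt, arcoshC_one, zero_div] at this
      exact this.mono_left nhdsWithin_le_nhds
    · filter_upwards [self_mem_nhdsWithin] with z hz h
      apply hz
      have h2 : arcoshC z = 0 := by simpa using h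
      rw [Set.mem_singleton_iff, ← cosh_arcoshC z, h2, cosh_zero]
  have h2 := ((tendsto_sinh_div_sinh lam).comp h1).pow 2
  refine h2.congr' ?_
  filter_upwards [self_mem_nhdsWithin] with z hz
  rw [slope_def_field, coshPow_one, coshPow, cosh_eq_two_mul_sinh_sq, Function.comp_apply, div_pow]
  have h3 : z - 1 = 2 * sinh (arcoshC z / 2) ^ 2 := by
    conv_lhs => rw [← cosh_arcoshC z, cosh_eq_two_mul_sinh_sq]
    ring
  rw [h3, add_sub_cancel_right, mul_div_mul_left _ _ two_ne_zero, mul_div_assoc]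

theorem differentiableAt_coshPow (lam : ℝ) {z : ℂ} (hz : 1 + z ∈ slitPlane) :
    DifferentiableAt ℂ (coshPow lam) z := by
  by_cases h : arcoshC z = 0
  · have : z = 1 := by rw [← cosh_arcoshC z, h, cosh_zero]
    rw [this]
    exact (hasDerivAt_coshPow_one lam).differentiableAt
  · have := hasDerivAt_coshPow lam (abs_im_arcoshC_lt hz) h
    rw [cosh_arcoshC] at this
    exact this.differentiableAt

/-- The bound λ ≤ 1 keeps λw in the strip |Im| < π, where sinh vanishes only at 0. It is applied
with λ = χ/2. -/
theorem deriv_coshPow_ne_zero {lam : ℝ} (h0 : 0 < lam) (h1 : lam ≤ 1) {z : ℂ}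
    (hz : 1 + z ∈ slitPlane) : deriv (coshPow lam) z ≠ 0 := by
  have hl : (lam : ℂ) ≠ 0 := by exact_mod_cast h0.ne'
  by_cases h : arcoshC z = 0
  · have : z = 1 := by rw [← cosh_arcoshC z, h, cosh_zero]
    rw [this, (hasDerivAt_coshPow_one lam).deriv]
    exact pow_ne_zero _ hl
  · have hs := abs_im_arcoshC_lt hz
    have := hasDerivAt_coshPow lam hs h
    rw [cosh_arcoshC] at this
    rw [this.deriv]
    refine div_ne_zero (mul_ne_zero hl (sinh_ne_zero_of_strip ?_ (mul_ne_zero hl h)))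
      (sinh_ne_zero_of_strip hs h)
    rw [im_ofReal_mul, abs_mul, abs_of_pos h0]
    nlinarith [abs_nonneg (arcoshC z).im]

/-! ### Hyperbolic coordinates -/

theorem cosh_re_im (w : ℂ) : cosh w = (Real.cosh w.re * Real.cos w.im : ℝ) +
    (Real.sinh w.re * Real.sin w.im : ℝ) * I := by
  conv_lhs => rw [← re_add_im w, cosh_add, cosh_mul_I, sinh_mul_I]
  push_cast
  ring

theorem cosh_re (w : ℂ) : (cosh w).re = Real.cosh w.re * Real.cos w.im := by
  rw [cosh_re_im, add_re, ofReal_re, re_ofReal_mul, I_re, mul_zero, add_zero]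

theorem cosh_im (w : ℂ) : (cosh w).im = Real.sinh w.re * Real.sin w.im := by
  rw [cosh_re_im, add_im, ofReal_im, im_ofReal_mul, I_im, mul_one, zero_add]

theorem sinh_im (w : ℂ) : (sinh w).im = Real.cosh w.re * Real.sin w.im := by
  have h : sinh w = (Real.sinh w.re * Real.cos w.im : ℝ) +
      (Real.cosh w.re * Real.sin w.im : ℝ) * I := by
    conv_lhs => rw [← re_add_im w, sinh_add, cosh_mul_I, sinh_mul_I]
    push_cast
    ring
  rw [h, add_im, ofReal_im, im_ofReal_mul, I_im, mul_one, zero_add]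

theorem norm_eq_of_sq {z : ℂ} {t : ℝ} (ht : 0 ≤ t) (h : z.re ^ 2 + z.im ^ 2 = t ^ 2) : ‖z‖ = t := by
  rw [← sq_eq_sq₀ (norm_nonneg z) ht, ← normSq_eq_norm_sq, normSq_apply, ← h]
  ring

theorem norm_one_add_cosh (w : ℂ) : ‖1 + cosh w‖ = Real.cosh w.re + Real.cos w.im := by
  apply norm_eq_of_sq
  · linarith [Real.one_le_cosh w.re, Real.neg_one_le_cos w.im]
  · rw [add_re, add_im, cosh_re, cosh_im]
    simp only [one_re, one_im]
    have h1 := Real.cosh_sq w.re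
    have h2 := Real.sin_sq_add_cos_sq w.im
    linear_combination (-Real.sin w.im ^ 2) * h1 + (Real.cosh w.re ^ 2 - 1) * h2

theorem norm_cosh_sub_one (w : ℂ) : ‖cosh w - 1‖ = Real.cosh w.re - Real.cos w.im := by
  apply norm_eq_of_sq
  · linarith [Real.one_le_cosh w.re, Real.cos_le_one w.im]
  · rw [sub_re, sub_im, cosh_re, cosh_im]
    simp only [one_re, one_im]
    have h1 := Real.cosh_sq w.re
    have h2 := Real.sin_sq_add_cos_sq w.im
    linear_combination (-Real.sin w.im ^ 2) * h1 + (Real.cosh w.re ^ 2 - 1) * h2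

/-- Horizontal lines in the w-plane go to confocal hyperbolas with foci ±1. This expresses Im w
through Z without inverting cosh. -/
theorem norm_sub_norm_cosh (w : ℂ) : ‖1 + cosh w‖ - ‖cosh w - 1‖ = 2 * Real.cos w.im := by
  rw [norm_one_add_cosh, norm_cosh_sub_one]
  ring

/-- On the excluded ray (-∞, -1] the difference of the distances to the foci is exactly -2. -/
theorem mem_slitPlane_of_norm_sub {z : ℂ} (h : -2 < ‖1 + z‖ - ‖z - 1‖) : 1 + z ∈ slitPlane := by
  by_contra hn
  rw [mem_slitPlane_iff, not_or, not_lt, not_not] at hn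
  obtain ⟨h1, h2⟩ := hn
  rw [add_re, one_re] at h1
  rw [add_im, one_im, zero_add] at h2
  have hz : z = (z.re : ℂ) := Complex.ext rfl (by simpa using h2)
  have e1 : ‖1 + z‖ = -(1 + z.re) := by
    apply norm_eq_of_sq (by linarith)
    simp [h2]
    ring
  have e2 : ‖z - 1‖ = 1 - z.re := by
    apply norm_eq_of_sq (by linarith)
    simp [h2]
    ring
  rw [e1, e2] at h
  linarith

/-! ### The root `√(1 - z²)` off the two real half-lines -/

/-- The branch of `√(1 - z²)` on the complement of `(-∞, -1] ∪ [1, ∞)`. -/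
noncomputable def rootOne (z : ℂ) : ℂ := Complex.sqrt (1 - z) * Complex.sqrt (1 + z)

theorem rootOne_sq (z : ℂ) : rootOne z ^ 2 = 1 - z ^ 2 := by
  rw [rootOne, mul_pow, sqrt_sq, sqrt_sq]
  ring

/-- In this half of the strip both √2 cosh(w/2) and -i√2 sinh(w/2) have positive real part, so they
are the principal roots of 1 + cosh w and 1 - cosh w. -/
theorem rootOne_cosh {w : ℂ} (h0 : 0 < w.im) (h1 : w.im < Real.pi) :
    rootOne (cosh w) = -I * sinh w := by
  have hs2 : ((Real.sqrt 2 : ℝ) : ℂ) ^ 2 = 2 := by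
    rw [← ofReal_pow, Real.sq_sqrt zero_le_two]; norm_num
  have e1 : Complex.sqrt (1 + cosh w) = (Real.sqrt 2 : ℝ) * cosh (w / 2) := by
    apply sqrt_eq_of_sq_eq
    · rw [cosh_eq_two_mul_sq w, mul_pow, hs2]
      ring
    · rw [re_ofReal_mul]
      exact mul_pos (by positivity) (cosh_re_pos (abs_im_half_lt (abs_lt.2 ⟨by linarith, h1⟩)))
  have e2 : Complex.sqrt (1 - cosh w) = (Real.sqrt 2 : ℝ) * (-I * sinh (w / 2)) := by
    apply sqrt_eq_of_sq_eq
    · rw [cosh_eq_two_mul_sinh_sq w, mul_pow, hs2, mul_pow, neg_sq, I_sq]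
      ring
    · rw [re_ofReal_mul]
      apply mul_pos (by positivity)
      have h3 : (-I * sinh (w / 2)).re = Real.cosh (w / 2).re * Real.sin (w / 2).im := by
        rw [← sinh_im]
        simp
      have h4 : (w / 2).im = w.im / 2 := by simp
      rw [h3, h4]
      exact mul_pos (Real.cosh_pos _) (Real.sin_pos_of_pos_of_lt_pi (by linarith) (by linarith))
  have e3 : sinh w = 2 * sinh (w / 2) * cosh (w / 2) := by
    rw [← Complex.sinh_two_mul, mul_div_cancel₀ w two_ne_zero]
  rw [rootOne, e1, e2, e3]
  linear_combination (-I * sinh (w / 2) * cosh (w / 2)) * hs2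

theorem rootOne_ne_zero {z : ℂ} (h1 : 1 - z ∈ slitPlane) (h2 : 1 + z ∈ slitPlane) :
    rootOne z ≠ 0 := by
  intro h
  have h3 := rootOne_sq z
  rw [h] at h3
  have h4 : (1 - z) * (1 + z) = 0 := by linear_combination -h3
  exact mul_ne_zero (slitPlane_ne_zero h1) (slitPlane_ne_zero h2) h4

theorem differentiableAt_rootOne {z : ℂ} (h1 : 1 - z ∈ slitPlane) (h2 : 1 + z ∈ slitPlane) :
    DifferentiableAt ℂ rootOne z := by
  apply DifferentiableAt.mul
  · exact (differentiableAt_sqrt h1).comp z (by fun_prop)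
  · exact (differentiableAt_sqrt h2).comp z (by fun_prop)

end ThreeQuadrants

namespace ThreeQuadrants

/-! ### The two-parameter family of walks -/

/-- The three numbers `b = p 1 0 = p 0 1`, `c = p 0 (-1) = p (-1) 0` and
`s = p 1 1 + b = p (-1) (-1) + c` that determine the transition probabilities. -/
structure Weights where
  b : ℝ
  c : ℝ
  s : ℝ
  b_nonneg : 0 ≤ b
  c_nonneg : 0 ≤ c
  b_le : b ≤ s
  c_le : c ≤ s
  pos : 0 < b + c
  total : 2 * s + b + c = 1

/-- `W` consists of the weights of the walk `p`. -/
structure Weights.Of (W : Weights) (p : ℤ → ℤ → ℝ) : Prop where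
  p11 : p 1 1 = W.s - W.b
  p10 : p 1 0 = W.b
  p01 : p 0 1 = W.b
  p0n : p 0 (-1) = W.c
  pn0 : p (-1) 0 = W.c
  pnn : p (-1) (-1) = W.s - W.c
  p00 : p 0 0 = 0
  p1n : p 1 (-1) = 0
  pn1 : p (-1) 1 = 0
  -- The change of variables reads these two entries at the corners (-1, 1) and (1, -1) of the new
  -- step set.
  far : p 1 2 = 0 ∧ p (-1) (-2) = 0

theorem Icc_neg_one_one : Finset.Icc (-1 : ℤ) 1 = {-1, 0, 1} := by decide

/-- Under symmetry, zero drift is the single relation p₁₁ + b = p₋₁₋₁ + c, whose common value is s.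
The condition on consecutive zeros enters only through b + c > 0. -/
theorem IsAdmissibleStep.exists_weights {p : ℤ → ℤ → ℝ} (hp : IsAdmissibleStep p) :
    ∃ W : Weights, W.Of p := by
  have h1 := hp.sum_eq_one
  have h2 := hp.drift_fst
  simp [Icc_neg_one_one, hp.zero_zero, hp.neg_one_one, hp.one_neg_one] at h1 h2
  have s1 := hp.symm 1 0
  have s2 := hp.symm (-1) 0
  have z : ∀ i j, ¬ (i ∈ Finset.Icc (-1 : ℤ) 1 ∧ j ∈ Finset.Icc (-1 : ℤ) 1) → p i j = 0 :=
    fun i j h => by_contra fun h' => h (hp.small i j h')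
  have hb := hp.nonneg 1 0
  have hc := hp.nonneg (-1) 0
  have ha := hp.nonneg 1 1
  have hd := hp.nonneg (-1) (-1)
  refine ⟨⟨p 1 0, p (-1) 0, p 1 1 + p 1 0, hb, hc, by linarith, by linarith, ?_, by linarith⟩,
    ⟨by simp, rfl, s1.symm, s2.symm, rfl, by dsimp only; linarith, hp.zero_zero, hp.one_neg_one,
      hp.neg_one_one, z _ _ (by decide), z _ _ (by decide)⟩⟩
  by_contra h
  have e1 : p 1 0 = 0 := by linarith
  have e2 : p 0 (-1) = 0 := by linarith
  exact hp.no_two_zeros.2.1 ⟨e1, e2⟩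

/-! ### Constants of the uniformisation and the inequalities between them -/

namespace Weights

variable (W : Weights)

theorem s_pos : 0 < W.s := by linarith [W.b_le, W.c_le, W.pos]

theorem sum_lt : W.b + W.c < 4 * W.s := by linarith [W.b_le, W.c_le, W.s_pos]

theorem radicand_pos : 0 < W.s * (W.b + W.c) - W.b * W.c := by
  rcases W.b_nonneg.eq_or_lt with h | h
  · have := W.pos
    rw [← h] at this ⊢
    nlinarith [W.s_pos]
  · nlinarith [W.s_pos, mul_nonneg W.c_nonneg (sub_nonneg.2 W.b_le), mul_pos W.s_pos h]

/-- The constant `√(s (b + c) - b c)`. -/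
noncomputable def sig : ℝ := √(W.s * (W.b + W.c) - W.b * W.c)

/-- The number `-cos θ`. -/
noncomputable def co : ℝ := √((W.b + W.c) / (4 * W.s))

/-- The number `sin θ`. -/
noncomputable def si : ℝ := √(1 - W.co ^ 2)

/-- The normalisation `1 / (2 s σ)`. -/
noncomputable def k : ℝ := (2 * W.s * W.sig)⁻¹

/-! The coefficients of the Möbius transformations `Z = (yA y + yB) / (1 - y)` and
`U = (xA x + xB) / (1 - x)` that uniformise the kernel. -/

noncomputable def yA : ℝ := (W.s * (W.b + 3 * W.c) - W.c * (W.b + W.c)) * W.k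

noncomputable def yB : ℝ := (W.s * (3 * W.b + W.c) - W.b * (W.b + W.c)) * W.k

noncomputable def xA : ℝ := (2 * W.s - W.b) * (2 * W.s * W.co * W.k)

noncomputable def xB : ℝ := (2 * W.s - W.c) * (2 * W.s * W.co * W.k)

theorem sig_pos : 0 < W.sig := Real.sqrt_pos.2 W.radicand_pos

theorem k_pos : 0 < W.k := inv_pos.2 (mul_pos (by linarith [W.s_pos]) W.sig_pos)

theorem co_pos : 0 < W.co := Real.sqrt_pos.2 (div_pos W.pos (by linarith [W.s_pos]))

theorem co_sq : 4 * W.s * W.co ^ 2 = W.b + W.c := by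
  have := W.s_pos
  rw [co, Real.sq_sqrt (div_pos W.pos (by linarith)).le]
  field_simp

theorem k_sq : W.k ^ 2 * (4 * W.s ^ 2 * (W.s * (W.b + W.c) - W.b * W.c)) = 1 := by
  have h1 := W.sig_pos
  have h2 := W.s_pos
  have h3 : W.sig ^ 2 = W.s * (W.b + W.c) - W.b * W.c := Real.sq_sqrt W.radicand_pos.le
  rw [k, ← h3]
  field_simp
  norm_num

theorem two_co_sq_le : 2 * W.co ^ 2 ≤ 1 := by
  have := W.co_sq
  nlinarith [W.s_pos, W.b_le, W.c_le]

theorem co_lt_one : W.co < 1 := by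
  nlinarith [W.two_co_sq_le, W.co_pos]

theorem si_sq : W.si ^ 2 = 1 - W.co ^ 2 :=
  Real.sq_sqrt (by nlinarith [W.two_co_sq_le, sq_nonneg W.co])

theorem si_pos : 0 < W.si := Real.sqrt_pos.2 (by nlinarith [W.two_co_sq_le, sq_nonneg W.co])

theorem yA_pos : 0 < W.yA := by
  refine mul_pos ?_ W.k_pos
  nlinarith [W.s_pos, W.b_le, W.c_le, W.b_nonneg, W.c_nonneg, W.pos,
    mul_pos W.s_pos W.pos, mul_nonneg W.c_nonneg (sub_nonneg.2 W.b_le),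
    mul_nonneg W.c_nonneg (sub_nonneg.2 W.c_le)]

theorem yB_pos : 0 < W.yB := by
  refine mul_pos ?_ W.k_pos
  nlinarith [W.s_pos, W.b_le, W.c_le, W.b_nonneg, W.c_nonneg, W.pos,
    mul_pos W.s_pos W.pos, mul_nonneg W.b_nonneg (sub_nonneg.2 W.b_le),
    mul_nonneg W.b_nonneg (sub_nonneg.2 W.c_le)]

theorem scale_pos : 0 < 2 * W.s * W.co * W.k :=
  mul_pos (mul_pos (by linarith [W.s_pos]) W.co_pos) W.k_pos

theorem xA_pos : 0 < W.xA := mul_pos (by linarith [W.b_le, W.s_pos]) W.scale_pos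

theorem xB_pos : 0 < W.xB := mul_pos (by linarith [W.c_le, W.s_pos]) W.scale_pos

/-- The difference of `(1 - y)²` and `(yA y + yB)²` as a multiple of the quadratic factor of
the discriminant. -/
theorem sq_sub_y (y : ℝ) : (1 - y) ^ 2 - (W.yA * y + W.yB) ^ 2 =
    W.k ^ 2 * (W.b + W.c) * (4 * W.s - W.b - W.c) *
      (((W.s - W.c) * y + (W.s - W.b)) ^ 2 - 4 * W.s ^ 2 * y) := by
  have h := W.k_sq
  rw [yA, yB]
  linear_combination -(1 - y) ^ 2 * h

theorem sq_sub_x (x : ℝ) : (1 - x) ^ 2 - (W.xA * x + W.xB) ^ 2 =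
    W.k ^ 2 * W.s * (4 * W.s - W.b - W.c) *
      (W.b ^ 2 * x ^ 2 + (2 * W.b * W.c - 4 * W.s * (W.b + W.c)) * x + W.c ^ 2) := by
  have h := W.k_sq
  have h2 := W.co_sq
  rw [xA, xB]
  linear_combination -(1 - x) ^ 2 * h -
    W.k ^ 2 * W.s * ((2 * W.s - W.b) * x + (2 * W.s - W.c)) ^ 2 * h2

/-- This is the y²-coefficient of `sq_sub_y`, extracted from its values at 1, -1 and 0. -/
theorem one_sub_yA_sq : 1 - W.yA ^ 2 =
    W.k ^ 2 * (W.b + W.c) * (4 * W.s - W.b - W.c) * (W.s - W.c) ^ 2 := by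
  linear_combination W.sq_sub_y 1 / 2 + W.sq_sub_y (-1) / 2 - W.sq_sub_y 0

theorem one_sub_yB_sq : 1 - W.yB ^ 2 =
    W.k ^ 2 * (W.b + W.c) * (4 * W.s - W.b - W.c) * (W.s - W.b) ^ 2 := by
  linear_combination W.sq_sub_y 0

theorem one_sub_xA_sq : 1 - W.xA ^ 2 =
    W.k ^ 2 * W.s * (4 * W.s - W.b - W.c) * W.b ^ 2 := by
  linear_combination W.sq_sub_x 1 / 2 + W.sq_sub_x (-1) / 2 - W.sq_sub_x 0

theorem one_sub_xB_sq : 1 - W.xB ^ 2 =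
    W.k ^ 2 * W.s * (4 * W.s - W.b - W.c) * W.c ^ 2 := by
  linear_combination W.sq_sub_x 0

theorem mu_pos : 0 < W.k ^ 2 * (W.b + W.c) * (4 * W.s - W.b - W.c) :=
  mul_pos (mul_pos (pow_pos W.k_pos 2) W.pos) (by linarith [W.sum_lt])

theorem mu'_pos : 0 < W.k ^ 2 * W.s * (4 * W.s - W.b - W.c) :=
  mul_pos (mul_pos (pow_pos W.k_pos 2) W.s_pos) (by linarith [W.sum_lt])

theorem yA_le : W.yA ≤ 1 := by
  have := mul_nonneg W.mu_pos.le (sq_nonneg (W.s - W.c))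
  nlinarith [W.one_sub_yA_sq, W.yA_pos]

theorem yB_le : W.yB ≤ 1 := by
  have := mul_nonneg W.mu_pos.le (sq_nonneg (W.s - W.b))
  nlinarith [W.one_sub_yB_sq, W.yB_pos]

theorem xA_le : W.xA ≤ 1 := by
  have := mul_nonneg W.mu'_pos.le (sq_nonneg W.b)
  nlinarith [W.one_sub_xA_sq, W.xA_pos]

theorem xB_le : W.xB ≤ 1 := by
  have := mul_nonneg W.mu'_pos.le (sq_nonneg W.c)
  nlinarith [W.one_sub_xB_sq, W.xB_pos]

/-- The degenerate case in which δ̃ has degree three: the fourth branch point, where Z = -1, moves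
to infinity. -/
theorem yA_eq_one_iff : W.yA = 1 ↔ W.s - W.c = 0 := by
  have h := W.one_sub_yA_sq
  have hm := W.mu_pos
  constructor
  · intro h1
    rw [h1] at h
    have : (W.s - W.c) ^ 2 = 0 := by
      rcases mul_eq_zero.1 (show _ * (W.s - W.c) ^ 2 = 0 by rw [← h]; norm_num) with h2 | h2
      · exact absurd h2 hm.ne'
      · exact h2
    exact pow_eq_zero_iff two_ne_zero |>.1 this
  · intro h1
    rw [h1] at h
    nlinarith [W.yA_pos]

theorem co_le_yA_aux : W.k ^ 2 * (W.s * (W.b + W.c) * (W.s * (W.b + W.c) - W.b * W.c)) =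
    W.co ^ 2 := by
  have h := W.k_sq
  have h2 := W.co_sq
  have h3 := W.s_pos
  have : 4 * W.s * (W.k ^ 2 * (W.s * (W.b + W.c) * (W.s * (W.b + W.c) - W.b * W.c))) =
      4 * W.s * W.co ^ 2 := by
    rw [h2]; linear_combination (W.b + W.c) * h
  exact mul_left_cancel₀ (by positivity) this

/-- The comparison of yA with co locates y = ∞, where Z = -yA, relative to the point Z = -co of the
curve. Infinity lies on the boundary exactly when c = 0, and otherwise outside the closed domain. -/
theorem yA_sq : W.yA ^ 2 = W.co ^ 2 + W.k ^ 2 * W.c * ((2 * W.s - W.b - W.c) *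
    (2 * W.s * (W.b + W.c) + W.c * (2 * W.s - W.b - W.c)) + W.s * (W.b + W.c) * W.b) := by
  rw [← W.co_le_yA_aux, yA]
  ring

theorem co_eq_yA (hc : W.c = 0) : W.yA = W.co := by
  have h := W.yA_sq
  rw [hc] at h
  have : W.yA ^ 2 = W.co ^ 2 := by rw [h]; ring
  exact (sq_eq_sq₀ W.yA_pos.le W.co_pos.le).1 this

theorem co_lt_yA (hc : W.c ≠ 0) : W.co < W.yA := by
  have h := W.yA_sq
  have hc' : 0 < W.c := lt_of_le_of_ne W.c_nonneg hc.symm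
  apply lt_of_pow_lt_pow_left₀ 2 W.yA_pos.le
  rw [h]
  have h1 : 0 ≤ 2 * W.s - W.b - W.c := by linarith [W.b_le, W.c_le]
  have h2 : 0 < (2 * W.s - W.b - W.c) *
    (2 * W.s * (W.b + W.c) + W.c * (2 * W.s - W.b - W.c)) + W.s * (W.b + W.c) * W.b := by
    have hs := W.s_pos
    rcases W.b_nonneg.eq_or_lt with hb | hb
    · rw [← hb]
      have := W.c_le
      have h3 : 0 < 2 * W.s - 0 - W.c := by linarith
      have := mul_pos h3 (add_pos_of_pos_of_nonneg (mul_pos (mul_pos two_pos hs) hc')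
        (mul_nonneg hc'.le h3.le))
      nlinarith
    · have := mul_pos (mul_pos hs W.pos) hb
      have h4 := mul_nonneg h1 (add_nonneg (mul_nonneg (mul_nonneg zero_le_two hs.le) W.pos.le)
        (mul_nonneg hc'.le h1))
      linarith
  have := mul_pos (mul_pos (pow_pos W.k_pos 2) hc') h2
  linarith

theorem co_le_yA : W.co ≤ W.yA := by
  by_cases hc : W.c = 0
  · exact (W.co_eq_yA hc).ge
  · exact (W.co_lt_yA hc).le

/-- The number whose multiples bound the unit discs in the uniformising planes. -/
noncomputable def kap : ℝ := (W.b - W.c) * (W.s * W.k)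

/-- In `cover` the two lines that bound the unit discs meet at distance |kap| from the origin. This
inequality is what makes the discs overlap enough. -/
theorem kap_sq_lt : W.kap ^ 2 < 1 := by
  have h := W.k_sq
  have hk := W.k_pos
  have : W.kap ^ 2 = 1 - W.k ^ 2 * W.s ^ 2 * ((W.b + W.c) * (4 * W.s - W.b - W.c)) := by
    rw [kap]; linear_combination h
  rw [this]
  have := mul_pos (mul_pos (pow_pos hk 2) (pow_pos W.s_pos 2)) (mul_pos W.pos
    (show 0 < 4 * W.s - W.b - W.c by linarith [W.sum_lt]))
  linarith

theorem yB_sub_yA : W.yB - W.yA = 2 * (W.kap * (1 - 2 * W.co ^ 2)) := by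
  have h := W.co_sq
  rw [yA, yB, kap]
  linear_combination W.k * (W.b - W.c) * h

theorem xB_sub_xA : W.xB - W.xA = 2 * (W.kap * W.co) := by
  rw [xA, xB, kap]
  ring

end Weights

/-! ### The uniformisation of the kernel -/

section Identities

variable {R : Type*} [CommRing R] {b c s k C x y : R}

/-- The form Z² + U² + 2CZU - (1 - C²), cleared of the denominators (1 - x)²(1 - y)². The
coefficients are normalised so that the branch points other than 1 sit at Z = ±1 and U = ±1. The
relation `hk` fixes this normalisation. -/
theorem kernel_identity (ht : 2 * s + b + c = 1) (hC : 4 * s * C ^ 2 = b + c)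
    (hk : k ^ 2 * (4 * s ^ 2 * (s * (b + c) - b * c)) = 1) {A B A' B' : R}
    (hA : A = (s * (b + 3 * c) - c * (b + c)) * k) (hB : B = (s * (3 * b + c) - b * (b + c)) * k)
    (hA' : A' = (2 * s - b) * (2 * s * C * k)) (hB' : B' = (2 * s - c) * (2 * s * C * k)) :
    (A + B) ^ 2 * ((c * x ^ 2 + (s - c) * x) * y ^ 2 + (b * x ^ 2 - x + c) * y
        + ((s - b) * x + b)) =
      (b + c) * ((A * y + B) ^ 2 * (1 - x) ^ 2 + (A' * x + B') ^ 2 * (1 - y) ^ 2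
        + 2 * C * ((A * y + B) * (1 - y)) * ((A' * x + B') * (1 - x))
        - (1 - C ^ 2) * ((1 - x) ^ 2 * (1 - y) ^ 2)) := by
  subst hA hB hA' hB'
  set n := (s * (b + 3 * c) - c * (b + c)) * y + (s * (3 * b + c) - b * (b + c)) with hn
  set n' := (2 * s - b) * x + (2 * s - c) with hn'
  linear_combination (k ^ 2 * (b + c) ^ 2 * (4 * s - b - c) ^ 2 * x * y) * ht
    - (b + c) * (1 - y) ^ 2 * n' ^ 2 * s * k ^ 2 * hC
    - (b + c) * n * n' * (1 - x) * (1 - y) * k ^ 2 * hC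
    - (b + c) * ((1 - x) ^ 2 * (1 - y) ^ 2) * (1 - C ^ 2) * hk
    - (b + c) * ((1 - x) ^ 2 * (1 - y) ^ 2) * (k ^ 2 * s * (s * (b + c) - b * c)) * hC

/-- The x-derivative of `kernel_identity`. It produces the factor that multiplies the diagonal
series in the functional equation. -/
theorem kernel_deriv_identity (ht : 2 * s + b + c = 1) (hC : 4 * s * C ^ 2 = b + c)
    (hk : k ^ 2 * (4 * s ^ 2 * (s * (b + c) - b * c)) = 1) {A B A' B' : R}
    (hA : A = (s * (b + 3 * c) - c * (b + c)) * k) (hB : B = (s * (3 * b + c) - b * (b + c)) * k)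
    (hA' : A' = (2 * s - b) * (2 * s * C * k)) (hB' : B' = (2 * s - c) * (2 * s * C * k)) :
    (A + B) ^ 2 * (2 * x * (c * y ^ 2 + b * y) + ((s - c) * y ^ 2 - y + (s - b))) =
      (b + c) * (-2 * (A * y + B) ^ 2 * (1 - x) + 2 * A' * (A' * x + B') * (1 - y) ^ 2
        + 2 * C * ((A * y + B) * (1 - y)) * (A' * (1 - x) - (A' * x + B'))
        + 2 * (1 - C ^ 2) * ((1 - x) * (1 - y) ^ 2)) := by
  subst hA hB hA' hB'
  set n := (s * (b + 3 * c) - c * (b + c)) * y + (s * (3 * b + c) - b * (b + c)) with hn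
  set n' := (2 * s - b) * x + (2 * s - c) with hn'
  linear_combination (k ^ 2 * (b + c) ^ 2 * (4 * s - b - c) ^ 2 * y) * ht
    - (b + c) * (1 - y) ^ 2 * (2 * n' * (2 * s - b)) * s * k ^ 2 * hC
    - (b + c) * n * ((2 * s - b) * (1 - x) - n') * (1 - y) * k ^ 2 * hC
    + 2 * (b + c) * ((1 - x) * (1 - y) ^ 2) * (1 - C ^ 2) * hk
    + 2 * (b + c) * ((1 - x) * (1 - y) ^ 2) * (k ^ 2 * s * (s * (b + c) - b * c)) * hC

end Identities

/-! ### The kernel and the discriminants in terms of the weights -/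

namespace Weights.Of

variable {W : Weights} {p : ℤ → ℤ → ℝ} (h : W.Of p)
include h

open Polynomial in
theorem alpha_eq : alpha (phi p) = C W.c * X ^ 2 + C (W.s - W.c) * X := by
  have := h.far.2
  simp [alpha, phi, h.pn0, h.pnn, this]

open Polynomial in
theorem beta_eq : beta (phi p) = C W.b * X ^ 2 - X + C W.c := by
  simp [beta, phi, h.p01, h.p0n, h.p00]
  ring

open Polynomial in
theorem gamma_eq : gamma (phi p) = C (W.s - W.b) * X + C W.b := by
  have := h.far.1
  simp [gamma, phi, h.p11, h.p10, this]

open Polynomial in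
theorem alpha_swap_eq : alpha (swap (phi p)) = C W.c * X ^ 2 + C W.b * X := by
  have := h.far.1
  simp [alpha, swap, phi, h.pn0, h.p01, this]

open Polynomial in
theorem beta_swap_eq : beta (swap (phi p)) = C (W.s - W.c) * X ^ 2 - X + C (W.s - W.b) := by
  simp [beta, swap, phi, h.pnn, h.p11, h.p00]
  ring

open Polynomial in
theorem gamma_swap_eq : gamma (swap (phi p)) = C W.c * X + C W.b := by
  have := h.far.2
  simp [gamma, swap, phi, h.p0n, h.p10, this]

theorem kernel_eq (x y : ℂ) : kernel (phi p) x y =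
    (W.c * x ^ 2 + (W.s - W.c) * x) * y ^ 2 + (W.b * x ^ 2 - x + W.c) * y
      + ((W.s - W.b) * x + W.b) := by
  rw [ThreeQuadrants.kernel_eq, h.alpha_eq, h.beta_eq, h.gamma_eq]
  simp

/-- The quadratic form in `Z` and `U` that represents the kernel. -/
theorem kernel_eq_mobius (x y : ℂ) : (W.yA + W.yB) ^ 2 * kernel (phi p) x y =
    (W.b + W.c) * ((W.yA * y + W.yB) ^ 2 * (1 - x) ^ 2 + (W.xA * x + W.xB) ^ 2 * (1 - y) ^ 2
        + 2 * W.co * ((W.yA * y + W.yB) * (1 - y)) * ((W.xA * x + W.xB) * (1 - x))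
        - (1 - W.co ^ 2) * ((1 - x) ^ 2 * (1 - y) ^ 2)) := by
  rw [h.kernel_eq]
  apply kernel_identity (k := (W.k : ℂ))
  · exact_mod_cast W.total
  · exact_mod_cast W.co_sq
  · exact_mod_cast W.k_sq
  · rw [Weights.yA]; push_cast; rfl
  · rw [Weights.yB]; push_cast; rfl
  · rw [Weights.xA]; push_cast; rfl
  · rw [Weights.xB]; push_cast; rfl

theorem angle_eq : angle (phi p) = Real.arccos (-W.co) := by
  have h1 := h.far.1
  have h2 := h.far.2
  have hs := W.s_pos
  have hp := W.pos
  have s1 : ∑ i ∈ Finset.Icc (-1 : ℤ) 1, ∑ j ∈ Finset.Icc (-1 : ℤ) 1, (i * j : ℝ) * phi p i j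
      = W.b + W.c := by
    simp [Icc_neg_one_one, phi, h.p10, h.pn0, h1, h2]
    ring
  have s2 : ∑ i ∈ Finset.Icc (-1 : ℤ) 1, ∑ j ∈ Finset.Icc (-1 : ℤ) 1, (i : ℝ) ^ 2 * phi p i j
      = 2 * (W.b + W.c) := by
    simp [Icc_neg_one_one, phi, h.p10, h.p01, h.p0n, h.pn0, h1, h2]
    ring
  have s3 : ∑ i ∈ Finset.Icc (-1 : ℤ) 1, ∑ j ∈ Finset.Icc (-1 : ℤ) 1, (j : ℝ) ^ 2 * phi p i j
      = 2 * W.s := by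
    simp [Icc_neg_one_one, phi, h.p11, h.p10, h.pn0, h.pnn, h1, h2]
    ring
  rw [angle, s1, s2, s3]
  congr 2
  have e : 2 * (W.b + W.c) * (2 * W.s) = (2 * W.s) ^ 2 * W.co ^ 2 * 4 := by
    linear_combination (-4 * W.s) * W.co_sq
  have e2 : √(2 * (W.b + W.c) * (2 * W.s)) = 4 * W.s * W.co := by
    rw [e, show (2 * W.s) ^ 2 * W.co ^ 2 * 4 = (4 * W.s * W.co) ^ 2 by ring]
    exact Real.sqrt_sq (mul_pos (by linarith) W.co_pos).le
  rw [e2, div_eq_iff (mul_pos (by linarith) W.co_pos).ne']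
  linear_combination -W.co_sq

theorem delta_eval (t : ℝ) : (delta (phi p)).eval t = (1 - t) ^ 2 *
    (W.b ^ 2 * t ^ 2 + (2 * W.b * W.c - 4 * W.s * (W.b + W.c)) * t + W.c ^ 2) := by
  rw [delta, h.alpha_eq, h.beta_eq, h.gamma_eq]
  have e : W.s = (1 - W.b - W.c) / 2 := by linarith [W.total]
  simp
  rw [e]
  ring

open Polynomial in
theorem deltaTilde_eq : deltaTilde (phi p) = (1 - X) ^ 2 *
    (C ((W.s - W.c) ^ 2) * X ^ 2 +
      C (2 * (W.s - W.b) * (W.s - W.c) - 4 * W.s ^ 2) * X + C ((W.s - W.b) ^ 2)) := by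
  apply Polynomial.funext
  intro t
  rw [deltaTilde, delta, h.alpha_swap_eq, h.beta_swap_eq, h.gamma_swap_eq]
  have e : W.s = (1 - W.b - W.c) / 2 := by linarith [W.total]
  simp
  rw [e]
  ring

theorem deltaTilde_eval (t : ℝ) : (deltaTilde (phi p)).eval t = (1 - t) ^ 2 *
    (((W.s - W.c) * t + (W.s - W.b)) ^ 2 - 4 * W.s ^ 2 * t) := by
  rw [h.deltaTilde_eq]
  simp [-mul_eq_mul_left_iff]
  ring

end Weights.Of

/-- The only zero of `1 - Z²` in `[-1, 1)`, where `Z = (A t + B) / (1 - t)`. -/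
theorem mobius_zeros {A B : ℝ} (hA : 0 < A) (hA1 : A ≤ 1) (hB : 0 < B) (hB1 : B ≤ 1) :
    {t : ℝ | t ∈ Set.Ico (-1) 1 ∧ (1 - t) ^ 2 - (A * t + B) ^ 2 = 0} = {(1 - B) / (1 + A)} := by
  ext t
  simp only [Set.mem_ofPred_eq, Set.mem_singleton_iff, Set.mem_Ico]
  rw [eq_div_iff (by linarith)]
  constructor
  · rintro ⟨⟨_, h1⟩, h2⟩
    -- The factors correspond to Z = 1 and Z = -1. The second cannot vanish for t < 1.
    have h3 : (1 - B - t * (1 + A)) * (1 + B - t * (1 - A)) = 0 := by linear_combination h2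
    rcases mul_eq_zero.1 h3 with h | h
    · linarith
    · nlinarith
  · intro h
    refine ⟨⟨?_, ?_⟩, ?_⟩
    · nlinarith
    · nlinarith
    · linear_combination (-(1 + B - t * (1 - A))) * h

namespace Weights.Of

variable {W : Weights} {p : ℤ → ℤ → ℝ} (h : W.Of p)
include h

theorem branchOne_delta : branchOne (delta (phi p)) = (1 - W.xB) / (1 + W.xA) := by
  rw [branchOne, ← csInf_singleton ((1 - W.xB) / (1 + W.xA)),
    ← mobius_zeros W.xA_pos W.xA_le W.xB_pos W.xB_le]
  congr 1
  ext t
  simp only [Set.mem_ofPred_eq]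
  refine and_congr_right fun ht => ?_
  rw [h.delta_eval, W.sq_sub_x]
  have h1 : 1 - t ≠ 0 := by linarith [ht.2]
  have h2 := W.mu'_pos.ne'
  rw [mul_eq_zero, mul_eq_zero (a := W.k ^ 2 * W.s * (4 * W.s - W.b - W.c))]
  simp [h1, h2]

theorem branchOne_deltaTilde : branchOne (deltaTilde (phi p)) = (1 - W.yB) / (1 + W.yA) := by
  rw [branchOne, ← csInf_singleton ((1 - W.yB) / (1 + W.yA)),
    ← mobius_zeros W.yA_pos W.yA_le W.yB_pos W.yB_le]
  congr 1
  ext t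
  simp only [Set.mem_ofPred_eq]
  refine and_congr_right fun ht => ?_
  rw [h.deltaTilde_eval, W.sq_sub_y]
  have h1 : 1 - t ≠ 0 := by linarith [ht.2]
  have h2 := W.mu_pos.ne'
  rw [mul_eq_zero, mul_eq_zero (a := W.k ^ 2 * (W.b + W.c) * (4 * W.s - W.b - W.c))]
  simp [h1, h2]

theorem branchFour_deltaTilde (hA : W.yA < 1) :
    branchFour (deltaTilde (phi p)) = (1 + W.yB) / (1 - W.yA) := by
  rw [branchFour, ← csSup_singleton ((1 + W.yB) / (1 - W.yA))]
  congr 1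
  ext t
  have hA0 := W.yA_pos
  have hB0 := W.yB_pos
  have hB1 := W.yB_le
  simp only [Set.mem_ofPred_eq, Set.mem_singleton_iff]
  have e := W.sq_sub_y t
  have hm := W.mu_pos.ne'
  rw [eq_div_iff (by linarith), h.deltaTilde_eval]
  constructor
  · rintro ⟨h1, h2⟩
    rcases mul_eq_zero.1 h2 with h3 | h3
    · have := pow_eq_zero_iff two_ne_zero |>.1 h3
      linarith
    · rw [h3, mul_zero] at e
      have h4 : (1 - W.yB - t * (1 + W.yA)) * (1 + W.yB - t * (1 - W.yA)) = 0 := by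
        linear_combination e
      rcases mul_eq_zero.1 h4 with h5 | h5
      · nlinarith
      · linarith
  · intro h1
    refine ⟨by nlinarith, ?_⟩
    have h2 : W.k ^ 2 * (W.b + W.c) * (4 * W.s - W.b - W.c) *
      (((W.s - W.c) * t + (W.s - W.b)) ^ 2 - 4 * W.s ^ 2 * t) = 0 := by
      rw [← e]
      linear_combination (-(1 - W.yB - t * (1 + W.yA))) * h1
    rw [(mul_eq_zero.1 h2).resolve_left hm, mul_zero]

end Weights.Of

end ThreeQuadrants

namespace ThreeQuadrants

open Complex

theorem inv_mem_slitPlane_of_mem {z : ℂ} (hz : z ∈ slitPlane) : z⁻¹ ∈ slitPlane := by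
  have h : 0 < normSq z := normSq_pos.2 (slitPlane_ne_zero hz)
  rw [mem_slitPlane_iff] at hz ⊢
  rw [inv_re, inv_im]
  rcases hz with h1 | h1
  · left; positivity
  · right; exact div_ne_zero (neg_ne_zero.2 h1) h.ne'

/-! ### The functions `T` and `W` in hyperbolic coordinates -/

section Quartic

open Polynomial

theorem quartic_eq (p₀ p₁ p₂ : ℝ) : (1 - X) ^ 2 * (C p₂ * X ^ 2 + C p₁ * X + C p₀) =
    C p₂ * X ^ 4 + C (p₁ - 2 * p₂) * X ^ 3 + C (p₀ - 2 * p₁ + p₂) * X ^ 2 + C (p₁ - 2 * p₀) * X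
      + C p₀ := by
  simp only [C_sub, C_add, C_mul, map_ofNat]
  ring

theorem quartic_derivative (c₀ c₁ c₂ c₃ c₄ : ℝ) :
    derivative (C c₄ * X ^ 4 + C c₃ * X ^ 3 + C c₂ * X ^ 2 + C c₁ * X + C c₀) =
      C 0 * X ^ 4 + C (4 * c₄) * X ^ 3 + C (3 * c₃) * X ^ 2 + C (2 * c₂) * X + C c₁ := by
  have e4 : (C (4 : ℝ) : ℝ[X]) = 4 := map_ofNat C 4
  have e3 : (C (3 : ℝ) : ℝ[X]) = 3 := map_ofNat C 3
  have e2 : (C (2 : ℝ) : ℝ[X]) = 2 := map_ofNat C 2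
  simp only [derivative_add, derivative_mul, derivative_X_pow, derivative_C, derivative_X, C_mul,
    C_0, e2, e3, e4]
  norm_num [e2, e3, e4]
  ring

theorem quartic_eval (c₀ c₁ c₂ c₃ c₄ t : ℝ) :
    (C c₄ * X ^ 4 + C c₃ * X ^ 3 + C c₂ * X ^ 2 + C c₁ * X + C c₀).eval t =
      c₄ * t ^ 4 + c₃ * t ^ 3 + c₂ * t ^ 2 + c₁ * t + c₀ := by
  simp

theorem quartic_natDegree (c₀ c₁ c₂ c₃ : ℝ) {c₄ : ℝ} :
    (C c₄ * X ^ 4 + C c₃ * X ^ 3 + C c₂ * X ^ 2 + C c₁ * X + C c₀).natDegree = 4 ↔ c₄ ≠ 0 := by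
  constructor
  · rintro h rfl
    have : (C 0 * X ^ 4 + C c₃ * X ^ 3 + C c₂ * X ^ 2 + C c₁ * X + C c₀ : ℝ[X]).natDegree ≤ 3 := by
      rw [C_0, zero_mul, zero_add]
      compute_degree
    omega
  · intro h
    compute_degree!

end Quartic

/-- The transformation `Z = (yA y + yB) / (1 - y)`. -/
noncomputable def Weights.Z (W : Weights) (y : ℂ) : ℂ := (W.yA * y + W.yB) / (1 - y)

/-- With 1 - Z² proportional to the quadratic factor of δ̃, the point v is where Z = -1. The left
side is then the Möbius function of y with pole v that equals 2/(1 + Z). -/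
theorem ratPart_identity_four {A B y m p₀ p₁ p₂ v : ℂ} (hm : m ≠ 0) (h1 : 1 - A ≠ 0)
    (h3 : A + B ≠ 0) (hy : 1 - y ≠ 0) (hp₂ : m * p₂ = 1 - A ^ 2) (hp₁ : m * p₁ = -2 - 2 * A * B)
    (hp₀ : m * p₀ = 1 - B ^ 2) (hv : v = (1 + B) / (1 - A)) (hyv : y - v ≠ 0) :
    1 / 3 - 2 * ((12 * p₂ * v ^ 2 + 6 * (p₁ - 2 * p₂) * v + 2 * (p₀ - 2 * p₁ + p₂)) / 6 +
      (4 * p₂ * v ^ 3 + 3 * (p₁ - 2 * p₂) * v ^ 2 + 2 * (p₀ - 2 * p₁ + p₂) * v + (p₁ - 2 * p₀))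
        / (y - v)) / (2 * (p₀ + p₁ + p₂)) = 2 / (1 + (A * y + B) / (1 - y)) := by
  have e2 : p₂ = (1 - A ^ 2) / m := by rw [eq_div_iff hm]; linear_combination hp₂
  have e1 : p₁ = (-2 - 2 * A * B) / m := by rw [eq_div_iff hm]; linear_combination hp₁
  have e0 : p₀ = (1 - B ^ 2) / m := by rw [eq_div_iff hm]; linear_combination hp₀
  have e3 : p₀ + p₁ + p₂ = -(A + B) ^ 2 / m := by rw [e0, e1, e2]; ring
  have e4 : y - v = ((1 - A) * y - (1 + B)) / (1 - A) := by rw [hv]; field_simp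
  have e5 : (1 - A) * y - (1 + B) ≠ 0 := by
    intro h
    rw [e4, h, zero_div] at hyv
    exact hyv rfl
  have e6 : 1 + (A * y + B) / (1 - y) = -((1 - A) * y - (1 + B)) / (1 - y) := by
    field_simp
    ring
  rw [e3, e4, e6, e0, e1, e2, hv]
  field_simp
  ring

/-- The limiting case A = 1: the pole v is at infinity and 2/(1 + Z) is affine in y. -/
theorem ratPart_identity_three {B y m p₀ p₁ : ℂ} (hm : m ≠ 0) (h3 : 1 + B ≠ 0) (hy : 1 - y ≠ 0)
    (hp₁ : m * p₁ = -2 - 2 * B) (hp₀ : m * p₀ = 1 - B ^ 2) :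
    1 / 3 - 2 * (2 * (p₀ - 2 * p₁) / 6 + 6 * p₁ / 6 * y) / (2 * (p₀ + p₁)) =
      2 / (1 + (1 * y + B) / (1 - y)) := by
  have e1 : p₁ = (-2 - 2 * B) / m := by rw [eq_div_iff hm]; linear_combination hp₁
  have e0 : p₀ = (1 - B ^ 2) / m := by rw [eq_div_iff hm]; linear_combination hp₀
  have e3 : p₀ + p₁ = -(1 + B) ^ 2 / m := by rw [e0, e1]; ring
  have e6 : 1 + (1 * y + B) / (1 - y) = (1 + B) / (1 - y) := by
    field_simp
    ring
  rw [e3, e6, e0, e1]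
  field_simp
  ring

namespace Weights.Of

variable {W : Weights} {p : ℤ → ℤ → ℝ} (h : W.Of p)
include h

theorem one_div_three_sub_ratPart {y : ℂ} (hy : y ≠ 1) (hZ : 1 + W.Z y ≠ 0) :
    1 / 3 - 2 * ratPart (deltaTilde (phi p)) y /
      (((deltaTilde (phi p)).derivative.derivative.eval 1 : ℝ) : ℂ) = 2 / (1 + W.Z y) := by
  have hy' : 1 - y ≠ 0 := sub_ne_zero.2 hy.symm
  have hm := W.mu_pos.ne'
  set m := W.k ^ 2 * (W.b + W.c) * (4 * W.s - W.b - W.c) with hmdef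
  have hAB : W.yA + W.yB ≠ 0 := (add_pos W.yA_pos W.yB_pos).ne'
  have q2 : m * (W.s - W.c) ^ 2 = 1 - W.yA ^ 2 := W.one_sub_yA_sq.symm
  have q0 : m * (W.s - W.b) ^ 2 = 1 - W.yB ^ 2 := W.one_sub_yB_sq.symm
  have q1 : m * (2 * (W.s - W.b) * (W.s - W.c) - 4 * W.s ^ 2) = -2 - 2 * W.yA * W.yB := by
    linear_combination -W.sq_sub_y 1 / 2 + W.sq_sub_y (-1) / 2
  rw [ratPart]
  split_ifs with hd
  · have hdeg := hd
    rw [h.deltaTilde_eq, quartic_eq, quartic_natDegree] at hd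
    have hA : W.yA < 1 := lt_of_le_of_ne W.yA_le fun h1 => hd (by
      rw [W.yA_eq_one_iff.1 h1]; norm_num)
    rw [h.branchFour_deltaTilde hA]
    rw [h.deltaTilde_eq, quartic_eq]
    simp only [quartic_derivative, quartic_eval]
    have hA' : (1 : ℂ) - W.yA ≠ 0 := by exact_mod_cast (sub_pos.2 hA).ne'
    have hyv : y - (((1 + W.yB) / (1 - W.yA) : ℝ) : ℂ) ≠ 0 := by
      intro h0
      apply hZ
      have e : y = (1 + W.yB) / (1 - W.yA) := by
        rw [sub_eq_zero.1 h0]; push_cast; rfl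
      rw [eq_div_iff hA'] at e
      rw [Weights.Z]
      field_simp
      linear_combination -e
    have key := ratPart_identity_four (A := W.yA) (B := W.yB) (y := y) (m := m)
      (p₀ := ((W.s - W.b) ^ 2 : ℝ)) (p₁ := (2 * (W.s - W.b) * (W.s - W.c) - 4 * W.s ^ 2 : ℝ))
      (p₂ := ((W.s - W.c) ^ 2 : ℝ)) (v := ((1 + W.yB) / (1 - W.yA) : ℝ))
      (by exact_mod_cast hm) hA' (by exact_mod_cast hAB) hy' (by exact_mod_cast q2)
      (by exact_mod_cast q1) (by exact_mod_cast q0) (by push_cast; rfl) hyv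
    rw [Weights.Z, ← key]
    congr 2
    · congr 2
      · push_cast
        ring
      · congr 1
        push_cast
        ring
    · push_cast
      ring
  · rw [h.deltaTilde_eq, quartic_eq, quartic_natDegree, not_not] at hd
    have hA : W.yA = 1 := W.yA_eq_one_iff.2 (pow_eq_zero_iff two_ne_zero |>.1 hd)
    rw [h.deltaTilde_eq, quartic_eq]
    simp only [quartic_derivative, quartic_eval]
    rw [hA] at q1 hAB
    have key := ratPart_identity_three (B := W.yB) (y := y) (m := m)
      (p₀ := ((W.s - W.b) ^ 2 : ℝ)) (p₁ := (2 * (W.s - W.b) * (W.s - W.c) - 4 * W.s ^ 2 : ℝ))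
      (by exact_mod_cast hm) (by exact_mod_cast hAB) hy'
      (by rw [mul_one] at q1; exact_mod_cast q1) (by exact_mod_cast q0)
    rw [Weights.Z, hA, ofReal_one, ← key, hd]
    congr 2
    · congr 2
      · push_cast
        ring
      · push_cast
        ring
    · push_cast
      ring

/-- Since T² = (1 + Z)/2 = cosh²(w/2), the quantity 2i(arcsin T - π/2) is a solution w of cosh w = Z
in the strip |Im w| < π. The outer sin² is then a half-angle formula. -/
theorem gluingW_eq {y : ℂ} (hy : y ≠ 1) (hZ : 1 + W.Z y ∈ slitPlane) :
    gluingW (phi p) y = (1 - coshPow (Real.pi / Real.arccos (-W.co)) (W.Z y)) / 2 := by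
  set χ : ℝ := Real.pi / Real.arccos (-W.co) with hχ
  set z := W.Z y
  have hz0 : 1 + z ≠ 0 := slitPlane_ne_zero hZ
  have hT : funT (deltaTilde (phi p)) y = 1 / Complex.sqrt (2 / (1 + z)) := by
    rw [funT, h.one_div_three_sub_ratPart hy hz0]
  set T := funT (deltaTilde (phi p)) y
  have hT2 : T ^ 2 = (1 + z) / 2 := by
    rw [hT, div_pow, sqrt_sq, one_pow, one_div_div]
  have hTre : 0 < T.re := by
    have h1 : (2 : ℂ) / (1 + z) ∈ slitPlane := by
      have := inv_mem_slitPlane_of_mem (half_mem_slitPlane hZ)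
      rwa [inv_div] at this
    rw [hT, one_div, inv_re]
    have h2 := sqrt_re_pos h1
    have h3 : Complex.sqrt (2 / (1 + z)) ≠ 0 := fun h0 => by
      rw [h0] at h2
      simp at h2
    exact div_pos h2 (normSq_pos.2 h3)
  set Q := Complex.sqrt (1 - T ^ 2) with hQ
  have hQ2 : Q ^ 2 = 1 - T ^ 2 := sqrt_sq _
  -- The argument of the logarithm in arcsin T is i(T - iQ). Since T ∓ iQ are mutually inverse and
  -- Re T > 0, `re_add_pos` shows that log splits here without a 2πi correction.
  have hPv : (T + -I * Q) * (T - -I * Q) = 1 := by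
    linear_combination hQ2 - Q ^ 2 * I_sq
  have hE := re_add_pos hPv hTre
  have harc : 2 * I * (arcsinC T - Real.pi / 2) = 2 * log (T + -I * Q) := by
    have h1 : I * T + Q = I * (T + -I * Q) := by linear_combination Q * I_sq
    have hne := left_ne_zero_of_mul_eq_one hPv
    have h2 : log (I * (T + -I * Q)) = log I + log (T + -I * Q) := by
      apply log_mul I_ne_zero hne
      have h3 := abs_lt.1 (abs_arg_lt_pi_div_two_iff.2 (Or.inl hE))
      rw [arg_I]
      constructor <;> linarith [Real.pi_pos]
    rw [arcsinC, ← hQ, h1, h2, log_I]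
    linear_combination (-2 * (Real.pi / 2 * I + log (T + -I * Q))) * I_sq
  have hcosh : cosh (2 * log (T + -I * Q)) = z := by
    rw [cosh_two_log hPv, hT2]
    ring
  rw [gluingW, h.angle_eq]
  rw [← hcosh, coshPow_cosh _ (abs_im_two_log_lt hE), ← harc]
  have h4 : cosh ((χ : ℂ) * (2 * I * (arcsinC T - Real.pi / 2))) =
      Complex.cos (2 * ((Real.pi / Real.arccos (-W.co) : ℂ) * (arcsinC T - Real.pi / 2))) := by
    rw [← Complex.cosh_mul_I, hχ]
    congr 1
    push_cast
    ring
  rw [h4, Complex.cos_two_mul, Complex.sin_sq]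
  ring

end Weights.Of

end ThreeQuadrants

namespace ThreeQuadrants

open Complex Filter

theorem tendsto_cosh_atTop : Tendsto Real.cosh atTop atTop := by
  apply tendsto_atTop_mono (f := fun t => Real.exp t / 2)
  · intro t
    rw [Real.cosh_eq]
    linarith [Real.exp_pos (-t)]
  · exact Real.tendsto_exp_atTop.atTop_div_const two_pos

namespace Weights

variable (W : Weights)

/-! ### The angle of the cone -/

/-- The angle `θ`. -/
noncomputable def ang : ℝ := Real.arccos (-W.co)

/-- The exponent `π / θ`. -/
noncomputable def chi : ℝ := Real.pi / W.ang

theorem cos_ang : Real.cos W.ang = -W.co :=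
  Real.cos_arccos (by linarith [W.co_lt_one]) (by linarith [W.co_pos])

theorem sin_ang : Real.sin W.ang = W.si := by
  rw [ang, Real.sin_arccos, neg_sq, si]

theorem half_pi_lt_ang : Real.pi / 2 < W.ang := by
  rw [ang, Real.arccos_neg]
  linarith [Real.arccos_lt_pi_div_two.2 W.co_pos]

theorem ang_lt_pi : W.ang < Real.pi := by
  rw [ang, Real.arccos_neg]
  linarith [Real.arccos_pos.2 W.co_lt_one]

theorem ang_pos : 0 < W.ang := by linarith [W.half_pi_lt_ang, Real.pi_pos]

theorem chi_pos : 0 < W.chi := div_pos Real.pi_pos W.ang_pos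

theorem chi_lt_two : W.chi < 2 := by
  rw [chi, div_lt_iff₀ W.ang_pos]
  linarith [W.half_pi_lt_ang]

theorem chi_mul_ang : W.chi * W.ang = Real.pi := div_mul_cancel₀ _ W.ang_pos.ne'

theorem neg_co_lt_cos {t : ℝ} (h : |t| < W.ang) : -W.co < Real.cos t := by
  rw [← W.cos_ang, ← Real.cos_abs t]
  exact Real.cos_lt_cos_of_nonneg_of_le_pi (abs_nonneg t) W.ang_lt_pi.le h

theorem abs_lt_ang {t : ℝ} (ht : |t| ≤ Real.pi) (h : -W.co < Real.cos t) : |t| < W.ang := by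
  by_contra hn
  rw [← W.cos_ang, ← Real.cos_abs t] at h
  exact absurd h (not_lt.2 (Real.cos_le_cos_of_nonneg_of_le_pi W.ang_pos.le ht (not_lt.1 hn)))

theorem abs_le_ang {t : ℝ} (ht : |t| ≤ Real.pi) (h : -W.co ≤ Real.cos t) : |t| ≤ W.ang := by
  by_contra hn
  rw [← W.cos_ang, ← Real.cos_abs t] at h
  exact absurd h (not_le.2 (Real.cos_lt_cos_of_nonneg_of_le_pi W.ang_pos.le ht (not_le.1 hn)))

theorem abs_eq_ang {t : ℝ} (ht : |t| ≤ Real.pi) (h : Real.cos t = -W.co) : |t| = W.ang := by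
  rw [← W.cos_ang, ← Real.cos_abs t] at h
  exact Real.injOn_cos ⟨abs_nonneg t, ht⟩ ⟨W.ang_pos.le, W.ang_lt_pi.le⟩ h

/-! ### The domain and the curve -/

/-- The inverse of the transformation `Z`. -/
noncomputable def yOf (z : ℂ) : ℂ := (z - W.yB) / (z + W.yA)

theorem AB_ne : (W.yA : ℂ) + W.yB ≠ 0 := by
  exact_mod_cast (add_pos W.yA_pos W.yB_pos).ne'

theorem Z_add {y : ℂ} (hy : y ≠ 1) : W.Z y + W.yA = (W.yA + W.yB) / (1 - y) := by
  have := sub_ne_zero.2 hy.symm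
  rw [Z]
  field_simp
  ring

theorem Z_add_ne {y : ℂ} (hy : y ≠ 1) : W.Z y + W.yA ≠ 0 := by
  rw [W.Z_add hy]
  exact div_ne_zero W.AB_ne (sub_ne_zero.2 hy.symm)

theorem one_sub_yOf {z : ℂ} (hz : z + W.yA ≠ 0) : 1 - W.yOf z = (W.yA + W.yB) / (z + W.yA) := by
  rw [yOf]
  field_simp
  ring

theorem yOf_ne_one {z : ℂ} (hz : z + W.yA ≠ 0) : W.yOf z ≠ 1 := by
  intro h
  have h2 := W.one_sub_yOf hz
  rw [h, sub_self] at h2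
  exact div_ne_zero W.AB_ne hz h2.symm

theorem Z_yOf {z : ℂ} (hz : z + W.yA ≠ 0) : W.Z (W.yOf z) = z := by
  have h := W.AB_ne
  rw [Z, W.one_sub_yOf hz, yOf]
  field_simp
  ring

theorem yOf_Z {y : ℂ} (hy : y ≠ 1) : W.yOf (W.Z y) = y := by
  have h := sub_ne_zero.2 hy.symm
  have h2 := W.AB_ne
  rw [yOf, W.Z_add hy, Z]
  field_simp
  ring

theorem Z_injective {y y' : ℂ} (hy : y ≠ 1) (hy' : y' ≠ 1) (h : W.Z y = W.Z y') : y = y' := by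
  rw [← W.yOf_Z hy, h, W.yOf_Z hy']

/-- A continuous function that is positive on the domain and vanishes on the curve. -/
noncomputable def level (y : ℂ) : ℝ :=
  ‖(W.yA - 1) * y + (W.yB + 1)‖ - ‖(W.yA + 1) * y + (W.yB - 1)‖ + 2 * W.co * ‖1 - y‖

theorem continuous_level : Continuous W.level := by
  unfold level
  fun_prop

theorem level_one : W.level 1 = 0 := by
  rw [level]
  have e1 : ((W.yA : ℂ) - 1) * 1 + (W.yB + 1) = (W.yA + W.yB) := by ring
  have e2 : ((W.yA : ℂ) + 1) * 1 + (W.yB - 1) = (W.yA + W.yB) := by ring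
  rw [e1, e2]
  simp

theorem level_eq {y : ℂ} (hy : y ≠ 1) :
    W.level y = ‖1 - y‖ * (‖1 + W.Z y‖ - ‖W.Z y - 1‖ + 2 * W.co) := by
  have h := sub_ne_zero.2 hy.symm
  have e1 : ((W.yA : ℂ) - 1) * y + (W.yB + 1) = (1 - y) * (1 + W.Z y) := by
    rw [Z]; field_simp; ring
  have e2 : ((W.yA : ℂ) + 1) * y + (W.yB - 1) = (1 - y) * (W.Z y - 1) := by
    rw [Z]; field_simp; ring
  rw [level, e1, e2, norm_mul, norm_mul]
  ring

theorem level_cosh {y w : ℂ} (hy : y ≠ 1) (hw : cosh w = W.Z y) :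
    W.level y = ‖1 - y‖ * (2 * (Real.cos w.im + W.co)) := by
  rw [W.level_eq hy, ← hw, norm_sub_norm_cosh]
  ring

theorem one_add_Z_mem_slitPlane {y : ℂ} (hy : y ≠ 1) (h : 0 ≤ W.level y) :
    1 + W.Z y ∈ slitPlane := by
  apply mem_slitPlane_of_norm_sub
  rw [W.level_eq hy] at h
  have := nonneg_of_mul_nonneg_right h (norm_pos_iff.2 (sub_ne_zero.2 hy.symm))
  linarith [W.co_lt_one]

theorem exists_strip {y : ℂ} (hy : y ≠ 1) (h : 0 ≤ W.level y) :
    ∃ w : ℂ, |w.im| ≤ W.ang ∧ cosh w = W.Z y ∧ (0 < W.level y → |w.im| < W.ang) ∧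
      (W.level y = 0 → |w.im| = W.ang) := by
  have hs := W.one_add_Z_mem_slitPlane hy h
  have hc := cosh_arcoshC (W.Z y)
  have hi := abs_im_arcoshC_lt hs
  have hn := norm_pos_iff.2 (sub_ne_zero.2 hy.symm)
  have hl := W.level_cosh hy hc
  refine ⟨arcoshC (W.Z y), ?_, hc, fun h1 => ?_, fun h1 => ?_⟩
  · apply W.abs_le_ang hi.le
    rw [hl] at h
    linarith [nonneg_of_mul_nonneg_right h hn]
  · apply W.abs_lt_ang hi.le
    rw [hl] at h1
    linarith [pos_of_mul_pos_right h1 hn.le]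
  · apply W.abs_eq_ang hi.le
    rw [hl] at h1
    linarith [(mul_eq_zero.1 h1).resolve_left hn.ne']

/-- The pole of `yOf` is Z = -yA, where the focal difference is -2 yA ≤ -2 co. Inside the strip it
exceeds -2 co. -/
theorem cosh_add_ne_of_strip {w : ℂ} (hw : |w.im| < W.ang) : cosh w + W.yA ≠ 0 := by
  intro h
  have h1 : cosh w = ((-W.yA : ℝ) : ℂ) := by
    rw [eq_neg_of_add_eq_zero_left h, ofReal_neg]
  have h2 := norm_sub_norm_cosh w
  have e1 : ‖1 + ((-W.yA : ℝ) : ℂ)‖ = 1 - W.yA := by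
    rw [← ofReal_one, ← ofReal_add, norm_real, Real.norm_eq_abs, abs_of_nonneg] <;>
      linarith [W.yA_le]
  have e2 : ‖((-W.yA : ℝ) : ℂ) - 1‖ = 1 + W.yA := by
    rw [← ofReal_one, ← ofReal_sub, norm_real, Real.norm_eq_abs, abs_of_nonpos] <;>
      linarith [W.yA_pos]
  rw [h1, e1, e2] at h2
  linarith [W.neg_co_lt_cos hw, W.co_le_yA]

theorem level_pos_of_strip {w : ℂ} (hw : |w.im| < W.ang) : 0 < W.level (W.yOf (cosh w)) := by
  have h := W.cosh_add_ne_of_strip hw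
  have h1 := W.yOf_ne_one h
  rw [W.level_cosh h1 (W.Z_yOf h).symm]
  have := W.neg_co_lt_cos hw
  have := norm_pos_iff.2 (sub_ne_zero.2 h1.symm)
  apply mul_pos this
  linarith

theorem ne_one_of_level_pos {y : ℂ} (h : 0 < W.level y) : y ≠ 1 := by
  rintro rfl
  rw [W.level_one] at h
  exact lt_irrefl _ h

theorem image_strip : (fun w => W.yOf (cosh w)) '' {w | |w.im| < W.ang} = {y | 0 < W.level y} := by
  ext y
  constructor
  · rintro ⟨w, hw, rfl⟩
    exact W.level_pos_of_strip hw
  · intro h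
    have hy := W.ne_one_of_level_pos h
    obtain ⟨w, _, h2, h3, _⟩ := W.exists_strip hy (le_of_lt h)
    exact ⟨w, h3 h, by simp only [h2, W.yOf_Z hy]⟩

theorem differentiableAt_yOf {z : ℂ} (hz : z + W.yA ≠ 0) : DifferentiableAt ℂ W.yOf z := by
  unfold yOf
  fun_prop (disch := exact hz)

theorem continuousAt_yOf_cosh {w : ℂ} (hz : cosh w + W.yA ≠ 0) :
    ContinuousAt (fun w => W.yOf (cosh w)) w :=
  ContinuousAt.comp (W.differentiableAt_yOf hz).continuousAt continuous_cosh.continuousAt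

theorem isPreconnected_domain : IsPreconnected {y | 0 < W.level y} := by
  rw [← image_strip]
  apply IsPreconnected.image
  · apply Convex.isPreconnected
    have : {w : ℂ | |w.im| < W.ang} = Complex.imLm ⁻¹' Set.Ioo (-W.ang) W.ang := by
      ext w
      simp [abs_lt]
    rw [this]
    exact (convex_Ioo _ _).linear_preimage Complex.imLm
  · intro w hw
    exact (W.continuousAt_yOf_cosh (W.cosh_add_ne_of_strip hw)).continuousWithinAt

theorem isOpen_domain : IsOpen {y | 0 < W.level y} :=
  isOpen_lt continuous_const W.continuous_level

/-- The point 1 corresponds to Z = ∞, which is approached along real w → +∞. -/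
theorem one_mem_closure : (1 : ℂ) ∈ closure {y | 0 < W.level y} := by
  have h1 : Tendsto (fun t : ℝ => ((W.yA + W.yB : ℝ) : ℂ) * ((Real.cosh t + W.yA)⁻¹ : ℝ)) atTop
      (𝓝 (((W.yA + W.yB : ℝ) : ℂ) * ((0 : ℝ) : ℂ))) := by
    apply Tendsto.const_mul
    apply (continuous_ofReal.tendsto 0).comp
    apply tendsto_inv_atTop_zero.comp
    exact tendsto_atTop_add_const_right _ _ tendsto_cosh_atTop
  have h2 := h1.const_sub 1
  rw [ofReal_zero, mul_zero, sub_zero] at h2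
  refine mem_closure_of_tendsto h2 (Eventually.of_forall fun t => ?_)
  have hs : |((t : ℂ)).im| < W.ang := by simpa using W.ang_pos
  have := W.level_pos_of_strip hs
  have e : W.yOf (cosh t) = 1 - ((W.yA + W.yB : ℝ) : ℂ) * ((Real.cosh t + W.yA)⁻¹ : ℝ) := by
    rw [eq_sub_iff_add_eq, ← eq_sub_iff_add_eq', W.one_sub_yOf (W.cosh_add_ne_of_strip hs)]
    push_cast
    rw [div_eq_mul_inv]
  rw [← e]
  exact this

theorem closure_domain : closure {y | 0 < W.level y} = {y | 0 ≤ W.level y} := by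
  apply Set.Subset.antisymm
  · exact closure_minimal (fun y hy => le_of_lt (show 0 < W.level y from hy))
      (isClosed_le continuous_const W.continuous_level)
  · intro y hy
    by_cases h1 : y = 1
    · rw [h1]
      exact W.one_mem_closure
    obtain ⟨w, hw, h2, -, -⟩ := W.exists_strip h1 hy
    -- A point of the closed strip is approached from inside by contracting its imaginary part by r
    -- < 1.
    have hc : ContinuousAt (fun r : ℝ => W.yOf (cosh (w.re + r * (w.im * I)))) 1 := by
      have e : (w.re : ℂ) + ((1 : ℝ) : ℂ) * (w.im * I) = w := by simp
      apply ContinuousAt.comp (g := fun w => W.yOf (cosh w))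
        (f := fun r : ℝ => (w.re : ℂ) + r * (w.im * I))
      · apply W.continuousAt_yOf_cosh
        rw [e, h2]
        exact W.Z_add_ne h1
      · fun_prop
    have h3 : Tendsto (fun r : ℝ => W.yOf (cosh (w.re + r * (w.im * I)))) (𝓝[<] 1) (𝓝 y) := by
      have := hc.tendsto
      have e : (w.re : ℂ) + ((1 : ℝ) : ℂ) * (w.im * I) = w := by simp
      rw [e, h2, W.yOf_Z h1] at this
      exact this.mono_left nhdsWithin_le_nhds
    refine mem_closure_of_tendsto h3 ?_
    filter_upwards [Ioo_mem_nhdsLT (show (0 : ℝ) < 1 by norm_num)] with r hr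
    apply W.level_pos_of_strip
    have : ((w.re : ℂ) + r * (w.im * I)).im = r * w.im := by simp
    rw [this, abs_mul, abs_of_pos hr.1]
    have := abs_nonneg w.im
    have := W.ang_pos
    nlinarith [hr.1, hr.2]

theorem frontier_domain : frontier {y | 0 < W.level y} = {y | W.level y = 0} := by
  rw [frontier, W.closure_domain, W.isOpen_domain.interior_eq]
  ext y
  simp only [Set.mem_sdiff, Set.mem_ofPred_eq, not_lt]
  exact ⟨fun h => le_antisymm h.2 h.1, fun h => ⟨h.ge, h.le⟩⟩

/-! ### The curve as the zero set of the kernel -/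

/-- The transformation `U = (xA x + xB) / (1 - x)`. -/
noncomputable def U (x : ℂ) : ℂ := (W.xA * x + W.xB) / (1 - x)

/-- The inverse of the transformation `U`. -/
noncomputable def xOf (u : ℂ) : ℂ := (u - W.xB) / (u + W.xA)

theorem xAB_ne : (W.xA : ℂ) + W.xB ≠ 0 := by
  exact_mod_cast (add_pos W.xA_pos W.xB_pos).ne'

theorem one_sub_xOf {u : ℂ} (hu : u + W.xA ≠ 0) : 1 - W.xOf u = (W.xA + W.xB) / (u + W.xA) := by
  rw [xOf]
  field_simp
  ring

theorem xOf_ne_one {u : ℂ} (hu : u + W.xA ≠ 0) : W.xOf u ≠ 1 := by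
  intro h
  have h2 := W.one_sub_xOf hu
  rw [h, sub_self] at h2
  exact div_ne_zero W.xAB_ne hu h2.symm

theorem U_xOf {u : ℂ} (hu : u + W.xA ≠ 0) : W.U (W.xOf u) = u := by
  have h := W.xAB_ne
  rw [U, W.one_sub_xOf hu, xOf]
  field_simp
  ring

/-- The roots in Z of the kernel form at U = cosh t. By the addition formula their sum is 2 cosh t
cos θ = -2 co cosh t, which matches the linear coefficient. -/
theorem quadratic_factor (t : ℝ) (z : ℂ) :
    z ^ 2 + cosh t ^ 2 + 2 * W.co * z * cosh t - (1 - W.co ^ 2) =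
      (z - cosh (t + W.ang * I)) * (z - cosh (t - W.ang * I)) := by
  have e1 : cosh (t + W.ang * I) = cosh t * Complex.cos W.ang + sinh t * (Complex.sin W.ang * I) := by
    rw [cosh_add, cosh_mul_I, sinh_mul_I]
  have e2 : cosh (t - W.ang * I) = cosh t * Complex.cos W.ang - sinh t * (Complex.sin W.ang * I) := by
    rw [cosh_sub, cosh_mul_I, sinh_mul_I]
  have e3 : Complex.cos W.ang = -(W.co : ℂ) := by
    rw [← ofReal_cos, W.cos_ang, ofReal_neg]
  have e4 : Complex.sin W.ang ^ 2 = 1 - (W.co : ℂ) ^ 2 := by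
    rw [← ofReal_sin, W.sin_ang, ← ofReal_pow, W.si_sq]
    push_cast
    rfl
  rw [e1, e2, e3]
  have h := Complex.cosh_sq t
  linear_combination (Complex.sin W.ang) ^ 2 * sinh t ^ 2 * I_sq - sinh t ^ 2 * e4
    + (1 - W.co ^ 2) * h

end Weights

namespace Weights.Of

variable {W : Weights} {p : ℤ → ℤ → ℝ} (h : W.Of p)
include h

theorem kernel_eq_zero_iff {x y : ℂ} (hx : x ≠ 1) (hy : y ≠ 1) : kernel (phi p) x y = 0 ↔
    W.Z y ^ 2 + W.U x ^ 2 + 2 * W.co * W.Z y * W.U x - (1 - W.co ^ 2) = 0 := by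
  have hx' := sub_ne_zero.2 hx.symm
  have hy' := sub_ne_zero.2 hy.symm
  have e : ((W.yA : ℂ) + W.yB) ^ 2 * kernel (phi p) x y = ((W.b + W.c) * ((1 - x) ^ 2 * (1 - y) ^ 2))
      * (W.Z y ^ 2 + W.U x ^ 2 + 2 * W.co * W.Z y * W.U x - (1 - W.co ^ 2)) := by
    rw [h.kernel_eq_mobius, Weights.Z, Weights.U]
    field_simp
  have hbc : (W.b : ℂ) + W.c ≠ 0 := by exact_mod_cast W.pos.ne'
  have h1 : ((W.yA : ℂ) + W.yB) ^ 2 ≠ 0 := pow_ne_zero _ W.AB_ne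
  have h2 : ((W.b : ℂ) + W.c) * ((1 - x) ^ 2 * (1 - y) ^ 2) ≠ 0 :=
    mul_ne_zero hbc (mul_ne_zero (pow_ne_zero _ hx') (pow_ne_zero _ hy'))
  constructor
  · intro h0
    rw [h0, mul_zero] at e
    exact (mul_eq_zero.1 e.symm).resolve_left h2
  · intro h0
    rw [h0, mul_zero] at e
    exact (mul_eq_zero.1 e).resolve_left h1

theorem kernel_one_one : kernel (phi p) 1 1 = 0 := by
  have e := h.kernel_eq_mobius 1 1
  have h1 : ((W.yA : ℂ) + W.yB) ^ 2 ≠ 0 := pow_ne_zero _ W.AB_ne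
  have : ((W.yA : ℂ) + W.yB) ^ 2 * kernel (phi p) 1 1 = 0 := by
    rw [e]; ring
  exact (mul_eq_zero.1 this).resolve_left h1

theorem kernel_one_ne_zero {y : ℂ} (hy : y ≠ 1) : kernel (phi p) 1 y ≠ 0 := by
  intro h0
  have e := h.kernel_eq_mobius 1 y
  rw [h0, mul_zero] at e
  have hbc : (W.b : ℂ) + W.c ≠ 0 := by exact_mod_cast W.pos.ne'
  have : ((W.b : ℂ) + W.c) * ((W.xA + W.xB) ^ 2 * (1 - y) ^ 2) = 0 := by
    rw [e]; ring
  exact mul_ne_zero hbc (mul_ne_zero (pow_ne_zero _ W.xAB_ne)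
    (pow_ne_zero _ (sub_ne_zero.2 hy.symm))) this

/-- As x runs over [x₁, 1), U runs over [1, ∞) and equals cosh t with t real. Then Z = cosh(t ± iθ)
lies on an edge of the strip. The endpoint x = 1 contributes only y = 1. -/
theorem curveL_eq : curveL (phi p) = {y | W.level y = 0} := by
  have hA := W.xA_pos
  have hB := W.xB_pos
  ext y
  rw [curveL, h.branchOne_delta]
  simp only [Set.mem_ofPred_eq, Set.mem_Icc]
  by_cases hy : y = 1
  · subst hy
    refine ⟨fun _ => W.level_one, fun _ => ⟨1, ⟨?_, le_rfl⟩, by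
      rw [ofReal_one]; exact h.kernel_one_one⟩⟩
    rw [div_le_iff₀ (by linarith)]
    linarith
  constructor
  · rintro ⟨x, ⟨hx1, hx2⟩, hK⟩
    have hx : x ≠ 1 := by
      rintro rfl
      rw [ofReal_one] at hK
      exact h.kernel_one_ne_zero hy hK
    have hlt : x < 1 := lt_of_le_of_ne hx2 hx
    rw [div_le_iff₀ (by linarith)] at hx1
    rw [h.kernel_eq_zero_iff (by exact_mod_cast hx) hy] at hK
    have hU1 : 1 ≤ (W.xA * x + W.xB) / (1 - x) := by
      rw [le_div_iff₀ (by linarith)]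
      linarith
    have hU : W.U x = cosh (Real.arcosh ((W.xA * x + W.xB) / (1 - x)) : ℝ) := by
      rw [← ofReal_cosh, Real.cosh_arcosh hU1, Weights.U]
      push_cast
      rfl
    rw [hU, W.quadratic_factor] at hK
    rcases mul_eq_zero.1 hK with h1 | h1
    · rw [W.level_cosh hy (sub_eq_zero.1 h1).symm]
      simp [W.cos_ang]
    · rw [W.level_cosh hy (sub_eq_zero.1 h1).symm]
      simp [W.cos_ang]
  · intro hl
    obtain ⟨w, -, hw, -, h0⟩ := W.exists_strip hy hl.ge
    have him := h0 hl
    have hc := Real.one_le_cosh w.re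
    have hd : 0 < Real.cosh w.re + W.xA := by linarith
    have hd' : cosh (w.re : ℂ) + W.xA ≠ 0 := by
      rw [← ofReal_cosh]; exact_mod_cast hd.ne'
    have e : (((Real.cosh w.re - W.xB) / (Real.cosh w.re + W.xA) : ℝ) : ℂ) =
        W.xOf (cosh w.re) := by
      rw [Weights.xOf, ← ofReal_cosh]; push_cast; rfl
    refine ⟨(Real.cosh w.re - W.xB) / (Real.cosh w.re + W.xA), ⟨?_, ?_⟩, ?_⟩
    · rw [div_le_div_iff₀ (by linarith) hd]
      nlinarith
    · rw [div_le_one hd]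
      linarith
    · rw [e, h.kernel_eq_zero_iff (W.xOf_ne_one hd') hy, W.U_xOf hd', W.quadratic_factor, ← hw]
      rcases abs_choice w.im with hi | hi
      · have : (w.re : ℂ) + W.ang * I = w := by
          rw [← him, hi, re_add_im]
        rw [this, sub_self, zero_mul]
      · have : (w.re : ℂ) - W.ang * I = w := by
          rw [← him, hi, ofReal_neg, neg_mul, sub_neg_eq_add, re_add_im]
        rw [this, sub_self, mul_zero]

theorem domainL_eq : domainL (phi p) = {y | 0 < W.level y} := by
  have h0 : (branchOne (deltaTilde (phi p)) : ℂ) ∈ {y | 0 < W.level y} := by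
    -- The branch point y₁ is Z = 1, that is w = 0, the centre of the strip.
    have e : ((branchOne (deltaTilde (phi p)) : ℝ) : ℂ) = W.yOf (cosh 0) := by
      rw [h.branchOne_deltaTilde, Weights.yOf, cosh_zero]
      push_cast
      rfl
    rw [e]
    apply W.level_pos_of_strip
    simpa using W.ang_pos
  rw [domainL, h.curveL_eq]
  have hsub : {y | 0 < W.level y} ⊆ {y | W.level y = 0}ᶜ := fun y hy => ne_of_gt hy
  apply Set.Subset.antisymm
  · have hu : IsOpen {y | W.level y < 0} := isOpen_lt W.continuous_level continuous_const
    -- Off the curve, `level` has a sign, and the two signs define disjoint open sets. A connected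
    -- subset meeting the positive one stays in it.
    apply isPreconnected_connectedComponentIn.subset_left_of_subset_union W.isOpen_domain hu
    · rw [Set.disjoint_left]
      intro y h1 h2
      exact lt_asymm (show 0 < W.level y from h1) h2
    · intro y hy
      have := connectedComponentIn_subset _ _ hy
      rcases lt_or_gt_of_ne this with h1 | h1
      · exact Or.inr h1
      · exact Or.inl h1
    · exact ⟨_, mem_connectedComponentIn (hsub h0), h0⟩
  · exact W.isPreconnected_domain.subset_connectedComponentIn h0 hsub

end Weights.Of

end ThreeQuadrants

/-! ### The function `h` and the function `G` = cosh(χw/2) on the closed domain -/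

namespace ThreeQuadrants

open Complex Filter

theorem coshPow_conj (lam : ℝ) {z : ℂ} (hz : 1 + z ∈ slitPlane) :
    coshPow lam (starRingEnd ℂ z) = starRingEnd ℂ (coshPow lam z) := by
  have h := abs_im_arcoshC_lt hz
  have h2 : |(starRingEnd ℂ (arcoshC z)).im| < Real.pi := by rwa [conj_im, abs_neg]
  have h3 : cosh (starRingEnd ℂ (arcoshC z)) = starRingEnd ℂ z := by
    rw [cosh_conj, cosh_arcoshC]
  rw [← h3, coshPow_cosh lam h2, coshPow, ← cosh_conj, map_mul, conj_ofReal]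

/-- Here u - 1 = ζ²(u + 1), so √(u² - 1) is ±ζ(u + 1). The condition Re ζ > 0 selects the plus sign.
-/
theorem funh_eq {ζ : ℂ} (hζ : 0 < ζ.re) (h1 : 1 - ζ ^ 2 ≠ 0) :
    funh (2 / (1 - ζ ^ 2) - 1) = (ζ - 1) / (ζ + 1) := by
  set u := 2 / (1 - ζ ^ 2) - 1 with hu
  have e1 : u + 1 = 2 / (1 - ζ ^ 2) := by rw [hu]; ring
  have e2 : u - 1 = ζ ^ 2 * (u + 1) := by rw [e1, hu]; field_simp; ring
  set P := Complex.sqrt (u + 1) with hP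
  set Q := Complex.sqrt (u - 1) with hQ
  have hP2 : P ^ 2 = u + 1 := sqrt_sq _
  have hQ2 : Q ^ 2 = u - 1 := sqrt_sq _
  have hPne : P ≠ 0 := by
    intro h
    rw [h, e1] at hP2
    exact div_ne_zero two_ne_zero h1 (by rw [← hP2]; norm_num)
  have hpm : Q = ζ * P ∨ Q = -(ζ * P) := by
    apply sq_eq_sq_iff_eq_or_eq_neg.1
    rw [hQ2, mul_pow, hP2, e2]
  -- The numbers u ± 1 have the same imaginary part, so their principal roots lie in a common closed
  -- quadrant. This excludes Q = -ζP.
  have hprod : 0 ≤ Q.re * P.re + Q.im * P.im := by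
    have h3 : 0 ≤ Q.re * P.re := mul_nonneg (sqrt_re_nonneg _) (sqrt_re_nonneg _)
    have h4 : 0 ≤ Q.im * P.im := by
      rcases le_or_gt 0 u.im with h5 | h5
      · exact mul_nonneg (sqrt_im_nonneg (by simpa using h5)) (sqrt_im_nonneg (by simpa using h5))
      · exact mul_nonneg_of_nonpos_of_nonpos (sqrt_im_nonpos (by simpa using h5))
          (sqrt_im_nonpos (by simpa using h5))
    linarith
  have hQP : Q = ζ * P := by
    rcases hpm with h3 | h3
    · exact h3
    · exfalso
      have h4 : Q.re * P.re + Q.im * P.im = -(ζ.re * normSq P) := by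
        rw [h3, normSq_apply]
        simp
        ring
      rw [h4] at hprod
      have := mul_pos hζ (normSq_pos.2 hPne)
      linarith
  have h5 : ζ + 1 ≠ 0 := by
    intro h
    have := congrArg re h
    simp at this
    linarith
  have h6 : 1 - ζ ≠ 0 := by
    intro h
    apply h1
    linear_combination (1 + ζ) * h
  rw [funh, ← hP, ← hQ, hQP, mul_assoc, ← sq, hP2, e1, hu, eq_div_iff h5]
  have e3 : 1 - ζ ^ 2 = (1 - ζ) * (ζ + 1) := by ring
  rw [e3]
  field_simp
  ring

namespace Weights

variable (W : Weights)

/-- The constant `cos (χ φ₀ / 2)`, where `cos φ₀ = yB` is the value of `Z` at `0`. -/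
noncomputable def cz : ℝ := Real.cos (W.chi / 2 * Real.arccos W.yB)

/-- The function `cosh (χ w / 2)`, where `cosh w = Z`. -/
noncomputable def G (y : ℂ) : ℂ := coshPow (W.chi / 2) (W.Z y)

theorem cz_pos : 0 < W.cz := by
  have h1 := Real.arccos_nonneg W.yB
  have h2 := Real.arccos_lt_pi_div_two.2 W.yB_pos
  have h3 := W.chi_pos
  have h4 := W.chi_lt_two
  apply Real.cos_pos_of_mem_Ioo
  constructor
  · have := mul_nonneg (half_pos h3).le h1
    linarith [Real.pi_pos]
  · nlinarith

theorem cz_ne : (W.cz : ℂ) ≠ 0 := by exact_mod_cast W.cz_pos.ne'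

theorem coshPow_real {t : ℝ} (h0 : 0 ≤ t) (h1 : t < Real.pi) (lam : ℝ) :
    coshPow lam (Real.cos t : ℂ) = (Real.cos (lam * t) : ℂ) := by
  have e : ((Real.cos t : ℝ) : ℂ) = cosh (t * I) := by rw [cosh_mul_I, ofReal_cos]
  rw [e, coshPow_cosh]
  · rw [← mul_assoc, cosh_mul_I, ofReal_cos, ofReal_mul]
  · simpa [abs_of_nonneg h0] using h1

theorem G_zero : W.G 0 = W.cz := by
  have h1 := Real.arccos_nonneg W.yB
  have h2 := Real.arccos_lt_pi_div_two.2 W.yB_pos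
  have e : W.Z 0 = (Real.cos (Real.arccos W.yB) : ℂ) := by
    rw [Real.cos_arccos (by linarith [W.yB_pos]) W.yB_le, Z]
    simp
  rw [G, e, coshPow_real h1 (by linarith [Real.pi_pos]), cz]

/-- The value -co is Z at w = iθ, where χw/2 = iπ/2. It is the value of Z at Y(x₁). -/
theorem coshPow_neg_co : coshPow (W.chi / 2) (-W.co : ℂ) = 0 := by
  have e : (-W.co : ℂ) = (Real.cos W.ang : ℂ) := by rw [W.cos_ang, ofReal_neg]
  rw [e, coshPow_real W.ang_pos.le W.ang_lt_pi]
  have : W.chi / 2 * W.ang = Real.pi / 2 := by linarith [W.chi_mul_ang]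
  rw [this, Real.cos_pi_div_two, ofReal_zero]

/-- An open set that contains the closure of the domain, except for the point `1`. -/
def region : Set ℂ := {y | y ≠ 1 ∧ 1 + W.Z y ∈ slitPlane}

theorem hasDerivAt_Z {y : ℂ} (hy : y ≠ 1) : HasDerivAt W.Z ((W.yA + W.yB) / (1 - y) ^ 2) y := by
  have h := sub_ne_zero.2 hy.symm
  have h1 : HasDerivAt (fun y : ℂ => (W.yA : ℂ) * y + W.yB) (W.yA : ℂ) y := by
    simpa using ((hasDerivAt_id y).const_mul (W.yA : ℂ)).add_const (W.yB : ℂ)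
  have h2 : HasDerivAt (fun y : ℂ => 1 - y) (-1) y := by
    simpa using (hasDerivAt_id y).const_sub (1 : ℂ)
  refine (h1.div h2 h).congr_deriv ?_
  field_simp
  ring

theorem isOpen_region : IsOpen W.region := by
  have h : ContinuousOn (fun y => 1 + W.Z y) {1}ᶜ := fun y hy =>
    (continuousAt_const.add (W.hasDerivAt_Z hy).continuousAt).continuousWithinAt
  exact h.isOpen_inter_preimage isOpen_compl_singleton isOpen_slitPlane

theorem closure_subset_region : closure {y | 0 < W.level y} \ {1} ⊆ W.region := by
  rw [W.closure_domain]
  rintro y ⟨h1, h2⟩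
  exact ⟨h2, W.one_add_Z_mem_slitPlane h2 h1⟩

theorem domain_subset_region : {y | 0 < W.level y} ⊆ W.region := fun _ hy =>
  ⟨W.ne_one_of_level_pos hy, W.one_add_Z_mem_slitPlane (W.ne_one_of_level_pos hy)
    (le_of_lt (show 0 < W.level _ from hy))⟩

theorem analyticOnNhd_G : AnalyticOnNhd ℂ W.G W.region := by
  apply DifferentiableOn.analyticOnNhd _ W.isOpen_region
  intro y hy
  exact ((differentiableAt_coshPow _ hy.2).comp y
    (W.hasDerivAt_Z hy.1).differentiableAt).differentiableWithinAt

theorem deriv_G_ne_zero {y : ℂ} (hy : y ∈ W.region) : deriv W.G y ≠ 0 := by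
  have h := (differentiableAt_coshPow (W.chi / 2) hy.2).hasDerivAt.comp y (W.hasDerivAt_Z hy.1)
  have e : deriv W.G y = _ := h.deriv
  rw [e]
  exact mul_ne_zero (deriv_coshPow_ne_zero (half_pos W.chi_pos) (by linarith [W.chi_lt_two]) hy.2)
    (div_ne_zero W.AB_ne (pow_ne_zero _ (sub_ne_zero.2 hy.1.symm)))

theorem G_eq {y w : ℂ} (hw : |w.im| ≤ W.ang) (h : cosh w = W.Z y) :
    W.G y = cosh ((W.chi / 2 : ℝ) * w) := by
  rw [G, ← h, coshPow_cosh _ (hw.trans_lt W.ang_lt_pi)]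

theorem abs_im_half_chi_lt {w : ℂ} (hw : |w.im| < W.ang) :
    |(((W.chi / 2 : ℝ) : ℂ) * w).im| < Real.pi / 2 := by
  rw [im_ofReal_mul, abs_mul, abs_of_pos (half_pos W.chi_pos)]
  have := mul_lt_mul_of_pos_left hw (half_pos W.chi_pos)
  linarith [W.chi_mul_ang]

/-- The factor χ/2 compresses the strip |Im w| < θ to |Im| < π/2, where cosh has positive real part.
-/
theorem G_re_pos {y : ℂ} (hy : 0 < W.level y) : 0 < (W.G y).re := by
  obtain ⟨w, hw, h1, h2, -⟩ := W.exists_strip (W.ne_one_of_level_pos hy) hy.le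
  rw [W.G_eq hw h1]
  exact cosh_re_pos (W.abs_im_half_chi_lt (h2 hy))

theorem G_injOn {y y' : ℂ} (hy : 0 < W.level y) (hy' : 0 < W.level y') (h : W.G y = W.G y') :
    y = y' := by
  have h1 := W.ne_one_of_level_pos hy
  have h1' := W.ne_one_of_level_pos hy'
  obtain ⟨w, hw, h2, h3, -⟩ := W.exists_strip h1 hy.le
  obtain ⟨w', hw', h2', h3', -⟩ := W.exists_strip h1' hy'.le
  rw [W.G_eq hw h2, W.G_eq hw' h2'] at h
  have hc : ((W.chi / 2 : ℝ) : ℂ) ≠ 0 := by exact_mod_cast (half_pos W.chi_pos).ne'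
  have hpi := Real.pi_pos
  have := cosh_injOn_strip (by linarith [W.abs_im_half_chi_lt (h3 hy)])
    (by linarith [W.abs_im_half_chi_lt (h3' hy')]) h
  apply W.Z_injective h1 h1'
  rw [← h2, ← h2']
  rcases this with h4 | h4
  · rw [mul_left_cancel₀ hc h4]
  · rw [← mul_neg] at h4
    rw [mul_left_cancel₀ hc h4, cosh_neg]

theorem Z_conj (y : ℂ) : W.Z (starRingEnd ℂ y) = starRingEnd ℂ (W.Z y) := by
  simp [Z]

theorem level_conj (y : ℂ) : W.level (starRingEnd ℂ y) = W.level y := by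
  have e : ∀ u v : ℝ, ‖(u : ℂ) * starRingEnd ℂ y + v‖ = ‖(u : ℂ) * y + v‖ := by
    intro u v
    rw [← norm_conj]
    simp
  have e1 := e (W.yA - 1) (W.yB + 1)
  have e2 := e (W.yA + 1) (W.yB - 1)
  have e3 := e (-1) 1
  have e4 : ∀ z : ℂ, 1 - z = ((-1 : ℝ) : ℂ) * z + ((1 : ℝ) : ℂ) := by
    intro z; push_cast; ring
  push_cast at e1 e2
  rw [level, level, e1, e2, e4, e3, ← e4]

theorem G_conj {y : ℂ} (hy : y ∈ W.region) : W.G (starRingEnd ℂ y) = starRingEnd ℂ (W.G y) := by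
  rw [G, Z_conj, coshPow_conj _ hy.2, G]

/-- On the curve, the values of `G` are purely imaginary. -/
theorem G_re_eq_zero {y : ℂ} (h1 : y ≠ 1) (hy : W.level y = 0) : (W.G y).re = 0 := by
  obtain ⟨w, hw, h2, -, h4⟩ := W.exists_strip h1 hy.ge
  rw [W.G_eq hw h2, cosh_re]
  have h5 : Real.cos (((W.chi / 2 : ℝ) : ℂ) * w).im = 0 := by
    rw [im_ofReal_mul, ← Real.cos_abs, abs_mul, h4 hy, abs_of_pos (half_pos W.chi_pos)]
    have : W.chi / 2 * W.ang = Real.pi / 2 := by linarith [W.chi_mul_ang]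
    rw [this, Real.cos_pi_div_two]
  rw [h5, mul_zero]

theorem G_conj_eq_neg {y : ℂ} (h1 : y ≠ 1) (hy : W.level y = 0) :
    W.G (starRingEnd ℂ y) = -W.G y := by
  rw [W.G_conj ⟨h1, W.one_add_Z_mem_slitPlane h1 hy.ge⟩]
  have := W.G_re_eq_zero h1 hy
  apply Complex.ext
  · rw [conj_re, neg_re, this, neg_zero]
  · rw [conj_im, neg_im]

theorem one_lt_chi : 1 < W.chi := by
  rw [chi, lt_div_iff₀ W.ang_pos]
  linarith [W.ang_lt_pi]

/-- With u = Re w, one has |Z| ≤ cosh u and |G|² ≥ sinh²(χu/2) ≥ sinh²(u/2), the last step because χ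
> 1. This transfers the pole of Z at 1 to w̃. -/
theorem norm_G_sq_ge {y : ℂ} (h1 : y ≠ 1) (hy : 0 ≤ W.level y) :
    (‖W.Z y‖ - 1) / 2 ≤ ‖W.G y‖ ^ 2 := by
  obtain ⟨w, hw, h2, -, -⟩ := W.exists_strip h1 hy
  have hsq : ∀ v : ℂ, ‖cosh v‖ ^ 2 = Real.cosh v.re ^ 2 - Real.sin v.im ^ 2 := by
    intro v
    rw [← normSq_eq_norm_sq, normSq_apply, cosh_re, cosh_im]
    have := Real.cosh_sq v.re
    have := Real.sin_sq_add_cos_sq v.im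
    linear_combination (Real.cosh v.re ^ 2) * (Real.sin_sq_add_cos_sq v.im)
      - Real.sin v.im ^ 2 * (Real.cosh_sq v.re)
  have hup : ‖W.Z y‖ ≤ Real.cosh w.re := by
    rw [← h2]
    refine (sq_le_sq₀ (norm_nonneg _) (Real.cosh_pos _).le).1 ?_
    rw [hsq]
    nlinarith [sq_nonneg (Real.sin w.im)]
  have hlow : Real.sinh (w.re / 2) ^ 2 ≤ ‖W.G y‖ ^ 2 := by
    rw [W.G_eq hw h2, hsq, re_ofReal_mul]
    have h5 := Real.cosh_sq (W.chi / 2 * w.re)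
    have h6 := Real.sin_sq_le_one (((W.chi / 2 : ℝ) : ℂ) * w).im
    have h7 : Real.sinh (w.re / 2) ^ 2 ≤ Real.sinh (W.chi / 2 * w.re) ^ 2 := by
      rw [sq_le_sq, Real.abs_sinh, Real.abs_sinh, Real.sinh_le_sinh, abs_mul, abs_div, abs_two,
        abs_of_pos (half_pos W.chi_pos)]
      nlinarith [abs_nonneg w.re, W.one_lt_chi]
    linarith
  have h8 : Real.cosh w.re = 2 * Real.sinh (w.re / 2) ^ 2 + 1 := by
    have := Real.cosh_two_mul (w.re / 2)
    rw [mul_div_cancel₀ w.re two_ne_zero] at this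
    have h9 := Real.cosh_sq (w.re / 2)
    linarith
  linarith

theorem tendsto_norm_Z_one : Tendsto (fun y => ‖W.Z y‖) (𝓝[≠] 1) atTop := by
  have h1 : Tendsto (fun y : ℂ => ‖1 - y‖) (𝓝[≠] 1) (𝓝[>] 0) := by
    apply tendsto_nhdsWithin_of_tendsto_nhds_of_eventually_within
    · have : Continuous (fun y : ℂ => ‖1 - y‖) := by fun_prop
      have h2 := this.tendsto 1
      rw [sub_self, norm_zero] at h2
      exact h2.mono_left nhdsWithin_le_nhds
    · filter_upwards [self_mem_nhdsWithin] with y hy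
      exact norm_pos_iff.2 (sub_ne_zero.2 (Ne.symm hy))
  have h2 : Tendsto (fun y : ℂ => (W.yA + W.yB) * ‖1 - y‖⁻¹ - W.yA) (𝓝[≠] 1) atTop := by
    apply tendsto_atTop_add_const_right
    exact (tendsto_inv_nhdsGT_zero.comp h1).const_mul_atTop (add_pos W.yA_pos W.yB_pos)
  refine tendsto_atTop_mono' _ ?_ h2
  filter_upwards [self_mem_nhdsWithin] with y hy
  have h3 : ‖W.Z y + W.yA‖ = (W.yA + W.yB) * ‖1 - y‖⁻¹ := by
    rw [W.Z_add hy, norm_div, div_eq_mul_inv, ← ofReal_add, norm_real, Real.norm_eq_abs,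
      abs_of_pos (add_pos W.yA_pos W.yB_pos)]
  have h4 := norm_add_le (W.Z y) (W.yA : ℂ)
  rw [h3, norm_real, Real.norm_eq_abs, abs_of_pos W.yA_pos] at h4
  linarith

/-- For large |y| the three norms in `level` contribute about (1 - yA) - (1 + yA) + 2 co = -2(yA -
co) times |y|, which is negative when c ≠ 0. The triangle inequality makes this explicit. -/
theorem norm_le_of_level_nonneg (hc : W.c ≠ 0) {y : ℂ} (hy : 0 ≤ W.level y) :
    ‖y‖ ≤ (1 + W.co) / (W.yA - W.co) := by
  have h0 := W.co_lt_yA hc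
  have hA := W.yA_le
  have hB := W.yB_le
  have hB0 := W.yB_pos
  have hA0 := W.yA_pos
  rw [le_div_iff₀ (by linarith)]
  have h1 : ‖((W.yA : ℂ) - 1) * y + (W.yB + 1)‖ ≤ (1 - W.yA) * ‖y‖ + (W.yB + 1) := by
    refine (norm_add_le _ _).trans ?_
    rw [norm_mul]
    apply add_le_add
    · rw [← ofReal_one, ← ofReal_sub, norm_real, Real.norm_eq_abs, abs_of_nonpos (by linarith),
        neg_sub]
    · rw [← ofReal_one, ← ofReal_add, norm_real, Real.norm_eq_abs, abs_of_pos (by linarith)]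
  have h2 : (W.yA + 1) * ‖y‖ - (1 - W.yB) ≤ ‖((W.yA : ℂ) + 1) * y + (W.yB - 1)‖ := by
    have := norm_sub_norm_le (((W.yA : ℂ) + 1) * y) (-(W.yB - 1))
    rw [sub_neg_eq_add, norm_neg, norm_mul, ← ofReal_one, ← ofReal_add, norm_real,
      Real.norm_eq_abs, abs_of_pos (by linarith), ← ofReal_sub, norm_real,
      Real.norm_eq_abs, abs_of_nonpos (by linarith), neg_sub] at this
    exact_mod_cast this
  have h3 : ‖1 - y‖ ≤ 1 + ‖y‖ := by
    have := norm_sub_le (1 : ℂ) y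
    rwa [norm_one] at this
  have h4 := mul_le_mul_of_nonneg_left h3 W.co_pos.le
  rw [level] at hy
  nlinarith

theorem tendsto_Z_infinity : Tendsto W.Z (Bornology.cobounded ℂ) (𝓝 (-W.yA : ℂ)) := by
  have h1 : Tendsto (fun y : ℂ => (1 - y)⁻¹) (Bornology.cobounded ℂ) (𝓝 0) := by
    apply tendsto_inv₀_cobounded.comp
    exact tendsto_const_sub_cobounded 1
  have h2 := (h1.const_mul ((W.yA : ℂ) + W.yB)).sub_const (W.yA : ℂ)
  rw [mul_zero, zero_sub] at h2
  refine h2.congr' ?_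
  filter_upwards [Bornology.eventually_ne_cobounded (1 : ℂ)] with y hy
  rw [← div_eq_mul_inv, ← W.Z_add hy, add_sub_cancel_right]

/-- When c = 0 the edge point w = iθ has Z = -co = -yA, the pole of `yOf`. Points w = it with t
increasing to θ lie in the strip and escape to infinity. -/
theorem not_isBounded_domain (hc : W.c = 0) : ¬ Bornology.IsBounded {y | 0 < W.level y} := by
  intro hb
  obtain ⟨M, hM⟩ := hb.exists_norm_le
  have hAB := add_pos W.yA_pos W.yB_pos
  have hcont : Tendsto (fun t : ℝ => |Real.cos t + W.yA| * (1 + |M|)) (𝓝[<] W.ang) (𝓝 0) := by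
    have : Continuous (fun t : ℝ => |Real.cos t + W.yA| * (1 + |M|)) := by fun_prop
    have h2 := this.tendsto W.ang
    rw [W.cos_ang, ← W.co_eq_yA hc, neg_add_cancel, abs_zero, zero_mul] at h2
    exact h2.mono_left nhdsWithin_le_nhds
  have hev := hcont.eventually_lt_const hAB
  obtain ⟨t, h1, h2⟩ := (hev.and (Ioo_mem_nhdsLT W.ang_pos)).exists
  have hs : |((t : ℂ) * I).im| < W.ang := by
    simpa [abs_of_pos h2.1] using h2.2
  have h3 := W.cosh_add_ne_of_strip hs
  have h4 := hM _ (W.level_pos_of_strip hs)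
  have h5 := W.one_sub_yOf h3
  have h6 : cosh ((t : ℂ) * I) + W.yA = ((Real.cos t + W.yA : ℝ) : ℂ) := by
    rw [cosh_mul_I, ← ofReal_cos, ofReal_add]
  have h7 : ‖1 - W.yOf (cosh (t * I))‖ * |Real.cos t + W.yA| = W.yA + W.yB := by
    rw [h5, h6, ← ofReal_add, ← ofReal_div, norm_real, Real.norm_eq_abs, ← abs_mul,
      div_mul_cancel₀ _ (by rw [h6] at h3; exact_mod_cast h3), abs_of_pos hAB]
  have h8 : ‖1 - W.yOf (cosh (t * I))‖ ≤ 1 + |M| := by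
    have := norm_sub_le (1 : ℂ) (W.yOf (cosh (t * I)))
    rw [norm_one] at this
    linarith [le_abs_self M]
  have := mul_le_mul_of_nonneg_right h8 (abs_nonneg (Real.cos t + W.yA))
  linarith

end Weights

end ThreeQuadrants

/-! ### The gluing function, `g` and the ratio `g / g'` expressed through `G` -/

namespace ThreeQuadrants

open Complex Filter

namespace Weights

variable (W : Weights)

theorem zero_mem_region : (0 : ℂ) ∈ W.region := by
  refine ⟨zero_ne_one, ?_⟩
  have : 1 + W.Z 0 = ((1 + W.yB : ℝ) : ℂ) := by simp [Z]
  rw [this, ofReal_mem_slitPlane]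
  linarith [W.yB_pos]

theorem tendsto_G_infinity (hc : W.c = 0) : Tendsto W.G (Bornology.cobounded ℂ) (𝓝 0) := by
  have h1 : (1 : ℂ) + (-W.yA : ℂ) ∈ slitPlane := by
    rw [← ofReal_neg, ← ofReal_one, ← ofReal_add, ofReal_mem_slitPlane, W.co_eq_yA hc]
    linarith [W.co_lt_one]
  have h2 := (differentiableAt_coshPow (W.chi / 2) h1).continuousAt.tendsto.comp
    W.tendsto_Z_infinity
  rw [W.co_eq_yA hc, W.coshPow_neg_co] at h2
  exact h2

theorem isBounded_closure (hc : W.c ≠ 0) : Bornology.IsBounded {y | 0 ≤ W.level y} := by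
  rw [isBounded_iff_forall_norm_le]
  exact ⟨_, fun y hy => W.norm_le_of_level_nonneg hc hy⟩

theorem xB_eq_one_iff : W.xB = 1 ↔ W.c = 0 := by
  have h := W.one_sub_xB_sq
  have hm := W.mu'_pos
  constructor
  · intro h1
    rw [h1] at h
    have h2 : W.k ^ 2 * W.s * (4 * W.s - W.b - W.c) * W.c ^ 2 = 0 := by rw [← h]; norm_num
    exact pow_eq_zero_iff two_ne_zero |>.1 ((mul_eq_zero.1 h2).resolve_left hm.ne')
  · intro h1
    rw [h1] at h
    nlinarith [W.xB_pos]

/-- The continuous extension of `g / g'`. -/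
noncomputable def ratio (y : ℂ) : ℂ := (W.G y ^ 2 - W.cz ^ 2) / (2 * W.cz * deriv W.G y)

theorem G_add_ne {y : ℂ} (hy : 0 < W.level y) : W.G y + W.cz ≠ 0 := by
  intro h
  have := congrArg re h
  rw [add_re, ofReal_re, zero_re] at this
  linarith [W.G_re_pos hy, W.cz_pos]

theorem continuousOn_ratio : ContinuousOn W.ratio W.region := by
  have h1 : ContinuousOn W.G W.region := W.analyticOnNhd_G.continuousOn
  have h2 : ContinuousOn (deriv W.G) W.region := W.analyticOnNhd_G.deriv.continuousOn
  exact ((h1.pow 2).sub continuousOn_const).div (continuousOn_const.mul h2) fun y hy =>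
    mul_ne_zero (mul_ne_zero two_ne_zero W.cz_ne) (W.deriv_G_ne_zero hy)

end Weights

namespace Weights.Of

variable {W : Weights} {p : ℤ → ℤ → ℝ} (h : W.Of p)
include h

theorem gluingw_eq {y : ℂ} (hy : y ∈ W.region) :
    gluingw (phi p) y = W.cz ^ 2 - W.G y ^ 2 := by
  have e : ∀ {z : ℂ}, z ∈ W.region → gluingW (phi p) z = 1 - W.G z ^ 2 := by
    intro z hz
    rw [h.gluingW_eq hz.1 hz.2, coshPow_eq_half, Weights.G, Weights.chi, Weights.ang]
    ring
  rw [gluingw, e hy, e W.zero_mem_region, W.G_zero]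
  ring

theorem tendsto_gluingw_infinity : ∃ l, (W.c = 0 → l = (W.cz : ℂ) ^ 2) ∧
    Tendsto (gluingw (phi p)) (Bornology.cobounded ℂ ⊓ 𝓟 (closure (domainL (phi p)))) (𝓝 l) := by
  refine ⟨W.cz ^ 2, fun _ => rfl, ?_⟩
  rw [h.domainL_eq, W.closure_domain]
  by_cases hc : W.c = 0
  · have h1 := ((W.tendsto_G_infinity hc).pow 2).const_sub ((W.cz : ℂ) ^ 2)
    rw [zero_pow two_ne_zero, sub_zero] at h1
    refine (h1.mono_left inf_le_left).congr' ?_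
    filter_upwards [inf_le_left (a := Bornology.cobounded ℂ)
      (Bornology.eventually_ne_cobounded (1 : ℂ)), mem_inf_of_right (mem_principal_self _)]
      with y h2 h3
    exact (h.gluingw_eq (W.closure_subset_region ⟨by rw [W.closure_domain]; exact h3, h2⟩)).symm
  -- Here the closed domain is bounded, the filter is trivial and any limit would do.
  · have h1 := W.isBounded_closure hc
    have : Bornology.cobounded ℂ ⊓ 𝓟 {y | 0 ≤ W.level y} = ⊥ := by
      rw [inf_principal_eq_bot]
      exact Bornology.isBounded_def.1 h1
    rw [this]
    exact tendsto_bot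

theorem isConformalGluing : IsConformalGluing (domainL (phi p)) (curveL (phi p))
    (gluingw (phi p)) where
  injOn := by
    rw [h.domainL_eq]
    intro y hy y' hy' he
    rw [h.gluingw_eq (W.domain_subset_region hy), h.gluingw_eq (W.domain_subset_region hy')] at he
    have h1 : W.G y ^ 2 = W.G y' ^ 2 := by linear_combination -he
    rcases sq_eq_sq_iff_eq_or_eq_neg.1 h1 with h2 | h2
    · exact W.G_injOn hy hy' h2
    · have h3 := W.G_re_pos hy
      have h4 := W.G_re_pos hy'
      rw [h2, neg_re] at h3
      linarith
  analytic := by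
    rw [h.domainL_eq]
    intro y hy
    have hr := W.domain_subset_region hy
    have h1 : AnalyticAt ℂ (fun y => (W.cz : ℂ) ^ 2 - W.G y ^ 2) y :=
      analyticAt_const.sub ((W.analyticOnNhd_G y hr).pow 2)
    refine h1.congr ?_
    filter_upwards [W.isOpen_region.mem_nhds hr] with z hz
    exact (h.gluingw_eq hz).symm
  glue := by
    rw [h.curveL_eq]
    rintro y ⟨hy, h1⟩
    have h1' : y ≠ 1 := h1
    have hl0 : W.level y = 0 := hy
    have h2 : starRingEnd ℂ y ≠ 1 := by
      intro h3
      apply h1'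
      rw [← conj_conj y, h3, map_one]
    have hl : 0 ≤ W.level (starRingEnd ℂ y) := by
      rw [W.level_conj]; exact hl0.ge
    have hl' : 0 ≤ W.level y := hl0.ge
    rw [h.gluingw_eq ⟨h1', W.one_add_Z_mem_slitPlane h1' hl'⟩,
      h.gluingw_eq ⟨h2, W.one_add_Z_mem_slitPlane h2 hl⟩, W.G_conj_eq_neg h1' hy, neg_sq]
  continuousOn := by
    rw [h.domainL_eq]
    have h1 : ContinuousOn (fun y => (W.cz : ℂ) ^ 2 - W.G y ^ 2) W.region :=
      continuousOn_const.sub (W.analyticOnNhd_G.continuousOn.pow 2)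
    exact (h1.congr fun y hy => h.gluingw_eq hy).mono W.closure_subset_region
  infinite_at_one := by
    rw [h.domainL_eq, ← tendsto_norm_atTop_iff_cobounded]
    have h1 : Tendsto (fun y => (‖W.Z y‖ - 1) / 2 - W.cz ^ 2)
        (𝓝[closure {y | 0 < W.level y} \ {1}] 1) atTop := by
      apply tendsto_atTop_add_const_right
      apply Tendsto.atTop_div_const two_pos
      apply tendsto_atTop_add_const_right
      exact W.tendsto_norm_Z_one.mono_left (nhdsWithin_mono _ fun y hy => hy.2)
    refine tendsto_atTop_mono' _ ?_ h1
    filter_upwards [self_mem_nhdsWithin] with y hy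
    have h2 : 0 ≤ W.level y := by
      have := hy.1
      rw [W.closure_domain] at this
      exact this
    rw [h.gluingw_eq (W.closure_subset_region hy)]
    have h3 := W.norm_G_sq_ge hy.2 h2
    have h4 := norm_sub_norm_le (W.G y ^ 2) ((W.cz : ℂ) ^ 2)
    rw [norm_sub_rev, norm_pow, norm_pow, norm_real, Real.norm_eq_abs, sq_abs] at h4
    linarith
  limit_at_infinity := by
    obtain ⟨l, -, hl⟩ := h.tendsto_gluingw_infinity
    exact ⟨l, hl⟩

theorem alpha_branch_eq_zero_iff :
    (alpha (phi p)).eval (branchOne (delta (phi p))) = 0 ↔ W.c = 0 := by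
  have hA := W.xA_pos
  rw [h.branchOne_delta, h.alpha_eq]
  have e : (Polynomial.C W.c * Polynomial.X ^ 2 + Polynomial.C (W.s - W.c) * Polynomial.X).eval
      ((1 - W.xB) / (1 + W.xA)) =
      (1 - W.xB) / (1 + W.xA) * (W.c * ((1 - W.xB) / (1 + W.xA)) + (W.s - W.c)) := by
    simp
    ring
  rw [e]
  constructor
  · intro h1
    by_contra hc
    have hB : W.xB < 1 := lt_of_le_of_ne W.xB_le fun h2 => hc (W.xB_eq_one_iff.1 h2)
    have hx : 0 < (1 - W.xB) / (1 + W.xA) := div_pos (by linarith) (by linarith)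
    have hc' : 0 < W.c := lt_of_le_of_ne W.c_nonneg (Ne.symm hc)
    have h2 := mul_pos hc' hx
    exact (mul_pos hx (add_pos_of_pos_of_nonneg h2 (sub_nonneg.2 W.c_le))).ne' h1
  · intro hc
    rw [W.xB_eq_one_iff.2 hc]
    simp

theorem kernel_ne_zero_one {x : ℂ} (hx : x ≠ 1) : kernel (phi p) x 1 ≠ 0 := by
  intro h0
  have e := h.kernel_eq_mobius x 1
  rw [h0, mul_zero] at e
  have hbc : (W.b : ℂ) + W.c ≠ 0 := by exact_mod_cast W.pos.ne'
  have : ((W.b : ℂ) + W.c) * ((W.yA + W.yB) ^ 2 * (1 - x) ^ 2) = 0 := by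
    rw [e]; ring
  exact mul_ne_zero hbc (mul_ne_zero (pow_ne_zero _ W.AB_ne)
    (pow_ne_zero _ (sub_ne_zero.2 hx.symm))) this

/-- At x₁ one has U = 1, and the kernel form is the perfect square (Z + co)². Hence Z = -co at Y(x₁)
and G vanishes. If c = 0 the same value arises as the limit at infinity. -/
theorem gluingwAtY_eq : gluingwAtY (phi p) = W.cz ^ 2 := by
  rw [gluingwAtY]
  split_ifs with ha
  · have hc := h.alpha_branch_eq_zero_iff.1 ha
    obtain ⟨l, h1, hl⟩ := h.tendsto_gluingw_infinity
    -- Unboundedness of the domain is needed for `limUnder` to be determined by the limit.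
    have : (Bornology.cobounded ℂ ⊓ 𝓟 (closure (domainL (phi p)))).NeBot := by
      rw [neBot_iff, ne_eq, inf_principal_eq_bot]
      intro h2
      apply W.not_isBounded_domain hc
      rw [← h.domainL_eq]
      exact (Bornology.isBounded_def.2 h2).subset subset_closure
    rw [hl.limUnder_eq, h1 hc]
  · have hα := ha
    set x₁ := branchOne (delta (phi p)) with hx₁
    set Y : ℝ := -(beta (phi p)).eval x₁ / (2 * (alpha (phi p)).eval x₁) with hY
    have hA := W.xA_pos
    have hB := W.xB_pos
    have hx1 : x₁ = (1 - W.xB) / (1 + W.xA) := h.branchOne_delta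
    have hxlt : x₁ < 1 := by
      rw [hx1, div_lt_one (by linarith)]
      linarith
    have hmul : x₁ * (1 + W.xA) = 1 - W.xB := by
      rw [hx1, div_mul_cancel₀ _ (by linarith)]
    have hU : W.U x₁ = 1 := by
      have : (1 : ℂ) - x₁ ≠ 0 := by exact_mod_cast (sub_pos.2 hxlt).ne'
      rw [Weights.U, div_eq_one_iff_eq this]
      have h2 : W.xA * x₁ + W.xB = 1 - x₁ := by linarith
      exact_mod_cast h2
    have hdelta : (delta (phi p)).eval x₁ = 0 := by
      have h2 : W.k ^ 2 * W.s * (4 * W.s - W.b - W.c) * (W.b ^ 2 * x₁ ^ 2 +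
          (2 * W.b * W.c - 4 * W.s * (W.b + W.c)) * x₁ + W.c ^ 2) = 0 := by
        rw [← W.sq_sub_x]
        have h3 : W.xA * x₁ + W.xB = 1 - x₁ := by linarith
        rw [h3, sub_self]
      rw [h.delta_eval, (mul_eq_zero.1 h2).resolve_left W.mu'_pos.ne', mul_zero]
    have hK : kernel (phi p) x₁ Y = 0 := by
      have h2 : (alpha (phi p)).eval x₁ * Y ^ 2 + (beta (phi p)).eval x₁ * Y
          + (gamma (phi p)).eval x₁ = 0 := by
        have h3 : 2 * (alpha (phi p)).eval x₁ * Y + (beta (phi p)).eval x₁ = 0 := by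
          rw [hY]; field_simp; ring
        have h4 : (beta (phi p)).eval x₁ ^ 2 - 4 * (alpha (phi p)).eval x₁
            * (gamma (phi p)).eval x₁ = 0 := by
          rw [← hdelta, delta]; simp
        have h5 : 4 * (alpha (phi p)).eval x₁ * ((alpha (phi p)).eval x₁ * Y ^ 2
            + (beta (phi p)).eval x₁ * Y + (gamma (phi p)).eval x₁) = 0 := by
          linear_combination (2 * (alpha (phi p)).eval x₁ * Y + (beta (phi p)).eval x₁) * h3 - h4
        exact (mul_eq_zero.1 h5).resolve_left (mul_ne_zero (by norm_num) hα)
      rw [ThreeQuadrants.kernel_eq]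
      have e : ∀ q : ℝ[X], (q.aeval (x₁ : ℂ) : ℂ) = ((q.eval x₁ : ℝ) : ℂ) := fun q =>
        Polynomial.aeval_algebraMap_apply_eq_algebraMap_eval x₁ q
      rw [e, e, e]
      exact_mod_cast h2
    have hxne : (x₁ : ℂ) ≠ 1 := by exact_mod_cast hxlt.ne
    have hYne : (Y : ℂ) ≠ 1 := by
      intro h2
      rw [h2] at hK
      exact h.kernel_ne_zero_one hxne hK
    have hZ : W.Z Y = -W.co := by
      rw [h.kernel_eq_zero_iff hxne hYne, hU] at hK
      have : (W.Z Y + W.co) ^ 2 = 0 := by linear_combination hK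
      exact eq_neg_of_add_eq_zero_left (pow_eq_zero_iff two_ne_zero |>.1 this)
    have hreg : (Y : ℂ) ∈ W.region := by
      refine ⟨hYne, ?_⟩
      rw [hZ, ← ofReal_neg, ← ofReal_one, ← ofReal_add, ofReal_mem_slitPlane]
      linarith [W.co_lt_one]
    rw [h.gluingw_eq hreg, Weights.G, hZ, W.coshPow_neg_co]
    ring

theorem gFun_eq {y : ℂ} (hy : 0 < W.level y) :
    gFun (phi p) y = (W.G y - W.cz) / (W.G y + W.cz) := by
  have hr := W.domain_subset_region hy
  have hc := W.cz_ne
  have hs := W.G_add_ne hy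
  rw [gFun, h.gluingwAtY_eq, h.gluingw_eq hr]
  split_ifs with h0
  · have h1 : (W.cz - W.G y) * (W.G y + W.cz) = 0 := by linear_combination h0
    have h2 := (mul_eq_zero.1 h1).resolve_right hs
    have h3 : W.G y - W.cz = 0 := by linear_combination -h2
    rw [h3, zero_div]
  · have e : W.cz ^ 2 - W.G y ^ 2 = W.cz ^ 2 * (1 - (W.G y / W.cz) ^ 2) := by
      field_simp
    have h1 : 1 - (W.G y / W.cz) ^ 2 ≠ 0 := by
      intro h1
      rw [e, h1, mul_zero] at h0
      exact h0 rfl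
    have h2 : 0 < (W.G y / W.cz).re := by
      rw [div_ofReal_re]
      exact div_pos (W.G_re_pos hy) W.cz_pos
    rw [e, mul_comm (2 : ℂ), mul_div_mul_left _ _ (pow_ne_zero 2 hc), funh_eq h2 h1]
    field_simp

theorem hasDerivAt_gFun {y : ℂ} (hy : 0 < W.level y) :
    HasDerivAt (gFun (phi p)) (2 * W.cz * deriv W.G y / (W.G y + W.cz) ^ 2) y := by
  have hr := W.domain_subset_region hy
  have h1 : HasDerivAt W.G (deriv W.G y) y :=
    (W.analyticOnNhd_G y hr).differentiableAt.hasDerivAt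
  have h2 := (h1.sub_const (W.cz : ℂ)).div (h1.add_const (W.cz : ℂ)) (W.G_add_ne hy)
  refine (h2.congr_deriv (by ring)).congr_of_eventuallyEq ?_
  filter_upwards [W.isOpen_domain.mem_nhds hy] with z hz
  exact h.gFun_eq hz

theorem deriv_gFun_ne_zero {y : ℂ} (hy : 0 < W.level y) : deriv (gFun (phi p)) y ≠ 0 := by
  rw [(h.hasDerivAt_gFun hy).deriv]
  exact div_ne_zero (mul_ne_zero (mul_ne_zero two_ne_zero W.cz_ne)
    (W.deriv_G_ne_zero (W.domain_subset_region hy))) (pow_ne_zero 2 (W.G_add_ne hy))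

theorem analyticOnNhd_gFun : AnalyticOnNhd ℂ (gFun (phi p)) {y | 0 < W.level y} :=
  DifferentiableOn.analyticOnNhd
    (fun _ hy => (h.hasDerivAt_gFun hy).differentiableAt.differentiableWithinAt) W.isOpen_domain

theorem ratio_eq {y : ℂ} (hy : 0 < W.level y) :
    W.ratio y = gFun (phi p) y / deriv (gFun (phi p)) y := by
  have h1 := W.G_add_ne hy
  have h2 := W.deriv_G_ne_zero (W.domain_subset_region hy)
  have h3 := W.cz_ne
  rw [(h.hasDerivAt_gFun hy).deriv, h.gFun_eq hy, Weights.ratio]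
  field_simp
  ring

end Weights.Of

end ThreeQuadrants

namespace ThreeQuadrants

open Filter

/-! ### Growth of positive harmonic functions -/

namespace Weights

variable (W : Weights)

/-- The function `v` is harmonic at the point `(i, j)`. -/
def Harm (v : ℤ → ℤ → ℝ) (i j : ℤ) : Prop :=
  v i j = (W.s - W.b) * v (i + 1) (j + 1) + W.b * v (i + 1) j + W.b * v i (j + 1)
    + W.c * v i (j - 1) + W.c * v (i - 1) j + (W.s - W.c) * v (i - 1) (j - 1)

/-- A constant in the Harnack inequality. -/
noncomputable def har : ℝ :=
  min (W.b + W.c * (W.s - W.b)) (W.c + W.b * (W.s - W.c)) / 2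

theorem har_pos : 0 < W.har := by
  have hs := W.s_pos
  have hbc := W.pos
  apply half_pos
  apply lt_min
  · rcases W.b_nonneg.eq_or_lt with h | h
    · rw [← h] at hbc ⊢
      rw [zero_add, sub_zero]
      exact mul_pos (by linarith) hs
    · have := mul_nonneg W.c_nonneg (sub_nonneg.2 W.b_le)
      linarith
  · rcases W.c_nonneg.eq_or_lt with h | h
    · rw [← h] at hbc ⊢
      rw [zero_add, sub_zero]
      exact mul_pos (by linarith) hs
    · have := mul_nonneg W.b_nonneg (sub_nonneg.2 W.c_le)
      linarith

theorem har_le_one : W.har ≤ 1 := by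
  have h1 : min (W.b + W.c * (W.s - W.b)) (W.c + W.b * (W.s - W.c)) ≤ W.b + W.c * (W.s - W.b) :=
    min_le_left _ _
  have := W.total
  have := W.b_le
  have := W.c_le
  have h2 := W.b_nonneg
  have h3 := W.c_nonneg
  rw [har]
  nlinarith [mul_nonneg h3 h2]

variable {W} {v : ℤ → ℤ → ℝ} (hv : ∀ i j, 0 ≤ v i j)
include hv

theorem Harm.ge {i j : ℤ} (h : W.Harm v i j) :
    (W.s - W.b) * v (i + 1) (j + 1) ≤ v i j ∧ W.b * v (i + 1) j ≤ v i j ∧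
    W.b * v i (j + 1) ≤ v i j ∧ W.c * v i (j - 1) ≤ v i j ∧ W.c * v (i - 1) j ≤ v i j ∧
    (W.s - W.c) * v (i - 1) (j - 1) ≤ v i j := by
  have h1 := mul_nonneg (sub_nonneg.2 W.b_le) (hv (i + 1) (j + 1))
  have h2 := mul_nonneg W.b_nonneg (hv (i + 1) j)
  have h3 := mul_nonneg W.b_nonneg (hv i (j + 1))
  have h4 := mul_nonneg W.c_nonneg (hv i (j - 1))
  have h5 := mul_nonneg W.c_nonneg (hv (i - 1) j)
  have h6 := mul_nonneg (sub_nonneg.2 W.c_le) (hv (i - 1) (j - 1))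
  rw [Harm] at h
  refine ⟨?_, ?_, ?_, ?_, ?_, ?_⟩ <;> linarith

/-- Each lattice neighbour is reached directly or by a two-step detour. For (i + 1, j), the step (1,
0) has weight b, while (0, -1) followed by (1, 1) has weight c(s - b). At least one route has
positive weight, since b and c are not both zero. -/
theorem harnack {i j : ℤ}
    (h : ∀ k ∈ Set.Icc (i - 1) (i + 1), ∀ l ∈ Set.Icc (j - 1) (j + 1), W.Harm v k l) :
    W.har * v (i + 1) j ≤ v i j ∧ W.har * v (i - 1) j ≤ v i j ∧
    W.har * v i (j + 1) ≤ v i j ∧ W.har * v i (j - 1) ≤ v i j := by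
  have H : ∀ k l, i - 1 ≤ k → k ≤ i + 1 → j - 1 ≤ l → l ≤ j + 1 → W.Harm v k l :=
    fun k l h1 h2 h3 h4 => h k ⟨h1, h2⟩ l ⟨h3, h4⟩
  obtain ⟨c1, c2, c3, c4, c5, c6⟩ := (H i j (by omega) (by omega) (by omega) (by omega)).ge hv
  obtain ⟨d1, -, -, -, -, -⟩ := (H i (j - 1) (by omega) (by omega) (by omega) (by omega)).ge hv
  obtain ⟨e1, -, -, -, -, -⟩ := (H (i - 1) j (by omega) (by omega) (by omega) (by omega)).ge hv
  obtain ⟨-, -, -, -, -, d6⟩ := (H i (j + 1) (by omega) (by omega) (by omega) (by omega)).ge hv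
  obtain ⟨-, -, -, -, -, e6⟩ := (H (i + 1) j (by omega) (by omega) (by omega) (by omega)).ge hv
  rw [sub_add_cancel] at d1 e1
  rw [add_sub_cancel_right] at d6 e6
  have f1 := (mul_le_mul_of_nonneg_left d1 W.c_nonneg).trans c4
  have f2 := (mul_le_mul_of_nonneg_left e1 W.c_nonneg).trans c5
  have f3 := (mul_le_mul_of_nonneg_left d6 W.b_nonneg).trans c3
  have f4 := (mul_le_mul_of_nonneg_left e6 W.b_nonneg).trans c2
  have g1 : 2 * W.har ≤ W.b + W.c * (W.s - W.b) := by
    rw [har, mul_div_cancel₀ _ two_ne_zero]; exact min_le_left _ _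
  have g2 : 2 * W.har ≤ W.c + W.b * (W.s - W.c) := by
    rw [har, mul_div_cancel₀ _ two_ne_zero]; exact min_le_right _ _
  have k1 := mul_le_mul_of_nonneg_right g1 (hv (i + 1) j)
  have k2 := mul_le_mul_of_nonneg_right g1 (hv i (j + 1))
  have k3 := mul_le_mul_of_nonneg_right g2 (hv (i - 1) j)
  have k4 := mul_le_mul_of_nonneg_right g2 (hv i (j - 1))
  refine ⟨?_, ?_, ?_, ?_⟩ <;> linarith

/-- The strong minimum principle. -/
theorem eq_zero_of_harm (h : ∀ i j, W.Harm v i j) (h0 : v 0 0 = 0) (i j : ℤ) : v i j = 0 := by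
  have hp := W.har_pos
  have step : ∀ i j, v i j = 0 →
      v (i + 1) j = 0 ∧ v (i - 1) j = 0 ∧ v i (j + 1) = 0 ∧ v i (j - 1) = 0 := by
    intro i j hz
    obtain ⟨h1, h2, h3, h4⟩ := harnack hv (i := i) (j := j) fun k _ l _ => h k l
    rw [hz] at h1 h2 h3 h4
    have key : ∀ x : ℝ, 0 ≤ x → W.har * x ≤ 0 → x = 0 := by
      intro x hx hx'
      by_contra hne
      exact absurd hx' (not_le.2 (mul_pos hp (lt_of_le_of_ne hx (Ne.symm hne))))
    exact ⟨key _ (hv _ _) h1, key _ (hv _ _) h2, key _ (hv _ _) h3, key _ (hv _ _) h4⟩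
  have hi : ∀ i : ℤ, v i 0 = 0 := fun i => by
    induction i using Int.induction_on with
    | zero => exact h0
    | succ n ih => exact (step _ _ ih).1
    | pred n ih => exact (step _ _ ih).2.1
  induction j using Int.induction_on with
  | zero => exact hi i
  | succ n ih => exact (step _ _ ih).2.2.1
  | pred n ih => exact (step _ _ ih).2.2.2

omit hv

/-- An exponential S^i t^j with S ≠ 1 is strictly subharmonic. Apply log z ≤ z - 1 to each step and
average: zero drift cancels the logarithms, and the steps (±1, 0) make the inequality strict. -/
theorem one_lt_sum {S t : ℝ} (hS : 0 < S) (ht : 0 < t) (h1 : S ≠ 1) :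
    1 - W.b * S - W.c / S < ((W.s - W.b) * S + W.b) * t + (W.c + (W.s - W.c) / S) / t := by
  have l1 := Real.log_le_sub_one_of_pos (mul_pos hS ht)
  have l2 := Real.log_lt_sub_one_of_pos hS h1
  have l3 := Real.log_le_sub_one_of_pos ht
  have l4 := Real.log_le_sub_one_of_pos (inv_pos.2 ht)
  have l5 := Real.log_lt_sub_one_of_pos (inv_pos.2 hS) (inv_ne_one.2 h1)
  have l6 := Real.log_le_sub_one_of_pos (inv_pos.2 (mul_pos hS ht))
  rw [Real.log_inv] at l4 l5 l6
  rw [Real.log_mul hS.ne' ht.ne'] at l1 l6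
  have m1 := mul_le_mul_of_nonneg_left l1 (sub_nonneg.2 W.b_le)
  have m3 := mul_le_mul_of_nonneg_left l3 W.b_nonneg
  have m4 := mul_le_mul_of_nonneg_left l4 W.c_nonneg
  have m6 := mul_le_mul_of_nonneg_left l6 (sub_nonneg.2 W.c_le)
  have m25 : W.b * Real.log S + W.c * -Real.log S < W.b * (S - 1) + W.c * (S⁻¹ - 1) := by
    rcases W.b_nonneg.eq_or_lt with h | h
    · have hc : 0 < W.c := by linarith [W.pos]
      rw [← h]
      linarith [mul_lt_mul_of_pos_left l5 hc]
    · linarith [mul_lt_mul_of_pos_left l2 h, mul_le_mul_of_nonneg_left l5.le W.c_nonneg]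
  have e : ((W.s - W.b) * S + W.b) * t + (W.c + (W.s - W.c) / S) / t =
      (W.s - W.b) * (S * t) + W.b * t + W.c * t⁻¹ + (W.s - W.c) * (S * t)⁻¹ := by
    rw [mul_inv]
    field_simp
    ring
  rw [e, div_eq_mul_inv]
  linarith [W.total]

/-- The hypothesis says that the characteristic polynomial has no positive root. The successive
quotients of a positive solution would then decrease by at least a fixed amount at each step and
become negative. -/
theorem no_positive_recurrence {al ga be : ℝ} (hal : 0 < al) (hga : 0 < ga)
    (hlt : ∀ t, 0 < t → be < al * t + ga / t) {k : ℕ → ℝ} (hk : ∀ n, 0 < k n)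
    (hrec : ∀ n, al * k (n + 2) + ga * k n = be * k (n + 1)) : False := by
  -- The minimiser of al t + ga/t on (0, ∞). It turns the pointwise strict inequality into a uniform
  -- gap.
  set t₀ := √(ga / al) with ht₀
  have ht₀pos : 0 < t₀ := Real.sqrt_pos.2 (div_pos hga hal)
  have ht₀sq : al * t₀ ^ 2 = ga := by
    rw [ht₀, Real.sq_sqrt (div_pos hga hal).le]
    field_simp
  set del := al * t₀ + ga / t₀ - be with hdel
  have hdelpos : 0 < del := sub_pos.2 (hlt t₀ ht₀pos)
  have hmin : ∀ t, 0 < t → be + del ≤ al * t + ga / t := by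
    intro t ht
    have h1 : al * t + ga / t - (al * t₀ + ga / t₀) = al * (t - t₀) ^ 2 / t := by
      rw [← ht₀sq]
      field_simp
      ring
    have h2 : 0 ≤ al * (t - t₀) ^ 2 / t := by positivity
    linarith
  have hq : ∀ n, k (n + 1) / k n ≤ k 1 / k 0 - n * (del / al) := by
    intro n
    induction n with
    | zero => simp
    | succ n ih =>
      have h0 := hk n
      have h1 := hk (n + 1)
      have h2 := hmin _ (div_pos h1 h0)
      have h3 : al * (k (n + 2) / k (n + 1)) + ga / (k (n + 1) / k n) = be := by
        rw [div_div_eq_mul_div]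
        field_simp
        linarith [hrec n]
      have h4 : al * (k (n + 2) / k (n + 1)) + del ≤ al * (k (n + 1) / k n) := by linarith
      have h5 : k (n + 2) / k (n + 1) + del / al ≤ k (n + 1) / k n := by
        rw [← mul_le_mul_iff_right₀ hal, mul_add, mul_div_cancel₀ _ hal.ne']
        exact h4
      push_cast
      linarith
  obtain ⟨n, hn⟩ := exists_nat_gt (k 1 / k 0 / (del / al))
  rw [div_lt_iff₀ (div_pos hdelpos hal)] at hn
  have := hq n
  have := div_pos (hk (n + 1)) (hk n)
  linarith

/-- A positive harmonic function on the plane that attains its largest growth ratio in a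
horizontal direction has growth ratio one. -/
theorem ratio_eq_one {h : ℤ → ℤ → ℝ} (hpos : ∀ i j, 0 < h i j) (hh : ∀ i j, W.Harm h i j) {e : ℤ}
    (he : e = 1 ∨ e = -1) {S : ℝ} (hle : ∀ i j, h (i + e) j ≤ S * h i j)
    (heq : h (0 + e) 0 = S * h 0 0) : S = 1 := by
  have hS : 0 < S := by
    have := hpos (0 + e) 0
    rw [heq] at this
    exact pos_of_mul_pos_left this (hpos 0 0).le
  -- A non-negative harmonic function with a zero at the origin: the minimum principle makes the
  -- extremal ratio exact everywhere.
  have hz : ∀ i j, S * h i j - h (i + e) j = 0 := by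
    apply eq_zero_of_harm (W := W) (v := fun i j => S * h i j - h (i + e) j)
    · intro i j
      exact sub_nonneg.2 (hle i j)
    · intro i j
      have h1 := hh i j
      have h2 := hh (i + e) j
      rw [Harm] at h1 h2 ⊢
      have e1 : i + e + 1 = i + 1 + e := by ring
      have e2 : i + e - 1 = i - 1 + e := by ring
      rw [e1, e2] at h2
      linear_combination S * h1 - h2
    · rw [heq, sub_self]
  obtain ⟨T, hT, hT1, hup⟩ : ∃ T : ℝ, 0 < T ∧ (T = 1 → S = 1) ∧ ∀ i j, h (i + 1) j = T * h i j := by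
    rcases he with rfl | rfl
    · exact ⟨S, hS, id, fun i j => by linarith [hz i j]⟩
    · refine ⟨S⁻¹, inv_pos.2 hS, fun h1 => inv_eq_one.1 h1, fun i j => ?_⟩
      have := hz (i + 1) j
      rw [add_neg_cancel_right] at this
      field_simp
      linarith
  have hdown : ∀ i j, h (i - 1) j = T⁻¹ * h i j := by
    intro i j
    have := hup (i - 1) j
    rw [sub_add_cancel] at this
    rw [this, inv_mul_cancel_left₀ hT.ne']
  apply hT1
  by_contra hne
  have hs := W.s_pos
  have hbc := W.pos
  have hal : 0 < (W.s - W.b) * T + W.b := by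
    rcases W.b_nonneg.eq_or_lt with h0 | h0
    · rw [← h0, sub_zero, add_zero]; positivity
    · have := mul_nonneg (sub_nonneg.2 W.b_le) hT.le
      linarith
  have hga : 0 < W.c + (W.s - W.c) / T := by
    rcases W.c_nonneg.eq_or_lt with h0 | h0
    · rw [← h0, sub_zero, zero_add]; positivity
    · have := div_nonneg (sub_nonneg.2 W.c_le) hT.le
      linarith
  -- The dependence on i is now exactly geometric, so harmonicity becomes a three-term recurrence
  -- along a column.
  refine no_positive_recurrence hal hga (fun t ht => one_lt_sum hT ht hne)
    (k := fun n : ℕ => h 0 n) (fun n => hpos _ _) fun n => ?_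
  have h1 := hh 0 (n + 1)
  rw [Harm, add_sub_cancel_right, hup, hup, hdown, hdown] at h1
  have e2 : ((n + 2 : ℕ) : ℤ) = n + 1 + 1 := by push_cast; ring
  have e1 : ((n + 1 : ℕ) : ℤ) = n + 1 := by push_cast; ring
  simp only [e1, e2, div_eq_mul_inv]
  linear_combination -h1

/-! ### Asymptotic flatness -/

/-- The points at depth at least `n` in the three-quarter plane. -/
def Deep (n : ℕ) (i j : ℤ) : Prop := (n : ℤ) ≤ i ∨ (n : ℤ) ≤ j

theorem Deep.mono {m n : ℕ} (h : m ≤ n) {i j : ℤ} (hd : Deep n i j) : Deep m i j := by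
  rcases hd with hd | hd
  · left; omega
  · right; omega

theorem Deep.shift {m n : ℕ} {i j k l : ℤ} (hd : Deep (m + n) i j) (hk : k.natAbs + l.natAbs ≤ n) :
    Deep m (i + k) (j + l) := by
  rcases hd with hd | hd
  · left; push_cast at hd; omega
  · right; push_cast at hd; omega

include hv in
theorem harnack_deep (hh : ∀ i j, Deep 1 i j → W.Harm v i j) {i j : ℤ} (hd : Deep 2 i j) :
    W.har * v (i + 1) j ≤ v i j ∧ W.har * v (i - 1) j ≤ v i j ∧
    W.har * v i (j + 1) ≤ v i j ∧ W.har * v i (j - 1) ≤ v i j := by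
  apply harnack hv
  rintro k ⟨hk1, hk2⟩ l ⟨hl1, hl2⟩
  apply hh
  rcases hd with hd | hd
  · left; push_cast at hd ⊢; omega
  · right; push_cast at hd ⊢; omega

include hv in
theorem harnack_iter (hh : ∀ i j, Deep 1 i j → W.Harm v i j) (m : ℕ) :
    ∀ {k l : ℤ}, k.natAbs + l.natAbs ≤ m → ∀ {i j : ℤ}, Deep (2 + m) i j →
      W.har ^ m * v (i + k) (j + l) ≤ v i j := by
  have hp := W.har_pos
  induction m with
  | zero =>
    intro k l hkl i j _
    have hk : k = 0 := by omega
    have hl : l = 0 := by omega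
    simp [hk, hl]
  | succ m ih =>
    intro k l hkl i j hd
    by_cases h0 : k = 0 ∧ l = 0
    · rw [h0.1, h0.2, add_zero, add_zero]
      exact mul_le_of_le_one_left (hv _ _) (pow_le_one₀ hp.le W.har_le_one)
    · have key : ∃ k' l' : ℤ, k'.natAbs + l'.natAbs ≤ m ∧
          W.har * v (i + k) (j + l) ≤ v (i + k') (j + l') := by
        have H := fun k' l' : ℤ => fun hkl' : k'.natAbs + l'.natAbs ≤ m =>
          harnack_deep hv hh (Deep.shift (m := 2) (hd.mono (by omega)) hkl')
        rcases lt_trichotomy k 0 with h1 | h1 | h1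
        · refine ⟨k + 1, l, by omega, ?_⟩
          have := (H (k + 1) l (by omega)).2.1
          rwa [← add_assoc, add_sub_cancel_right, add_assoc] at this
        · rcases lt_trichotomy l 0 with h2 | h2 | h2
          · refine ⟨k, l + 1, by omega, ?_⟩
            have := (H k (l + 1) (by omega)).2.2.2
            rwa [← add_assoc, add_sub_cancel_right, add_assoc] at this
          · exact absurd ⟨h1, h2⟩ h0
          · refine ⟨k, l - 1, by omega, ?_⟩
            have := (H k (l - 1) (by omega)).2.2.1
            rwa [add_assoc, sub_add_cancel] at this
        · refine ⟨k - 1, l, by omega, ?_⟩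
          have := (H (k - 1) l (by omega)).1
          rwa [add_assoc, sub_add_cancel] at this
      obtain ⟨k', l', h1, h2⟩ := key
      have h3 := ih h1 (hd.mono (by omega))
      have h4 := mul_le_mul_of_nonneg_left h2 (pow_nonneg hp.le m)
      rw [pow_succ, mul_assoc]
      exact h4.trans h3

-- Let S be the infimum of the bounds T that hold for the growth ratio at sufficient depth.
-- Recentred at deep points where the ratio nearly reaches S, and normalised there, the functions
-- have a positive harmonic limit on the whole lattice that attains S at the origin. Then
-- `ratio_eq_one` gives S = 1.
include hv in
theorem exists_ratio_le (hh : ∀ i j, Deep 1 i j → W.Harm v i j) (hpos : ∀ i j, Deep 1 i j → 0 < v i j)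
    {e : ℤ} (he : e = 1 ∨ e = -1) {ε : ℝ} (hε : 0 < ε) :
    ∃ N : ℕ, ∀ i j, Deep N i j → v (i + e) j ≤ (1 + ε) * v i j := by
  have hp := W.har_pos
  set 𝒯 : Set ℝ := {T | ∃ N : ℕ, ∀ i j, Deep N i j → v (i + e) j ≤ T * v i j} with h𝒯
  have hne : 𝒯.Nonempty := by
    refine ⟨W.har⁻¹, 2, fun i j hd => ?_⟩
    obtain ⟨h1, h2, -, -⟩ := harnack_deep hv hh hd
    rw [← div_eq_inv_mul, le_div_iff₀ hp, mul_comm]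
    rcases he with rfl | rfl
    · exact h1
    · exact h2
  have hbd : BddBelow 𝒯 := by
    refine ⟨0, ?_⟩
    rintro T ⟨N, hN⟩
    have h1 := hN (N + 1) 0 (Or.inl (by omega))
    have h2 := hpos (N + 1) 0 (Or.inl (by push_cast; omega))
    by_contra hT
    have := mul_neg_of_neg_of_pos (not_le.1 hT) h2
    linarith [hv (N + 1 + e) 0]
  set S := sInf 𝒯 with hS
  suffices hS1 : S = 1 by
    obtain ⟨T, ⟨N, hN⟩, hT⟩ := exists_lt_of_csInf_lt hne (show sInf 𝒯 < 1 + ε by rw [← hS, hS1]; linarith)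
    refine ⟨N + 1, fun i j hd => (hN i j (hd.mono (by omega))).trans ?_⟩
    exact mul_le_mul_of_nonneg_right hT.le (hv i j)
  have hz : ∀ n : ℕ, ∃ z : ℤ × ℤ, Deep (n + 1) z.1 z.2 ∧
      (S - 1 / ((n : ℝ) + 1)) * v z.1 z.2 < v (z.1 + e) z.2 := by
    intro n
    have hlt : S - 1 / ((n : ℝ) + 1) < S := by
      have : 0 < 1 / ((n : ℝ) + 1) := by positivity
      linarith
    have h1 := notMem_of_lt_csInf hlt hbd
    have h2 : ¬ ∃ N : ℕ, ∀ i j, Deep N i j → v (i + e) j ≤ (S - 1 / ((n : ℝ) + 1)) * v i j := h1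
    push Not at h2
    obtain ⟨i, j, h3, h4⟩ := h2 (n + 1)
    exact ⟨(i, j), h3, h4⟩
  choose z hzd hzr using hz
  set H : ℕ → ℤ → ℤ → ℝ := fun n k l => v ((z n).1 + k) ((z n).2 + l) / v (z n).1 (z n).2 with hH
  have hvz : ∀ n, 0 < v (z n).1 (z n).2 := fun n => hpos _ _ ((hzd n).mono (by omega))
  -- An ultrafilter finer than `atTop` makes all coordinates converge at once and replaces a
  -- diagonal subsequence.
  have hdeep : ∀ (N : ℕ) (k l : ℤ), ∀ᶠ n in hyperfilter ℕ, Deep N ((z n).1 + k) ((z n).2 + l) := by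
    intro N k l
    have : ∀ᶠ n in (atTop : Filter ℕ), Deep N ((z n).1 + k) ((z n).2 + l) := by
      filter_upwards [eventually_ge_atTop (N + (k.natAbs + l.natAbs))] with n hn
      exact Deep.shift ((hzd n).mono (by omega)) le_rfl
    exact Nat.hyperfilter_le_atTop this
  have hlim : ∀ k l : ℤ, ∃ x : ℝ, 0 < x ∧ Tendsto (fun n => H n k l) (hyperfilter ℕ) (𝓝 x) := by
    intro k l
    set m := k.natAbs + l.natAbs with hm
    have hpm : 0 < W.har ^ m := pow_pos hp m
    -- Harnack in both directions gives compactness, and the positive lower bound keeps the limit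
    -- positive.
    have hmem : ∀ᶠ n in hyperfilter ℕ, H n k l ∈ Set.Icc (W.har ^ m) (W.har ^ m)⁻¹ := by
      filter_upwards [hdeep (2 + m) k l, hdeep (2 + m) 0 0] with n h1 h2
      rw [add_zero, add_zero] at h2
      have h3 := harnack_iter hv hh m hm.ge h2
      have h4 := harnack_iter hv hh m (k := -k) (l := -l)
        (by rw [Int.natAbs_neg, Int.natAbs_neg, ← hm]) h1
      rw [add_neg_cancel_right, add_neg_cancel_right] at h4
      constructor
      · rw [hH, le_div_iff₀ (hvz n)]
        exact h4
      · rw [hH, div_le_iff₀ (hvz n), ← div_eq_inv_mul, le_div_iff₀ hpm, mul_comm]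
        exact h3
    obtain ⟨x, hx, hx'⟩ := (isCompact_Icc (a := W.har ^ m) (b := (W.har ^ m)⁻¹)).ultrafilter_le_nhds
      ((hyperfilter ℕ).map fun n => H n k l) (by
        rw [le_principal_iff]
        exact hmem)
    exact ⟨x, hpm.trans_le hx.1, hx'⟩
  choose h hhpos hht using hlim
  have hle : ∀ k l, h (k + e) l ≤ S * h k l := by
    intro k l
    apply le_of_forall_gt_imp_ge_of_dense
    intro x hx
    have h1 : S < x / h k l := by rwa [lt_div_iff₀ (hhpos k l)]
    obtain ⟨T, ⟨N, hN⟩, hT⟩ := exists_lt_of_csInf_lt hne h1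
    have h2 : h (k + e) l ≤ T * h k l := by
      refine le_of_tendsto_of_tendsto (hht (k + e) l) ((hht k l).const_mul T) ?_
      filter_upwards [hdeep N k l] with n hn
      have h3 := hN _ _ hn
      rw [hH, ← mul_div_assoc]
      apply div_le_div_of_nonneg_right _ (hvz n).le
      rwa [add_assoc] at h3
    have h3 := mul_lt_mul_of_pos_right hT (hhpos k l)
    rw [div_mul_cancel₀ _ (hhpos k l).ne'] at h3
    linarith
  have h00 : h 0 0 = 1 := by
    refine tendsto_nhds_unique (hht 0 0) (tendsto_const_nhds.congr' ?_)
    filter_upwards with n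
    simp only [hH]
    rw [add_zero, add_zero, div_self (hvz n).ne']
  refine ratio_eq_one (W := W) hhpos (fun k l => ?_) he hle (le_antisymm (hle 0 0) ?_)
  · have key := ((((((hht (k + 1) (l + 1)).const_mul (W.s - W.b)).add
      ((hht (k + 1) l).const_mul W.b)).add ((hht k (l + 1)).const_mul W.b)).add
      ((hht k (l - 1)).const_mul W.c)).add ((hht (k - 1) l).const_mul W.c)).add
      ((hht (k - 1) (l - 1)).const_mul (W.s - W.c))
    refine tendsto_nhds_unique (hht k l) (key.congr' ?_)
    filter_upwards [hdeep 1 k l] with n hn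
    have h1 := hh _ _ hn
    rw [Harm, add_assoc _ k 1, add_assoc _ l 1, add_sub_assoc _ k 1, add_sub_assoc _ l 1] at h1
    simp only [hH]
    rw [h1]
    ring
  · rw [h00, mul_one, zero_add]
    have h1 : Tendsto (fun n : ℕ => S - 1 / ((n : ℝ) + 1)) (hyperfilter ℕ) (𝓝 (S - 0)) :=
      (tendsto_one_div_add_atTop_nhds_zero_nat.mono_left Nat.hyperfilter_le_atTop).const_sub S
    rw [sub_zero] at h1
    refine le_of_tendsto_of_tendsto' h1 (hht e 0) fun n => ?_
    rw [hH, le_div_iff₀ (hvz n), add_zero]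
    exact (hzr n).le

-- Deep enough, each unit step costs a factor at most 1 + ε. The path runs along the first axis and
-- then vertically. A bounded number of Harnack steps handles the points that are not deep.
include hv in
theorem exists_growth_bound (hh : ∀ i j, Deep 1 i j → W.Harm v i j)
    (hpos : ∀ i j, Deep 1 i j → 0 < v i j) (hsymm : ∀ i j, v i j = v j i) {ε : ℝ} (hε : 0 < ε) :
    ∃ M : ℝ, ∀ (i : ℕ) (j : ℤ), v (i + 1) j ≤ M * (1 + ε) ^ (i + j.natAbs) := by
  obtain ⟨N₁, hN₁⟩ := exists_ratio_le hv hh hpos (Or.inl rfl) hε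
  obtain ⟨N₂, hN₂⟩ := exists_ratio_le hv hh hpos (Or.inr rfl) hε
  set N := max N₁ N₂ with hN
  have hp := W.har_pos
  have hε1 : 0 ≤ 1 + ε := by linarith
  have right : ∀ i j, Deep N i j → v (i + 1) j ≤ (1 + ε) * v i j := fun i j hd =>
    hN₁ i j (hd.mono (le_max_left _ _))
  have up : ∀ i j, Deep N i j → v i (j + 1) ≤ (1 + ε) * v i j := fun i j hd => by
    rw [hsymm i (j + 1), hsymm i j]
    exact hN₁ j i (hd.symm.imp (fun h => by omega) (fun h => by omega))
  have down : ∀ i j, Deep N i j → v i (j - 1) ≤ (1 + ε) * v i j := fun i j hd => by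
    rw [hsymm i (j - 1), hsymm i j, sub_eq_add_neg]
    exact hN₂ j i (hd.symm.imp (fun h => by omega) (fun h => by omega))
  have b1 : ∀ n : ℕ, v (N + n) 0 ≤ v N 0 * (1 + ε) ^ n := by
    intro n
    induction n with
    | zero => simp
    | succ n ih =>
      have h1 := right (N + n) 0 (Or.inl (by omega))
      have h2 := mul_le_mul_of_nonneg_left ih hε1
      push_cast
      rw [← add_assoc, pow_succ]
      linarith
  have b2 : ∀ (i : ℤ), (N : ℤ) ≤ i → ∀ j : ℤ, v i j ≤ v i 0 * (1 + ε) ^ j.natAbs := by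
    intro i hi j
    induction j using Int.induction_on with
    | zero => simp
    | succ n ih =>
      have h1 := up i n (Or.inl hi)
      have h2 := mul_le_mul_of_nonneg_left ih hε1
      have e1 : ((n : ℤ) + 1).natAbs = n + 1 := by omega
      have e2 : (n : ℤ).natAbs = n := by omega
      rw [e2] at h2
      rw [e1, pow_succ]
      linarith
    | pred n ih =>
      have h1 := down i (-n) (Or.inl hi)
      have h2 := mul_le_mul_of_nonneg_left ih hε1
      have e1 : (-(n : ℤ) - 1).natAbs = n + 1 := by omega
      have e2 : (-(n : ℤ)).natAbs = n := by omega
      rw [e2] at h2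
      rw [e1, pow_succ]
      linarith
  -- Moving m steps to the right reaches the column N + n, where the previous bounds apply. The
  -- final estimate takes m = N for every column.
  have b3 : ∀ (m : ℕ) (i : ℤ), 1 ≤ i → ∀ n : ℕ, i + m = N + n → ∀ j : ℤ,
      W.har ^ m * v i j ≤ v N 0 * (1 + ε) ^ (n + j.natAbs) := by
    intro m
    induction m with
    | zero =>
      intro i _ n hn j
      have e : i = N + n := by simpa using hn
      have h1 := b2 i (by omega) j
      rw [e] at h1 ⊢
      have h2 := mul_le_mul_of_nonneg_right (b1 n) (pow_nonneg hε1 j.natAbs)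
      rw [pow_zero, one_mul, pow_add, ← mul_assoc]
      exact h1.trans h2
    | succ m ih =>
      intro i hi n hn j
      have h1 := ih (i + 1) (by omega) n (by push_cast at hn; omega) j
      have h2 := (harnack_deep hv hh (i := i + 1) (j := j) (Or.inl (by push_cast; omega))).2.1
      rw [add_sub_cancel_right] at h2
      have h3 := mul_le_mul_of_nonneg_left h2 (pow_nonneg hp.le m)
      rw [pow_succ, mul_assoc]
      exact h3.trans h1
  refine ⟨(W.har ^ N)⁻¹ * (v N 0 * (1 + ε)), fun i j => ?_⟩
  have h1 := b3 N (i + 1) (by omega) (i + 1) (by push_cast; ring) j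
  have hpN := pow_pos hp N
  rw [mul_assoc, ← div_eq_inv_mul, le_div_iff₀ hpN]
  calc v (i + 1) j * W.har ^ N = W.har ^ N * v (i + 1) j := mul_comm _ _
    _ ≤ _ := h1
    _ = _ := by ring

end Weights

end ThreeQuadrants

namespace ThreeQuadrants

open Filter

/-! ### Generating functions -/

/-- A power series with coefficients of subexponential growth is analytic in the unit disc. -/
theorem differentiableOn_powerSeries {a : ℕ → ℝ}
    (ha : ∀ r : ℝ, 0 ≤ r → r < 1 → Summable fun n => |a n| * r ^ n) :
    DifferentiableOn ℂ (fun x : ℂ => ∑' n, (a n : ℂ) * x ^ n) (Metric.ball 0 1) := by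
  intro x hx
  rw [mem_ball_zero_iff] at hx
  obtain ⟨r, h1, h2⟩ := exists_between hx
  have h3 : DifferentiableOn ℂ (fun x : ℂ => ∑' n, (a n : ℂ) * x ^ n) (Metric.ball 0 r) := by
    apply Complex.differentiableOn_tsum_of_summable_norm (ha r ((norm_nonneg x).trans h1.le) h2)
    · intro n
      fun_prop
    · exact Metric.isOpen_ball
    · intro n w hw
      rw [mem_ball_zero_iff] at hw
      rw [norm_mul, Complex.norm_real, Real.norm_eq_abs, norm_pow]
      gcongr
  exact (h3.differentiableAt (Metric.isOpen_ball.mem_nhds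
    (mem_ball_zero_iff.2 h1))).differentiableWithinAt

/-- The harmonic function, extended by zero outside the three-quarter plane. -/
def extend (f : ℤ → ℤ → ℝ) (i j : ℤ) : ℝ := if 0 < i ∨ 0 < j then f i j else 0

section Extend

variable {W : Weights} {p f : ℤ → ℤ → ℝ} (h : W.Of p) (hf : IsSymmPosHarmonic p f)

include hf

theorem extend_eq {i j : ℤ} (hij : 0 ≤ i ∨ 0 ≤ j) : extend f i j = f i j := by
  rw [extend]
  split_ifs with h0
  · rfl
  · push Not at h0
    rcases hij with h1 | h1
    · have : i = 0 := by omega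
      rw [this, hf.zero_snd j h0.2]
    · have : j = 0 := by omega
      rw [this, hf.zero_fst i h0.1]

theorem extend_pos {i j : ℤ} (hij : Weights.Deep 1 i j) : 0 < extend f i j := by
  have h1 : 0 < i ∨ 0 < j := hij.imp (fun h => by push_cast at h; omega)
    (fun h => by push_cast at h; omega)
  rw [extend, if_pos h1]
  exact hf.pos i j h1

theorem extend_nonneg (i j : ℤ) : 0 ≤ extend f i j := by
  rw [extend]
  split_ifs with h0
  · exact (hf.pos i j h0).le
  · exact le_rfl

theorem extend_symm (i j : ℤ) : extend f i j = extend f j i := by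
  rw [extend, extend]
  by_cases h0 : 0 < i ∨ 0 < j
  · rw [if_pos h0, if_pos h0.symm, hf.symm i j (h0.imp le_of_lt le_of_lt)]
  · rw [if_neg h0, if_neg fun h1 => h0 h1.symm]

include h

theorem extend_harm {i j : ℤ} (hij : Weights.Deep 1 i j) : W.Harm (extend f) i j := by
  have h1 : 1 ≤ i ∨ 1 ≤ j := by exact_mod_cast hij
  -- From a point with i ≥ 1 or j ≥ 1 a small step stays in the cone, where the extension by zero
  -- agrees with f.
  have e : ∀ k l : ℤ, -1 ≤ k → -1 ≤ l → extend f (i + k) (j + l) = f (i + k) (j + l) := by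
    intro k l hk hl
    apply extend_eq hf
    omega
  have hh := hf.harmonic i j h1
  simp [Icc_neg_one_one, h.p11, h.p10, h.p01, h.p0n, h.pn0, h.pnn, h.p00, h.p1n, h.pn1] at hh
  have e0 := e 0 0 (by norm_num) (by norm_num)
  have e1 := e 1 1 (by norm_num) (by norm_num)
  have e2 := e 1 0 (by norm_num) (by norm_num)
  have e3 := e 0 1 (by norm_num) (by norm_num)
  have e4 := e 0 (-1) (by norm_num) (by norm_num)
  have e5 := e (-1) 0 (by norm_num) (by norm_num)
  have e6 := e (-1) (-1) (by norm_num) (by norm_num)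
  simp only [add_zero, ← sub_eq_add_neg] at e0 e1 e2 e3 e4 e5 e6
  simp only [← sub_eq_add_neg] at hh
  rw [Weights.Harm, e0, e1, e2, e3, e4, e5, e6, hh]
  ring

omit h hf

/-- The harmonic function in the coordinates of the walk after the change of variable. -/
def coef (f : ℤ → ℤ → ℝ) (m n : ℕ) : ℝ := extend f n (n - m)

theorem coef_eq {m n : ℕ} {i j : ℤ} (hi : (n : ℤ) = i) (hj : (n : ℤ) - m = j) :
    coef f m n = extend f i j := by
  subst hi hj
  rfl

theorem coef_row_zero (m : ℕ) : coef f m 0 = 0 := by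
  rw [coef, extend, if_neg]
  rintro (h0 | h0)
  · simp at h0
  · simp at h0
    omega

include hf

theorem coef_nonneg (m n : ℕ) : 0 ≤ coef f m n := extend_nonneg hf _ _

include h

/-- The exponent comes from |n + 1 - m| ≤ n + 1 + m. With ε small relative to the radii, every
series converges inside the unit disc. -/
theorem exists_coef_bound {ε : ℝ} (hε : 0 < ε) :
    ∃ M : ℝ, ∀ m n : ℕ, coef f m (n + 1) ≤ M * (1 + ε) ^ (2 * n + 1 + m) := by
  obtain ⟨M, hM⟩ := Weights.exists_growth_bound (W := W) (extend_nonneg hf)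
    (fun i j => extend_harm h hf) (fun i j => extend_pos hf) (extend_symm hf) hε
  have hM0 : 0 ≤ M := by
    have h1 := hM 0 0
    have h2 := extend_nonneg hf (((0 : ℕ) : ℤ) + 1) 0
    simp at h1 h2
    linarith
  refine ⟨M, fun m n => ?_⟩
  have h1 := hM n ((n + 1 : ℕ) - m)
  rw [coef]
  push_cast at h1 ⊢
  refine h1.trans (mul_le_mul_of_nonneg_left (pow_le_pow_right₀ (by linarith) ?_) hM0)
  omega

theorem summable_diag {r : ℝ} (h0 : 0 ≤ r) (h1 : r < 1) :
    Summable fun n => |coef f 0 (n + 1)| * r ^ n := by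
  obtain ⟨ε, hε, hlt⟩ : ∃ ε : ℝ, 0 < ε ∧ (1 + ε) ^ 2 * r < 1 := by
    have hc : Tendsto (fun ε : ℝ => (1 + ε) ^ 2 * r) (𝓝[>] 0) (𝓝 r) := by
      have : Continuous (fun ε : ℝ => (1 + ε) ^ 2 * r) := by fun_prop
      have h2 := this.tendsto 0
      norm_num at h2
      exact h2.mono_left nhdsWithin_le_nhds
    obtain ⟨ε, h2, h3⟩ := ((hc.eventually_lt_const h1).and self_mem_nhdsWithin).exists
    exact ⟨ε, h3, h2⟩
  obtain ⟨M, hM⟩ := exists_coef_bound h hf hε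
  refine Summable.of_nonneg_of_le (fun n => by positivity) (fun n => ?_)
    ((summable_geometric_of_lt_one (by positivity) hlt).mul_left (M * (1 + ε)))
  rw [abs_of_nonneg (coef_nonneg hf _ _)]
  calc coef f 0 (n + 1) * r ^ n ≤ M * (1 + ε) ^ (2 * n + 1 + 0) * r ^ n :=
        mul_le_mul_of_nonneg_right (hM 0 n) (by positivity)
    _ = _ := by rw [mul_pow, ← pow_mul]; ring

theorem summable_row (n : ℕ) {r : ℝ} (h0 : 0 ≤ r) (h1 : r < 1) :
    Summable fun m => |coef f (m + 1) n| * r ^ m := by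
  rcases n with _ | n
  · simp only [coef_row_zero, abs_zero, zero_mul]
    exact summable_zero
  obtain ⟨ε, hε, hlt⟩ : ∃ ε : ℝ, 0 < ε ∧ (1 + ε) * r < 1 := by
    have hc : Tendsto (fun ε : ℝ => (1 + ε) * r) (𝓝[>] 0) (𝓝 r) := by
      have : Continuous (fun ε : ℝ => (1 + ε) * r) := by fun_prop
      have h2 := this.tendsto 0
      norm_num at h2
      exact h2.mono_left nhdsWithin_le_nhds
    obtain ⟨ε, h2, h3⟩ := ((hc.eventually_lt_const h1).and self_mem_nhdsWithin).exists
    exact ⟨ε, h3, h2⟩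
  obtain ⟨M, hM⟩ := exists_coef_bound h hf hε
  refine Summable.of_nonneg_of_le (fun n => by positivity) (fun m => ?_)
    ((summable_geometric_of_lt_one (by positivity) hlt).mul_left (M * (1 + ε) ^ (2 * n + 2)))
  rw [abs_of_nonneg (coef_nonneg hf _ _)]
  calc coef f (m + 1) (n + 1) * r ^ m ≤ M * (1 + ε) ^ (2 * n + 1 + (m + 1)) * r ^ m :=
        mul_le_mul_of_nonneg_right (hM _ _) (by positivity)
    _ = _ := by rw [mul_pow]; ring

omit h hf

/-- The generating function of the row `n`. -/
noncomputable def row (f : ℤ → ℤ → ℝ) (n : ℕ) (x : ℂ) : ℂ := ∑' m, (coef f (m + 1) n : ℂ) * x ^ m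

/-- The generating function of the diagonal. -/
noncomputable def diag (f : ℤ → ℤ → ℝ) (y : ℂ) : ℂ := ∑' n, (coef f 0 (n + 1) : ℂ) * y ^ n

theorem row_zero (f : ℤ → ℤ → ℝ) (x : ℂ) : row f 0 x = 0 := by
  simp [row, coef_row_zero]

include h hf

theorem hasSum_row (n : ℕ) {x : ℂ} (hx : ‖x‖ < 1) :
    HasSum (fun m => (coef f (m + 1) n : ℂ) * x ^ m) (row f n x) := by
  apply Summable.hasSum
  apply Summable.of_norm
  simpa using summable_row h hf n (norm_nonneg x) hx

theorem hasSum_diag {y : ℂ} (hy : ‖y‖ < 1) :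
    HasSum (fun n => (coef f 0 (n + 1) : ℂ) * y ^ n) (diag f y) := by
  apply Summable.hasSum
  apply Summable.of_norm
  simpa using summable_diag h hf (norm_nonneg y) hy

theorem summable_rows {x y : ℂ} (hx : ‖x‖ < 1) (hy : ‖y‖ < 1) :
    Summable fun n => row f (n + 1) x * y ^ n := by
  obtain ⟨ε, hε, hlt1, hlt2⟩ : ∃ ε : ℝ, 0 < ε ∧ (1 + ε) * ‖x‖ < 1 ∧ (1 + ε) ^ 2 * ‖y‖ < 1 := by
    have hc : Tendsto (fun ε : ℝ => (1 + ε) * ‖x‖) (𝓝[>] 0) (𝓝 ‖x‖) := by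
      have : Continuous (fun ε : ℝ => (1 + ε) * ‖x‖) := by fun_prop
      have h2 := this.tendsto 0
      norm_num at h2
      exact h2.mono_left nhdsWithin_le_nhds
    have hc2 : Tendsto (fun ε : ℝ => (1 + ε) ^ 2 * ‖y‖) (𝓝[>] 0) (𝓝 ‖y‖) := by
      have : Continuous (fun ε : ℝ => (1 + ε) ^ 2 * ‖y‖) := by fun_prop
      have h2 := this.tendsto 0
      norm_num at h2
      exact h2.mono_left nhdsWithin_le_nhds
    obtain ⟨ε, ⟨h2, h4⟩, h3⟩ := (((hc.eventually_lt_const hx).and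
      (hc2.eventually_lt_const hy)).and self_mem_nhdsWithin).exists
    exact ⟨ε, h3, h2, h4⟩
  obtain ⟨M, hM⟩ := exists_coef_bound h hf hε
  have hb : ∀ n, ‖row f (n + 1) x‖ ≤ M * (1 + ε) ^ (2 * n + 2) * (1 - (1 + ε) * ‖x‖)⁻¹ := by
    intro n
    have hg := (hasSum_geometric_of_lt_one (by positivity) hlt1).mul_left (M * (1 + ε) ^ (2 * n + 2))
    refine tsum_of_norm_bounded hg fun m => ?_
    rw [norm_mul, Complex.norm_real, Real.norm_eq_abs, abs_of_nonneg (coef_nonneg hf _ _), norm_pow]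
    calc coef f (m + 1) (n + 1) * ‖x‖ ^ m
        ≤ M * (1 + ε) ^ (2 * n + 1 + (m + 1)) * ‖x‖ ^ m :=
          mul_le_mul_of_nonneg_right (hM _ _) (by positivity)
      _ = _ := by rw [mul_pow]; ring
  apply Summable.of_norm
  refine Summable.of_nonneg_of_le (fun n => norm_nonneg _) (fun n => ?_)
    ((summable_geometric_of_lt_one (by positivity) hlt2).mul_left
      (M * (1 + ε) ^ 2 * (1 - (1 + ε) * ‖x‖)⁻¹))
  rw [norm_mul, norm_pow]
  refine (mul_le_mul_of_nonneg_right (hb n) (by positivity)).trans_eq ?_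
  rw [mul_pow, ← pow_mul]
  ring

theorem coef_interior (m n : ℕ) : coef f (m + 1) (n + 1) =
    (W.s - W.b) * coef f (m + 1) (n + 2) + W.b * coef f (m + 2) (n + 2) + W.b * coef f m (n + 1)
      + W.c * coef f (m + 2) (n + 1) + W.c * coef f m n + (W.s - W.c) * coef f (m + 1) n := by
  have h1 : W.Harm (extend f) (n + 1) (n - m) :=
    extend_harm h hf (Or.inl (by push_cast; omega))
  rw [Weights.Harm] at h1
  rw [show coef f (m + 1) (n + 1) = extend f (n + 1) (n - m) from
      coef_eq (by push_cast; ring) (by push_cast; ring),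
    show coef f (m + 1) (n + 2) = extend f (n + 1 + 1) (n - m + 1) from
      coef_eq (by push_cast; ring) (by push_cast; ring),
    show coef f (m + 2) (n + 2) = extend f (n + 1 + 1) (n - m) from
      coef_eq (by push_cast; ring) (by push_cast; ring),
    show coef f m (n + 1) = extend f (n + 1) (n - m + 1) from
      coef_eq (by push_cast; ring) (by push_cast; ring),
    show coef f (m + 2) (n + 1) = extend f (n + 1) (n - m - 1) from
      coef_eq (by push_cast; ring) (by push_cast; ring),
    show coef f m n = extend f (n + 1 - 1) (n - m) from
      coef_eq (by ring) (by ring),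
    show coef f (m + 1) n = extend f (n + 1 - 1) (n - m - 1) from
      coef_eq (by ring) (by push_cast; ring)]
  exact h1

/-- On the diagonal, symmetry folds the neighbours above it onto those below, which doubles the
weights b and c. -/
theorem coef_diagonal (n : ℕ) : coef f 0 (n + 1) =
    (W.s - W.b) * coef f 0 (n + 2) + 2 * W.b * coef f 1 (n + 2) + 2 * W.c * coef f 1 (n + 1)
      + (W.s - W.c) * coef f 0 n := by
  have h1 : W.Harm (extend f) (n + 1) (n + 1) :=
    extend_harm h hf (Or.inl (by push_cast; omega))
  rw [Weights.Harm, extend_symm hf (n + 1) (n + 1 + 1), extend_symm hf (n + 1 - 1) (n + 1)] at h1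
  have e1 : coef f 0 (n + 1) = extend f (n + 1) (n + 1) :=
    coef_eq (by push_cast; ring) (by push_cast; ring)
  have e2 : coef f 0 (n + 2) = extend f (n + 1 + 1) (n + 1 + 1) :=
    coef_eq (by push_cast; ring) (by push_cast; ring)
  have e3 : coef f 1 (n + 2) = extend f (n + 1 + 1) (n + 1) :=
    coef_eq (by push_cast; ring) (by push_cast; ring)
  have e4 : coef f 1 (n + 1) = extend f (n + 1) (n + 1 - 1) :=
    coef_eq (by push_cast; ring) (by push_cast; ring)
  have e5 : coef f 0 n = extend f (n + 1 - 1) (n + 1 - 1) :=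
    coef_eq (by ring) (by push_cast; ring)
  rw [e1, e2, e3, e4, e5]
  linear_combination h1

/-- The interior relations summed against powers of x, plus half of the diagonal relation. The three
row coefficients are γ, β and α of the kernel. -/
theorem row_recurrence (n : ℕ) {x : ℂ} (hx : ‖x‖ < 1) :
    ((W.s - W.b) * x + W.b) * row f (n + 2) x + (W.b * x ^ 2 - x + W.c) * row f (n + 1) x
      + (W.c * x ^ 2 + (W.s - W.c) * x) * row f n x + (W.s - W.b) / 2 * coef f 0 (n + 2)
      + (W.b * x - 1 / 2) * coef f 0 (n + 1) + (W.c * x + (W.s - W.c) / 2) * coef f 0 n = 0 := by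
  have hr := fun n => hasSum_row h hf n hx
  have hA : ∀ n, HasSum (fun m => (coef f (m + 2) n : ℂ) * x ^ (m + 1)) (row f n x - coef f 1 n) := by
    intro n
    have := (hasSum_nat_add_iff' 1).2 (hr n)
    simpa using this
  have hB : ∀ n, HasSum (fun m => (coef f m n : ℂ) * x ^ m) (x * row f n x + coef f 0 n) := by
    intro n
    have h1 : HasSum (fun m => (coef f (m + 1) n : ℂ) * x ^ (m + 1)) (x * row f n x) := by
      refine ((hr n).mul_left x).congr_fun ?_
      intro m
      rw [pow_succ]; ring
    simpa using (hasSum_nat_add_iff (f := fun m => (coef f m n : ℂ) * x ^ m) 1).1 h1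
  have h1 := (hr (n + 1)).mul_left x
  have h2 := ((((((hr (n + 2)).mul_left ((W.s - W.b) * x)).add ((hA (n + 2)).mul_left (W.b : ℂ))).add
    ((hB (n + 1)).mul_left (W.b * x))).add ((hA (n + 1)).mul_left (W.c : ℂ))).add
    ((hB n).mul_left (W.c * x))).add ((hr n).mul_left ((W.s - W.c) * x))
  have h3 := h1.unique (h2.congr_fun fun m => by
    have h4 : (coef f (m + 1) (n + 1) : ℂ) = _ := congrArg Complex.ofReal (coef_interior h hf m n)
    push_cast at h4
    rw [h4]
    ring)
  have h5 : (coef f 0 (n + 1) : ℂ) = _ := congrArg Complex.ofReal (coef_diagonal h hf n)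
  push_cast at h5
  linear_combination -h3 - h5 / 2

/-- The functional equation on the zero set of the kernel. -/
theorem functional_equation {x y : ℂ} (hx : ‖x‖ < 1) (hy : ‖y‖ < 1)
    (hK : kernel (phi p) x y = 0) :
    diag f y * (2 * x * (W.c * y ^ 2 + W.b * y) + ((W.s - W.c) * y ^ 2 - y + (W.s - W.b))) =
      2 * ((W.s - W.b) * x + W.b) * row f 1 x + (W.s - W.b) * coef f 0 1 := by
  rw [h.kernel_eq] at hK
  have hD := hasSum_diag h hf hy
  have hM := (summable_rows h hf hx hy).hasSum
  set D := diag f y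
  set M := ∑' n, row f (n + 1) x * y ^ n
  have up : ∀ {g : ℕ → ℂ} {s : ℂ}, HasSum (fun n => g (n + 1) * y ^ n) s →
      HasSum (fun n => g (n + 2) * y ^ (n + 1)) (s - g 1) := by
    intro g s hs
    simpa using (hasSum_nat_add_iff' 1).2 hs
  have down : ∀ {g : ℕ → ℂ} {s : ℂ}, g 0 = 0 → HasSum (fun n => g (n + 1) * y ^ n) s →
      HasSum (fun n => g n * y ^ (n + 1)) (y ^ 2 * s) := by
    intro g s h0 hs
    have h1 : HasSum (fun n => g (n + 1) * y ^ (n + 2)) (y ^ 2 * s) :=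
      (hs.mul_left (y ^ 2)).congr_fun fun n => by rw [pow_add]; ring
    have := (hasSum_nat_add_iff (f := fun n => g n * y ^ (n + 1)) 1).1 h1
    simpa [h0] using this
  have mid : ∀ {g : ℕ → ℂ} {s : ℂ}, HasSum (fun n => g (n + 1) * y ^ n) s →
      HasSum (fun n => g (n + 1) * y ^ (n + 1)) (y * s) := by
    intro g s hs
    exact (hs.mul_left y).congr_fun fun n => by rw [pow_succ]; ring
  have c0 : ((coef f 0 0 : ℝ) : ℂ) = 0 := by rw [coef_row_zero, Complex.ofReal_zero]
  have h2 := (((((up (g := fun n => row f n x) hM).mul_left ((W.s - W.b) * x + W.b)).add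
    ((mid (g := fun n => row f n x) hM).mul_left (W.b * x ^ 2 - x + W.c))).add
    ((down (g := fun n => row f n x) (row_zero f x) hM).mul_left
      (W.c * x ^ 2 + (W.s - W.c) * x))).add
    (((up (g := fun n => (coef f 0 n : ℂ)) hD).mul_left ((W.s - W.b) / 2 : ℂ)).add
    ((mid (g := fun n => (coef f 0 n : ℂ)) hD).mul_left (W.b * x - 1 / 2)))).add
    ((down (g := fun n => (coef f 0 n : ℂ)) c0 hD).mul_left (W.c * x + (W.s - W.c) / 2))
  have h3 := h2.unique (hasSum_zero.congr_fun fun n => by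
    linear_combination y ^ (n + 1) * row_recurrence h hf n hx)
  -- The two-variable sum M appears multiplied by K, so it drops out. What remains of the diagonal
  -- is D ∂ₓK.
  linear_combination 2 * h3 - 2 * M * hK

theorem differentiableOn_diag : DifferentiableOn ℂ (diag f) (Metric.ball 0 1) :=
  differentiableOn_powerSeries fun _ h0 h1 => summable_diag h hf h0 h1

theorem differentiableOn_row : DifferentiableOn ℂ (row f 1) (Metric.ball 0 1) :=
  differentiableOn_powerSeries fun _ h0 h1 => summable_row h hf 1 h0 h1

end Extend

end ThreeQuadrants

namespace ThreeQuadrants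

open Complex Filter

/-! ### Continuation of the diagonal series -/

/-- A Möbius transformation that maps the unit disc onto a half-plane. -/
theorem norm_lt_norm_iff (z : ℂ) {A B : ℝ} (h : 0 < A + B) :
    ‖z - B‖ < ‖z + A‖ ↔ (B - A) / 2 < z.re := by
  rw [← sq_lt_sq₀ (norm_nonneg _) (norm_nonneg _), Complex.sq_norm, Complex.sq_norm, normSq_apply,
    normSq_apply]
  simp only [sub_re, add_re, sub_im, add_im, ofReal_re, ofReal_im, sub_zero, add_zero]
  constructor
  · intro h1
    by_contra h2
    push Not at h2
    nlinarith
  · intro h1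
    nlinarith

theorem one_sub_cosh_mem_slitPlane {w : ℂ} (h0 : 0 < w.im) (h1 : w.im < Real.pi) :
    1 - cosh w ∈ slitPlane := by
  have e : 1 - cosh w = 1 + cosh (w - Real.pi * I) := by
    rw [cosh_sub, cosh_mul_I, sinh_mul_I, Complex.cos_pi, Complex.sin_pi]
    ring
  rw [e]
  apply one_add_cosh_mem_slitPlane
  simp only [sub_im, mul_im, ofReal_re, I_im, ofReal_im, I_re, mul_one, mul_zero, add_zero]
  rw [abs_lt]
  constructor <;> linarith

namespace Weights

variable (W : Weights)

theorem norm_lt_one_iff {y : ℂ} (hy : y ≠ 1) : ‖y‖ < 1 ↔ W.kap * (1 - 2 * W.co ^ 2) < (W.Z y).re := by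
  have h0 := W.Z_add_ne hy
  have e : y = (W.Z y - W.yB) / (W.Z y + W.yA) := (W.yOf_Z hy).symm
  rw [e, norm_div, div_lt_one (norm_pos_iff.2 h0),
    norm_lt_norm_iff _ (add_pos W.yA_pos W.yB_pos), W.yB_sub_yA, ← e, mul_div_cancel_left₀ _ two_ne_zero]

/-- The branch of the algebraic function `U` that corresponds to `x` in the unit disc. -/
noncomputable def Uy (y : ℂ) : ℂ := -W.co * W.Z y + W.si * rootOne (W.Z y)

theorem Uy_quadratic (y : ℂ) : W.Z y ^ 2 + W.Uy y ^ 2 + 2 * W.co * W.Z y * W.Uy y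
    - (1 - W.co ^ 2) = 0 := by
  have h1 := rootOne_sq (W.Z y)
  have h2 : (W.si : ℂ) ^ 2 = 1 - W.co ^ 2 := by exact_mod_cast W.si_sq
  rw [Uy]
  linear_combination (W.si : ℂ) ^ 2 * h1 + (1 - W.Z y ^ 2) * h2

/-- Taking w in the upper half of the strip fixes the sign of √(1 - Z²), and the addition formula
gives the shift by -iθ. This branch is real on the upper edge. -/
theorem Uy_eq {y w : ℂ} (h0 : 0 < w.im) (h1 : w.im < Real.pi) (h : cosh w = W.Z y) :
    W.Uy y = cosh (w - W.ang * I) := by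
  rw [Uy, ← h, rootOne_cosh h0 h1, cosh_sub, cosh_mul_I, sinh_mul_I, ← ofReal_cos, ← ofReal_sin,
    W.cos_ang, W.sin_ang, ofReal_neg]
  ring

theorem Uy_re {y w : ℂ} (h0 : 0 < w.im) (h1 : w.im < Real.pi) (h : cosh w = W.Z y) :
    (W.Uy y).re = Real.cosh w.re * Real.cos (w.im - W.ang) := by
  rw [W.Uy_eq h0 h1 h, cosh_re]
  simp

theorem kap_mul_lt {t : ℝ} (h0 : 0 ≤ t) (h1 : t ≤ 1) : W.kap * t < 1 := by
  have h2 : W.kap < 1 := by nlinarith [W.kap_sq_lt]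
  rcases h0.eq_or_lt with h3 | h3
  · rw [← h3, mul_zero]
    exact one_pos
  · nlinarith

/-- The half-planes of the two unit discs cover the strip. -/
theorem cover {t η : ℝ} (ht : 1 ≤ t) (h0 : 0 ≤ η) (h1 : η < W.ang)
    (h : t * Real.cos (W.ang - η) ≤ W.kap * (1 - 2 * W.co ^ 2)) :
    W.kap * W.co < t * Real.cos η := by
  by_contra hc
  push Not at hc
  have hco := W.co_pos
  have hsi := W.si_pos
  have hss := W.si_sq
  have hk := W.kap_sq_lt
  have hsc := Real.sin_sq_add_cos_sq η
  have hsin : 0 ≤ Real.sin η := Real.sin_nonneg_of_nonneg_of_le_pi h0 (by linarith [W.ang_lt_pi])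
  rw [Real.cos_sub, W.cos_ang, W.sin_ang] at h
  -- The negations of the two half-plane conditions bound the point t(cos η, sin η) by two lines
  -- meeting at kap (co, si), inside the unit circle. This contradicts t ≥ 1.
  have h2 : t * Real.sin η ≤ W.kap * W.si := by
    have : W.si * (t * Real.sin η) ≤ W.si * (W.kap * W.si) := by
      have e : W.si * (W.kap * W.si) = W.kap - W.kap * W.co ^ 2 := by
        linear_combination W.kap * hss
      have := mul_le_mul_of_nonneg_left hc hco.le
      linarith
    exact le_of_mul_le_mul_left this hsi
  have h3 : (t * Real.sin η) ^ 2 ≤ W.kap ^ 2 * W.si ^ 2 := by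
    rw [← mul_pow]
    exact pow_le_pow_left₀ (by positivity) h2 2
  have ht2 : 1 ≤ t ^ 2 := by nlinarith
  have hsi2 : 0 < W.si ^ 2 := by positivity
  rcases le_or_gt 0 (Real.cos η) with h4 | h4
  · have h5 : (t * Real.cos η) ^ 2 ≤ W.kap ^ 2 * W.co ^ 2 := by
      rw [← mul_pow]
      exact pow_le_pow_left₀ (by positivity) hc 2
    have h6 : t ^ 2 = (t * Real.sin η) ^ 2 + (t * Real.cos η) ^ 2 := by
      linear_combination -t ^ 2 * hsc
    have h7 : W.kap ^ 2 * W.si ^ 2 + W.kap ^ 2 * W.co ^ 2 = W.kap ^ 2 := by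
      linear_combination W.kap ^ 2 * hss
    linarith
  -- When cos η < 0 its upper bound gives nothing. Instead η < θ forces sin²η > si², against the
  -- bound on t sin η.
  · have h5 := W.neg_co_lt_cos (t := η) (by rwa [abs_of_nonneg h0])
    have h6 : Real.cos η ^ 2 < W.co ^ 2 := by nlinarith
    have h7 : Real.sin η ^ 2 ≤ (t * Real.sin η) ^ 2 := by
      rw [mul_pow]
      nlinarith [sq_nonneg (Real.sin η)]
    nlinarith

/-- The open set on which the algebraic branch maps into the unit disc. -/
def contSet : Set ℂ := {y | y ≠ 1 ∧ 1 - W.Z y ∈ slitPlane ∧ 1 + W.Z y ∈ slitPlane ∧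
  W.kap * W.co < (W.Uy y).re}

theorem differentiableAt_Uy {y : ℂ} (h : y ≠ 1) (h1 : 1 - W.Z y ∈ slitPlane)
    (h2 : 1 + W.Z y ∈ slitPlane) : DifferentiableAt ℂ W.Uy y := by
  have hZ := (W.hasDerivAt_Z h).differentiableAt
  exact (hZ.const_mul _).add (((differentiableAt_rootOne h1 h2).comp y hZ).const_mul _)

theorem isOpen_contSet : IsOpen W.contSet := by
  have hZ : ContinuousOn W.Z {1}ᶜ := fun y hy =>
    (W.hasDerivAt_Z hy).continuousAt.continuousWithinAt
  have h1 : IsOpen ({1}ᶜ ∩ (fun y => 1 - W.Z y) ⁻¹' slitPlane) :=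
    (continuousOn_const.sub hZ).isOpen_inter_preimage isOpen_compl_singleton isOpen_slitPlane
  have h2 : IsOpen ({1}ᶜ ∩ (fun y => 1 + W.Z y) ⁻¹' slitPlane) :=
    (continuousOn_const.add hZ).isOpen_inter_preimage isOpen_compl_singleton isOpen_slitPlane
  have h3 : ContinuousOn (fun y => (W.Uy y).re) (({1}ᶜ ∩ (fun y => 1 - W.Z y) ⁻¹' slitPlane) ∩
      ({1}ᶜ ∩ (fun y => 1 + W.Z y) ⁻¹' slitPlane)) := fun y hy =>
    (continuous_re.continuousAt.comp
      (W.differentiableAt_Uy hy.1.1 hy.1.2 hy.2.2).continuousAt).continuousWithinAt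
  convert h3.isOpen_inter_preimage (h1.inter h2) (isOpen_Ioi (a := W.kap * W.co)) using 1
  ext y
  simp only [contSet, Set.mem_ofPred_eq, Set.mem_inter_iff, Set.mem_compl_iff,
    Set.mem_singleton_iff, Set.mem_preimage, Set.mem_Ioi]
  tauto

theorem mem_contSet {y w : ℂ} (hy : y ≠ 1) (h0 : 0 < w.im) (h1 : w.im < Real.pi)
    (h : cosh w = W.Z y) (h2 : W.kap * W.co < Real.cosh w.re * Real.cos (w.im - W.ang)) :
    y ∈ W.contSet := by
  refine ⟨hy, ?_, ?_, ?_⟩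
  · rw [← h]
    exact one_sub_cosh_mem_slitPlane h0 h1
  · rw [← h]
    exact one_add_cosh_mem_slitPlane (by rwa [abs_of_pos h0])
  · rwa [W.Uy_re h0 h1 h]

/-- Where the power series in y is unavailable, the branch x(y) lies in the unit disc, by `cover`
with η = θ - Im w. -/
theorem mem_contSet_of_one_le_norm {y : ℂ} (hy : y ≠ 1) (hl : 0 ≤ W.level y) (h : 1 ≤ ‖y‖) :
    y ∈ W.contSet := by
  have hZ : (W.Z y).re ≤ W.kap * (1 - 2 * W.co ^ 2) :=
    not_lt.1 fun h1 => not_lt.2 h ((W.norm_lt_one_iff hy).2 h1)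
  obtain ⟨w, hw, h0, h1⟩ : ∃ w : ℂ, |w.im| ≤ W.ang ∧ 0 ≤ w.im ∧ cosh w = W.Z y := by
    obtain ⟨w, hw, h1, -⟩ := W.exists_strip hy hl
    rcases le_total 0 w.im with h2 | h2
    · exact ⟨w, hw, h2, h1⟩
    · exact ⟨-w, by rwa [neg_im, abs_neg], by rw [neg_im]; linarith, by rw [cosh_neg, h1]⟩
  rw [abs_of_nonneg h0] at hw
  have hp := W.ang_lt_pi
  have ht := Real.one_le_cosh w.re
  rw [← h1, cosh_re] at hZ
  -- For real w, Re Z ≥ 1 would place y inside the unit disc. So the cut of √(1 - Z²) is avoided.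
  have h3 : 0 < w.im := by
    refine lt_of_le_of_ne h0 fun h3 => ?_
    rw [← h3, Real.cos_zero, mul_one] at hZ
    have := W.kap_mul_lt (t := 1 - 2 * W.co ^ 2) (by linarith [W.two_co_sq_le])
      (by nlinarith [sq_nonneg W.co])
    linarith
  apply W.mem_contSet hy h3 (by linarith) h1
  rw [← Real.cos_neg, neg_sub]
  apply W.cover ht (by linarith) (by linarith)
  rwa [sub_sub_cancel]

/-- On the curve, `Z` is given by a point on the upper edge of the strip. -/
theorem exists_edge {y : ℂ} (hy : y ≠ 1) (hl : W.level y = 0) :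
    ∃ τ : ℝ, cosh (τ + W.ang * I) = W.Z y := by
  obtain ⟨w, hw, h1, -, h2⟩ := W.exists_strip hy hl.ge
  have h3 := h2 hl
  rcases abs_eq W.ang_pos.le |>.1 h3 with h4 | h4
  · exact ⟨w.re, by rw [← h4, re_add_im, h1]⟩
  · refine ⟨-w.re, ?_⟩
    rw [← h1, ← cosh_neg w]
    congr 1
    apply Complex.ext <;> simp [h4]

theorem edge_mem_contSet {y : ℂ} {τ : ℝ} (hy : y ≠ 1) (h : cosh (τ + W.ang * I) = W.Z y) :
    y ∈ W.contSet := by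
  apply W.mem_contSet hy (w := τ + W.ang * I) (by simpa using W.ang_pos)
    (by simpa using W.ang_lt_pi) h
  have e : ((τ : ℂ) + W.ang * I).im - W.ang = 0 := by simp
  rw [e, Real.cos_zero, mul_one]
  exact (W.kap_mul_lt W.co_pos.le W.co_lt_one.le).trans_le (Real.one_le_cosh _)

theorem edge_Uy {y : ℂ} {τ : ℝ} (h : cosh (τ + W.ang * I) = W.Z y) : W.Uy y = cosh τ := by
  rw [W.Uy_eq (w := τ + W.ang * I) (by simpa using W.ang_pos) (by simpa using W.ang_lt_pi) h,
    add_sub_cancel_right]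

theorem add_xA_ne {u : ℂ} (hu : W.kap * W.co < u.re) : u + W.xA ≠ 0 := by
  intro h0
  have := congrArg re h0
  rw [add_re, ofReal_re, zero_re] at this
  linarith [W.xB_sub_xA, W.xA_pos, W.xB_pos]

theorem norm_xOf_lt {u : ℂ} (hu : W.kap * W.co < u.re) : ‖W.xOf u‖ < 1 := by
  have h0 := W.add_xA_ne hu
  rw [xOf, norm_div, div_lt_one (norm_pos_iff.2 h0),
    norm_lt_norm_iff u (add_pos W.xA_pos W.xB_pos)]
  linarith [W.xB_sub_xA]

theorem differentiableAt_xOf {u : ℂ} (hu : u + W.xA ≠ 0) : DifferentiableAt ℂ W.xOf u :=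
  (differentiableAt_id.sub_const _).div (differentiableAt_id.add_const _) hu

/-- The constant in the derivative of the kernel on the algebraic branch. -/
noncomputable def dconst : ℂ :=
  2 * (W.b + W.c) * (W.xA + W.xB) * W.si / (W.yA + W.yB) ^ 2

theorem dconst_ne : W.dconst ≠ 0 := by
  have hbc : (W.b : ℂ) + W.c ≠ 0 := by exact_mod_cast W.pos.ne'
  have hs : (W.si : ℂ) ≠ 0 := by exact_mod_cast W.si_pos.ne'
  exact div_ne_zero (mul_ne_zero (mul_ne_zero (mul_ne_zero two_ne_zero hbc) W.xAB_ne) hs)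
    (pow_ne_zero _ W.AB_ne)

/-- The derivative of the kernel on the algebraic branch. -/
theorem kernel_deriv_branch {y : ℂ} (hy : y ≠ 1) (hu : W.Uy y + W.xA ≠ 0) :
    2 * W.xOf (W.Uy y) * (W.c * y ^ 2 + W.b * y) + ((W.s - W.c) * y ^ 2 - y + (W.s - W.b)) =
      W.dconst * ((1 - y) ^ 2 * rootOne (W.Z y)) := by
  have e := kernel_deriv_identity (b := (W.b : ℂ)) (c := (W.c : ℂ)) (s := (W.s : ℂ))
    (k := (W.k : ℂ)) (C := (W.co : ℂ)) (x := W.xOf (W.Uy y)) (y := y)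
    (by exact_mod_cast W.total) (by exact_mod_cast W.co_sq) (by exact_mod_cast W.k_sq)
    (A := W.yA) (B := W.yB) (A' := W.xA) (B' := W.xB)
    (by rw [yA]; push_cast; rfl) (by rw [yB]; push_cast; rfl) (by rw [xA]; push_cast; rfl)
    (by rw [xB]; push_cast; rfl)
  have h1 := sub_ne_zero.2 hy.symm
  have h2 : (W.yA : ℂ) * y + W.yB = W.Z y * (1 - y) := (div_mul_cancel₀ _ h1).symm
  have h3 : (W.xA : ℂ) * W.xOf (W.Uy y) + W.xB = W.Uy y * (1 - W.xOf (W.Uy y)) := by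
    rw [xOf]
    field_simp
    ring
  have h4 : (1 - W.xOf (W.Uy y)) * (W.Uy y + W.xA) = W.xA + W.xB := by
    rw [W.one_sub_xOf hu, div_mul_cancel₀ _ hu]
  have h5 := W.Uy_quadratic y
  have h6 : W.Uy y + W.co * W.Z y = W.si * rootOne (W.Z y) := by rw [Uy]; ring
  have h7 := pow_ne_zero 2 W.AB_ne
  rw [dconst, div_mul_eq_mul_div, eq_div_iff h7, mul_comm _ (((W.yA : ℂ) + W.yB) ^ 2), e, h2, h3]
  linear_combination (-2 * (W.b + W.c) * (1 - W.xOf (W.Uy y)) * (1 - y) ^ 2) * h5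
    + 2 * (W.b + W.c) * (1 - y) ^ 2 * (W.Uy y + W.co * W.Z y) * h4
    + 2 * (W.b + W.c) * (W.xA + W.xB) * (1 - y) ^ 2 * h6

/-- The derivative of `G` on the edge. -/
theorem deriv_G_edge {y : ℂ} {τ : ℝ} (hy : y ≠ 1) (h : cosh (τ + W.ang * I) = W.Z y) :
    deriv W.G y * ((1 - y) ^ 2 * rootOne (W.Z y)) =
      (W.chi / 2 : ℝ) * (W.yA + W.yB) * cosh ((W.chi / 2 : ℝ) * τ) := by
  set w : ℂ := τ + W.ang * I with hw
  have h0 : w.im = W.ang := by simp [hw]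
  have hp : 0 < w.im := h0 ▸ W.ang_pos
  have hl : w.im < Real.pi := h0 ▸ W.ang_lt_pi
  have ha : |w.im| < Real.pi := by rwa [abs_of_pos hp]
  have hne : w ≠ 0 := fun h1 => by rw [h1, zero_im] at hp; exact lt_irrefl _ hp
  have hs := sinh_ne_zero_of_strip ha hne
  have h1 := hasDerivAt_coshPow (W.chi / 2) ha hne
  rw [h] at h1
  have e : deriv W.G y = _ := (h1.comp y (W.hasDerivAt_Z hy)).deriv
  have h2 := sub_ne_zero.2 hy.symm
  -- On the edge χw/2 = χτ/2 + iπ/2, and the quarter-period shift turns sinh into i cosh, which is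
  -- even in τ.
  have h3 : sinh (((W.chi / 2 : ℝ) : ℂ) * w) = I * cosh ((W.chi / 2 : ℝ) * τ) := by
    have : ((W.chi / 2 : ℝ) : ℂ) * w = (W.chi / 2 : ℝ) * τ + (Real.pi / 2 : ℝ) * I := by
      rw [← W.chi_mul_ang, hw]
      push_cast
      ring
    rw [this, sinh_add, cosh_mul_I, sinh_mul_I, ← ofReal_cos, ← ofReal_sin,
      Real.cos_pi_div_two, Real.sin_pi_div_two]
    push_cast
    ring
  rw [e, ← h, rootOne_cosh hp hl, h3]
  field_simp
  linear_combination (-((W.chi / 2 : ℝ) : ℂ) * (W.yA + W.yB) * cosh ((W.chi / 2 : ℝ) * τ)) * I_sq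

/-- The continuation of the diagonal series by the functional equation. -/
noncomputable def diagExt (f : ℤ → ℤ → ℝ) (y : ℂ) : ℂ :=
  (2 * ((W.s - W.b) * W.xOf (W.Uy y) + W.b) * row f 1 (W.xOf (W.Uy y))
    + (W.s - W.b) * coef f 0 1) / (W.dconst * ((1 - y) ^ 2 * rootOne (W.Z y)))

open Classical in
/-- The diagonal series and its continuation. -/
noncomputable def diagFun (f : ℤ → ℤ → ℝ) (y : ℂ) : ℂ :=
  if ‖y‖ < 1 then diag f y else W.diagExt f y

theorem denom_ne {y : ℂ} (hy : y ∈ W.contSet) :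
    W.dconst * ((1 - y) ^ 2 * rootOne (W.Z y)) ≠ 0 :=
  mul_ne_zero W.dconst_ne (mul_ne_zero (pow_ne_zero _ (sub_ne_zero.2 hy.1.symm))
    (rootOne_ne_zero hy.2.1 hy.2.2.1))

/-- The product of the two factors is symmetric on the curve. -/
theorem ratio_mul_diagExt_edge (f : ℤ → ℤ → ℝ) {y : ℂ} {τ : ℝ} (hy : y ≠ 1)
    (h : cosh (τ + W.ang * I) = W.Z y) :
    W.ratio y * W.diagExt f y = (W.G y ^ 2 - W.cz ^ 2) *
      (2 * ((W.s - W.b) * W.xOf (cosh τ) + W.b) * row f 1 (W.xOf (cosh τ))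
        + (W.s - W.b) * coef f 0 1) /
      (2 * W.cz * W.dconst * ((W.chi / 2 : ℝ) * (W.yA + W.yB) * cosh ((W.chi / 2 : ℝ) * τ))) := by
  rw [← W.deriv_G_edge hy h, ratio, diagExt, W.edge_Uy h, div_mul_div_comm]
  congr 1
  ring

end Weights

/-! ### Continuation of the diagonal series and the boundary condition -/

namespace Weights.Of

variable {W : Weights} {p f : ℤ → ℤ → ℝ} (h : W.Of p) (hf : IsSymmPosHarmonic p f)

include h hf

/-- Where |y| < 1 as well, (x(y), y) is a zero of the kernel in the unit bidisc, so the functional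
equation identifies the two definitions. -/
theorem diagFun_eq {y : ℂ} (hy : y ∈ W.contSet) : W.diagFun f y = W.diagExt f y := by
  rw [Weights.diagFun]
  split_ifs with h1
  · have hu := W.add_xA_ne hy.2.2.2
    have hK : kernel (phi p) (W.xOf (W.Uy y)) y = 0 := by
      rw [h.kernel_eq_zero_iff (W.xOf_ne_one hu) hy.1, W.U_xOf hu]
      exact W.Uy_quadratic y
    have e := functional_equation h hf (W.norm_xOf_lt hy.2.2.2) h1 hK
    rw [W.kernel_deriv_branch hy.1 hu] at e
    rw [Weights.diagExt, eq_div_iff (W.denom_ne hy), e]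
  · rfl

theorem differentiableAt_diagExt {y : ℂ} (hy : y ∈ W.contSet) :
    DifferentiableAt ℂ (W.diagExt f) y := by
  have hU := W.differentiableAt_Uy hy.1 hy.2.1 hy.2.2.1
  have hZ := (W.hasDerivAt_Z hy.1).differentiableAt
  have hX : DifferentiableAt ℂ (fun y => W.xOf (W.Uy y)) y :=
    (W.differentiableAt_xOf (W.add_xA_ne hy.2.2.2)).comp y hU
  have hr : DifferentiableAt ℂ (fun y => row f 1 (W.xOf (W.Uy y))) y :=
    DifferentiableAt.comp (g := row f 1) y ((differentiableOn_row h hf).differentiableAt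
      (Metric.isOpen_ball.mem_nhds (mem_ball_zero_iff.2 (W.norm_xOf_lt hy.2.2.2)))) hX
  have h1 : DifferentiableAt ℂ (fun y => rootOne (W.Z y)) y :=
    (differentiableAt_rootOne hy.2.1 hy.2.2.1).comp y hZ
  exact (((((hX.const_mul _).add_const _).const_mul _).mul hr).add_const _).div
    ((((differentiableAt_id.const_sub 1).pow 2).mul h1).const_mul _) (W.denom_ne hy)

theorem analyticOnNhd_diagFun : AnalyticOnNhd ℂ (W.diagFun f) (W.contSet ∪ Metric.ball 0 1) := by
  apply DifferentiableOn.analyticOnNhd _ (W.isOpen_contSet.union Metric.isOpen_ball)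
  rintro y (hy | hy)
  · refine ((differentiableAt_diagExt h hf hy).congr_of_eventuallyEq ?_).differentiableWithinAt
    filter_upwards [W.isOpen_contSet.mem_nhds hy] with z hz using diagFun_eq h hf hz
  · refine (((differentiableOn_diag h hf).differentiableAt
      (Metric.isOpen_ball.mem_nhds hy)).congr_of_eventuallyEq ?_).differentiableWithinAt
    filter_upwards [Metric.isOpen_ball.mem_nhds hy] with z hz
    rw [Weights.diagFun, if_pos (mem_ball_zero_iff.1 hz)]

omit h hf in
theorem level_nonneg_subset : {y | 0 ≤ W.level y} \ {1} ⊆ W.contSet ∪ Metric.ball 0 1 := by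
  rintro y ⟨hy, h1⟩
  by_cases h2 : ‖y‖ < 1
  · exact Or.inr (mem_ball_zero_iff.2 h2)
  · exact Or.inl (W.mem_contSet_of_one_le_norm h1 hy (not_lt.1 h2))

theorem hasSum_diagFun {y : ℂ} (hy : ‖y‖ < 1) :
    HasSum (fun n : ℕ => (f (n + 1) (n + 1) : ℂ) * y ^ n) (W.diagFun f y) := by
  rw [Weights.diagFun, if_pos hy]
  refine (hasSum_diag h hf hy).congr_fun fun n => ?_
  rw [coef_eq (i := n + 1) (j := n + 1) (by push_cast; ring) (by push_cast; ring),
    extend_eq hf (Or.inl (by positivity))]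

/-- Conjugation on the curve is τ ↦ -τ on the upper edge. The product involves only cosh τ,
cosh(χτ/2) and G², and all three are invariant. -/
theorem ratio_mul_diagFun {y : ℂ} (h1 : y ≠ 1) (hy : W.level y = 0) :
    W.ratio y * W.diagFun f y =
      W.ratio (starRingEnd ℂ y) * W.diagFun f (starRingEnd ℂ y) := by
  obtain ⟨τ, hτ⟩ := W.exists_edge h1 hy
  have h1' : starRingEnd ℂ y ≠ 1 := fun h2 => h1 (by
    rw [← Complex.conj_conj y, h2, map_one])
  have hτ' : cosh ((-τ : ℝ) + W.ang * I) = W.Z (starRingEnd ℂ y) := by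
    rw [W.Z_conj, ← hτ, ← cosh_conj, ← cosh_neg]
    congr 1
    simp
    ring
  rw [diagFun_eq h hf (W.edge_mem_contSet h1 hτ), diagFun_eq h hf (W.edge_mem_contSet h1' hτ'),
    W.ratio_mul_diagExt_edge f h1 hτ, W.ratio_mul_diagExt_edge f h1' hτ', W.G_conj_eq_neg h1 hy,
    ofReal_neg, cosh_neg, mul_neg, cosh_neg, neg_sq]

end Weights.Of

end ThreeQuadrants

/-! ### The lemma assembled -/

theorem mainTheorem4 (p f : ℤ → ℤ → ℝ) (hp : ThreeQuadrants.IsAdmissibleStep p)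
    (hf : ThreeQuadrants.IsSymmPosHarmonic p f) :
    frontier (ThreeQuadrants.domainL (ThreeQuadrants.phi p)) =
      ThreeQuadrants.curveL (ThreeQuadrants.phi p) ∧
    ThreeQuadrants.IsConformalGluing (ThreeQuadrants.domainL (ThreeQuadrants.phi p))
      (ThreeQuadrants.curveL (ThreeQuadrants.phi p))
      (ThreeQuadrants.gluingw (ThreeQuadrants.phi p)) ∧
    AnalyticOnNhd ℂ (ThreeQuadrants.gFun (ThreeQuadrants.phi p))
      (ThreeQuadrants.domainL (ThreeQuadrants.phi p)) ∧
    (∀ y ∈ ThreeQuadrants.domainL (ThreeQuadrants.phi p),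
      deriv (ThreeQuadrants.gFun (ThreeQuadrants.phi p)) y ≠ 0) ∧
    ∃ D R : ℂ → ℂ,
      -- `D` is the sum of the diagonal series in the unit disc, and its continuation
      (∀ y ∈ Metric.ball (0 : ℂ) 1,
        HasSum (fun n : ℕ => (f (n + 1) (n + 1) : ℂ) * y ^ n) (D y)) ∧
      AnalyticOnNhd ℂ D
        (ThreeQuadrants.domainL (ThreeQuadrants.phi p) ∪ Metric.ball (0 : ℂ) 1) ∧
      ContinuousOn D (closure (ThreeQuadrants.domainL (ThreeQuadrants.phi p)) \ {1}) ∧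
      -- `R` is `g / g'` in the domain, extended by its finite limits on the curve
      (∀ y ∈ ThreeQuadrants.domainL (ThreeQuadrants.phi p),
        R y = ThreeQuadrants.gFun (ThreeQuadrants.phi p) y /
          deriv (ThreeQuadrants.gFun (ThreeQuadrants.phi p)) y) ∧
      ContinuousOn R (closure (ThreeQuadrants.domainL (ThreeQuadrants.phi p)) \ {1}) ∧
      ∀ y ∈ ThreeQuadrants.curveL (ThreeQuadrants.phi p) \ {1},
        R y * D y - R (starRingEnd ℂ y) * D (starRingEnd ℂ y) = 0 := by
  obtain ⟨W, h⟩ := hp.exists_weights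
  have hg := h.isConformalGluing
  have hsub := ThreeQuadrants.Weights.Of.level_nonneg_subset (W := W)
  rw [h.domainL_eq, h.curveL_eq] at hg ⊢
  refine ⟨W.frontier_domain, hg, h.analyticOnNhd_gFun, fun y hy => h.deriv_gFun_ne_zero hy,
    W.diagFun f, W.ratio, fun y hy => h.hasSum_diagFun hf (mem_ball_zero_iff.1 hy), ?_, ?_,
    fun y hy => h.ratio_eq hy, W.continuousOn_ratio.mono W.closure_subset_region, ?_⟩
  · refine (h.analyticOnNhd_diagFun hf).mono (Set.union_subset (fun y hy => ?_)
      Set.subset_union_right)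
    exact hsub ⟨le_of_lt (show 0 < W.level y from hy), W.ne_one_of_level_pos hy⟩
  · rw [W.closure_domain]
    exact (h.analyticOnNhd_diagFun hf).continuousOn.mono hsub
  · rintro y ⟨hy, h1⟩
    exact sub_eq_zero.2 (h.ratio_mul_diagFun hf h1 hy)
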